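/- Let $\mathfrak n\in\{\mathfrak{so}(3),\mathfrak{so}(2,1)\}$ (real Lie algebras), let $\mathfrak g=\mathfrak n\oplus\mathbb R$ be the direct sum of Lie algebras, let $g$ be a Lorentzian inner product on $\mathfrak g$ (signature $(3,1)$, one minus sign) such that $g|_{\mathfrak n}$ is non-degenerate, and let $H\in\Lambda^3\mathfrak g^*$ be closed. Let $E=\mathfrak g\oplus\mathfrak g^*$ with pairing $\langle X+\xi,Y+\eta\rangle=\frac12(\eta(X)+\xi(Y))$, bracket $[X+\xi,Y+\eta]_H=[X,Y]+\mathcal L_X\eta-\iota_Y d\xi+H(X,Y,\cdot)$, involution $\mathcal G_g(X+\xi)=g^{-1}\xi+gX$ and $\pm1$-eigenspaces $E_\pm$ of $\mathcal G_g$. A generalised Levi-Civita connection is a linear map $D:E\to\mathrm{End}(E)$, $u\mapsto D_u$, such that every $D_u$ is skew for $\langle\cdot,\cdot\rangle$ and commutes with $\mathcal G_g$, and $D_uv-D_vu-[u,v]_H+(Du)^*v=0$ for all $u,v\in E$, where $(Du)^*$ is the adjoint of $Du:w\mapsto D_wu$. Its divergence operator is $\delta_D(e)=\mathrm{tr}(u\mapsto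 D_ue)$, and its generalised Ricci curvatures are $\mathcal{RC}^{\pm}_D(v,w)=\mathrm{tr}\bigl(E_\pm\ni u\mapsto D_uD_vw-D_vD_uw-D_{[u,v]_H}w\in E_\pm\bigr)$ for $v\in E_\mp$, $w\in E_\pm$. For $\delta\in E^*$, call $(\mathfrak g,H,\mathcal G_g,\delta)$ generalised Einstein if generalised Levi-Civita connections $D$ with $\delta_D=\delta$ exist and $\mathcal{RC}^+_D=0$, $\mathcal{RC}^-_D=0$ for every such $D$. Then $(\mathfrak g,H,\mathcal G_g,\delta=0)$ is generalised Einstein if and only if one of the following holds. (i) $\mathfrak n=\mathfrak{so}(3)$ is Riemannian (i.e. $g|_{\mathfrak n}$ is positive definite), and there are $a\in\mathbb R\setminus\{0\}$, $b\in\mathbb R$, $\epsilon\in\{-1,1\}$ and an orthonormal basis $(e_1,\dots,e_4)$ of $\mathfrak g$ such that $(e_1,e_2,e_3)$ is a basis of $\mathfrak n$, $H=a\,e^{123}$ and, up to anti-symmetry, the only non-zero brackets are $[e_1,e_2]=\epsilon a e_3$, $[e_2,e_3]=\epsilon a e_1$, $[e_3,e_1]=\epsilon a e_2$, $[e_3,e_4]=b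 e_2$, $[e_4,e_2]=b e_3$. (ii) $\mathfrak n=\mathfrak{so}(2,1)$ is Lorentzian, and there are $a\in\mathbb R\setminus\{0\}$, $\epsilon\in\{-1,1\}$ and an orthonormal basis $(e_1,\dots,e_4)$ of $\mathfrak g$ such that $(e_1,e_2,e_3)$ is a basis of $\mathfrak n$, $g(e_1,e_1)=-1$, $H=a\,e^{123}$ and, up to anti-symmetry, the only non-zero brackets are $[e_1,e_2]=\epsilon a e_3$, $[e_2,e_3]=-\epsilon a e_1$, $[e_3,e_1]=\epsilon a e_2$ together with those of one of - $(\alpha)$ $[e_4,e_2]=b e_3$, $[e_4,e_3]=-b e_2$ for some $b\in\mathbb R$; - $(\beta)$ $[e_4,e_1]=b e_2$, $[e_4,e_2]=b e_1$ for some $b\in\mathbb R\setminus\{0\}$; - $(\gamma)$ $[e_4,e_1]=e_2$, $[e_4,e_2]=e_1+e_3$, $[e_4,e_3]=-e_2$. The families (i), $(\alpha)$, $(\beta)$, $(\gamma)$ are mutually exclusive. Moreover, if $X\in\mathfrak n^\perp$ with $g(X,X)\in\{-1,1\}$ and $Y_0$ is the projection of $X$ to $\mathfrak n$ along $\mathbb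 R$, then $g(Y_0,Y_0)<0$ or $Y_0=0$ in case $(\alpha)$, $g(Y_0,Y_0)>0$ in case $(\beta)$, and $g(Y_0,Y_0)=0$ with $Y_0\neq0$ in case $(\gamma)$. -/

import Mathlib

open Module

noncomputable section

namespace GenGeom

/-- The Lie algebra `ℝ`: the bracket is the commutator of the commutative ring `ℝ`, so it is zero. -/
instance realLieRing : LieRing ℝ := LieRing.ofAssociativeRing

instance realLieAlgebra : LieAlgebra ℝ ℝ where
  lie_smul t x y := by simp only [Ring.lie_def, smul_eq_mul]; ring

theorem real_lie_eq_zero (x y : ℝ) : ⁅x, y⁆ = 0 := by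
  rw [Ring.lie_def]; ring

/-- The Lie algebra `so(3)` of skew-symmetric real `3 × 3` matrices. -/
abbrev SO3 : Type := LieAlgebra.Orthogonal.so (Fin 3) ℝ

/-- The Lie algebra `so(2,1)` of real `3 × 3` matrices that are skew with respect to
`diag(1, 1, -1)`. -/
abbrev SO21 : Type := LieAlgebra.Orthogonal.so' (Fin 2) (Fin 1) ℝ

/-- A symmetric bilinear form on a real vector space of dimension `n + 1` is Lorentzian if it has
signature `(n, 1)` (`n` plus signs, one minus sign). -/
def IsLorentzian {V : Type*} [AddCommGroup V] [Module ℝ V] (B : LinearMap.BilinForm ℝ V) : Prop :=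
  ∃ (n : ℕ) (e : Basis (Fin (n + 1)) ℝ V), ∀ i j,
    B (e i) (e j) = if i = j then (if i = 0 then -1 else 1) else 0

/-- A bilinear form is Riemannian (as a form on that space) if it is positive definite. -/
def IsRiemannian {V : Type*} [AddCommGroup V] [Module ℝ V] (B : LinearMap.BilinForm ℝ V) : Prop :=
  ∀ x, x ≠ 0 → 0 < B x x

section LieAlg

variable {𝔤 : Type*} [LieRing 𝔤] [LieAlgebra ℝ 𝔤]

/-- A three-form on a Lie algebra is closed if its Chevalley-Eilenberg differential
`dH(x₀,x₁,x₂,x₃) = ∑_{i<j} (-1)^{i+j} H([xᵢ,xⱼ], …)` vanishes. -/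
def IsClosedThreeForm (H : 𝔤 [⋀^Fin 3]→ₗ[ℝ] ℝ) : Prop :=
  ∀ w x y z : 𝔤,
    - H ![⁅w, x⁆, y, z] + H ![⁅w, y⁆, x, z] - H ![⁅w, z⁆, x, y]
    - H ![⁅x, y⁆, w, z] + H ![⁅x, z⁆, w, y] - H ![⁅y, z⁆, w, x] = 0

variable (𝔤) in
/-- A generalised pseudo-Riemannian metric `(H, 𝒢_g)` on a Lie algebra: a closed three-form `H` and
a pseudo-Riemannian metric `g` (which determines `𝒢_g`, see `GenMetric.G`). -/
structure GenMetric where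
  H : 𝔤 [⋀^Fin 3]→ₗ[ℝ] ℝ
  closed : IsClosedThreeForm H
  g : LinearMap.BilinForm ℝ 𝔤
  symm : g.IsSymm
  nondeg : g.Nondegenerate

variable (𝔤) in
/-- The generalised tangent space `E = 𝔤 ⊕ 𝔤*`. -/
abbrev E : Type _ := 𝔤 × Dual ℝ 𝔤

/-- The pairing `⟨X + ξ, Y + η⟩ = (η(X) + ξ(Y)) / 2` on `E`. -/
def pairing (u v : E 𝔤) : ℝ := (v.2 u.1 + u.2 v.1) / 2

/-- The one-form `H(X, Y, ·)`. -/
def contract₂ (H : 𝔤 [⋀^Fin 3]→ₗ[ℝ] ℝ) (X Y : 𝔤) : Dual ℝ 𝔤 where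
  toFun Z := H ![X, Y, Z]
  map_add' Z W := by
    have h := H.map_update_add ![X, Y, 0] 2 Z W
    have e : ∀ V : 𝔤, Function.update ![X, Y, 0] 2 V = ![X, Y, V] := by
      intro V; ext i; fin_cases i <;> rfl
    simpa only [e] using h
  map_smul' c Z := by
    have h := H.map_update_smul ![X, Y, 0] 2 c Z
    have e : ∀ V : 𝔤, Function.update ![X, Y, 0] 2 V = ![X, Y, V] := by
      intro V; ext i; fin_cases i <;> rfl
    simpa only [e, RingHom.id_apply] using h

/-- The coadjoint action `ℒ_X η = X ⌟ dη = -η([X, ·])` on left-invariant one-forms. -/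
def coad (X : 𝔤) (η : Dual ℝ 𝔤) : Dual ℝ 𝔤 := -(η ∘ₗ (LieAlgebra.ad ℝ 𝔤 X : 𝔤 →ₗ[ℝ] 𝔤))

/-- The `H`-twisted Dorfman bracket
`[X + ξ, Y + η]_H = [X, Y] + ℒ_X η - Y ⌟ dξ + H(X, Y, ·)` on `E`. -/
def dorfman (H : 𝔤 [⋀^Fin 3]→ₗ[ℝ] ℝ) (u v : E 𝔤) : E 𝔤 :=
  (⁅u.1, v.1⁆, coad u.1 v.2 - coad v.1 u.2 + contract₂ H u.1 v.1)

namespace GenMetric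

variable [FiniteDimensional ℝ 𝔤] (M : GenMetric 𝔤)

/-- The endomorphism `𝒢_g (X + ξ) = g⁻¹ ξ + g X` of `E`. -/
def G : E 𝔤 →ₗ[ℝ] E 𝔤 :=
  LinearMap.prod
    ((M.g.toDual M.nondeg).symm.toLinearMap ∘ₗ LinearMap.snd ℝ 𝔤 (Dual ℝ 𝔤))
    ((M.g.toDual M.nondeg).toLinearMap ∘ₗ LinearMap.fst ℝ 𝔤 (Dual ℝ 𝔤))

theorem G_G (u : E 𝔤) : M.G (M.G u) = u := by
  simp [G]

/-- The `+1`-eigenspace `E₊` of `𝒢_g`. -/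
def Eplus : Submodule ℝ (E 𝔤) := End.eigenspace M.G 1

/-- The `-1`-eigenspace `E₋` of `𝒢_g`. -/
def Eminus : Submodule ℝ (E 𝔤) := End.eigenspace M.G (-1)

/-- The projection `π₊ = (1 + 𝒢_g) / 2 : E → E₊` along `E₋`. -/
def piPlus : E 𝔤 →ₗ[ℝ] M.Eplus :=
  LinearMap.codRestrict M.Eplus ((2⁻¹ : ℝ) • (LinearMap.id + M.G)) (by
    intro u
    rw [Eplus, End.mem_eigenspace_iff]
    simp only [LinearMap.smul_apply, LinearMap.add_apply, LinearMap.id_apply, map_smul, map_add,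
      G_G, one_smul]
    rw [add_comm])

/-- The projection `π₋ = (1 - 𝒢_g) / 2 : E → E₋` along `E₊`. -/
def piMinus : E 𝔤 →ₗ[ℝ] M.Eminus :=
  LinearMap.codRestrict M.Eminus ((2⁻¹ : ℝ) • (LinearMap.id - M.G)) (by
    intro u
    rw [Eminus, End.mem_eigenspace_iff]
    simp only [LinearMap.smul_apply, LinearMap.sub_apply, LinearMap.id_apply, map_smul, map_sub,
      G_G, neg_smul, one_smul]
    rw [← smul_neg, neg_sub])

/-- A (left-invariant) generalised connection on `E` is a linear map `D : E → End(E)`,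
`D u v = D_u v`, with every `D_u` skew for the pairing. It is a generalised Levi-Civita connection
of `𝒢_g` if it is torsion-free and commutes with `𝒢_g`. The torsion
`T_D(u,v) = D_u v - D_v u - [u,v]_H + A^* v`, where `A^*` is the adjoint of `A : w ↦ D_w u` for the
pairing, is paired with an arbitrary `w`; so its last term contributes `⟨v, D_w u⟩`. -/
structure IsLeviCivita (D : E 𝔤 →ₗ[ℝ] E 𝔤 →ₗ[ℝ] E 𝔤) : Prop where
  skew : ∀ u v w, pairing (D u v) w + pairing v (D u w) = 0
  torsion : ∀ u v w,
    pairing (D u v - D v u - dorfman M.H u v) w + pairing v (D w u) = 0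
  metric : ∀ u v, D u (M.G v) = M.G (D u v)

/-- The divergence operator `δ_D(e) = tr (u ↦ D_u e)` of a generalised connection. -/
def divergence (D : E 𝔤 →ₗ[ℝ] E 𝔤 →ₗ[ℝ] E 𝔤) (e : E 𝔤) : ℝ :=
  LinearMap.trace ℝ (E 𝔤) (D.flip e)

/-- `D_u D_v w - D_v D_u w - D_{[u,v]_H} w`, as a linear function of `u`. -/
def curvature (D : E 𝔤 →ₗ[ℝ] E 𝔤 →ₗ[ℝ] E 𝔤) (v w : E 𝔤) : E 𝔤 →ₗ[ℝ] E 𝔤 where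
  toFun u := D u (D v w) - D v (D u w) - D (dorfman M.H u v) w
  map_add' u u' := by
    have h : dorfman M.H (u + u') v = dorfman M.H u v + dorfman M.H u' v := by
      have e : ∀ (H : 𝔤 [⋀^Fin 3]→ₗ[ℝ] ℝ) (X X' Y Z : 𝔤),
          H ![X + X', Y, Z] = H ![X, Y, Z] + H ![X', Y, Z] := by
        intro H X X' Y Z
        exact H.map_vecCons_add ![Y, Z] X X'
      ext Z
      · simp [dorfman]
      · simp [dorfman, coad, contract₂, e]; ring
    rw [h]; simp only [map_add, LinearMap.add_apply]; abel
  map_smul' c u := by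
    have h : dorfman M.H (c • u) v = c • dorfman M.H u v := by
      have e : ∀ (H : 𝔤 [⋀^Fin 3]→ₗ[ℝ] ℝ) (X Y Z : 𝔤),
          H ![c • X, Y, Z] = c * H ![X, Y, Z] := by
        intro H X Y Z
        exact H.map_vecCons_smul ![Y, Z] c X
      ext Z
      · simp [dorfman]
      · simp [dorfman, coad, contract₂, e]
    rw [h]; simp only [map_smul, LinearMap.smul_apply, RingHom.id_apply, smul_sub]

/-- The generalised Ricci curvature `RC⁺_D(v, w) = tr (E₊ ∋ u ↦ R_D(u, v) w ∈ E₊)`, for `v ∈ E₋`,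
`w ∈ E₊`. A metric `D` preserves `E₊`, so `π₊` only restricts the codomain. -/
def ricciPlus (D : E 𝔤 →ₗ[ℝ] E 𝔤 →ₗ[ℝ] E 𝔤) (v : M.Eminus) (w : M.Eplus) : ℝ :=
  LinearMap.trace ℝ M.Eplus
    (M.piPlus ∘ₗ M.curvature D (v : E 𝔤) (w : E 𝔤) ∘ₗ M.Eplus.subtype)

/-- The generalised Ricci curvature `RC⁻_D(v, w) = tr (E₋ ∋ u ↦ R_D(u, v) w ∈ E₋)`, for `v ∈ E₊`,
`w ∈ E₋`. -/
def ricciMinus (D : E 𝔤 →ₗ[ℝ] E 𝔤 →ₗ[ℝ] E 𝔤) (v : M.Eplus) (w : M.Eminus) : ℝ :=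
  LinearMap.trace ℝ M.Eminus
    (M.piMinus ∘ₗ M.curvature D (v : E 𝔤) (w : E 𝔤) ∘ₗ M.Eminus.subtype)

/-- `(𝔤, H, 𝒢_g, δ)` is generalised Einstein: there are generalised Levi-Civita connections with
divergence operator `δ`, and the generalised Ricci curvature of each of them vanishes. (That
curvature depends on the connection only through `δ`.) -/
def IsGeneralisedEinstein (δ : Dual ℝ (E 𝔤)) : Prop :=
  (∃ D, M.IsLeviCivita D ∧ ∀ e, divergence D e = δ e) ∧
  ∀ D, M.IsLeviCivita D → (∀ e, divergence D e = δ e) →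
    (∀ v w, M.ricciPlus D v w = 0) ∧ (∀ v w, M.ricciMinus D v w = 0)

end GenMetric

/-- The three-form `e^{123} = e¹ ∧ e² ∧ e³` built from the basis dual to `e` (indices in `Fin 4`
start at `0`); its value on the first three basis vectors is `1`. -/
def e123 (e : Basis (Fin 4) ℝ 𝔤) : 𝔤 [⋀^Fin 3]→ₗ[ℝ] ℝ :=
  (Matrix.detRowAlternating (n := Fin 3) (R := ℝ)).compLinearMap
    (LinearMap.pi fun i : Fin 3 => e.coord i.castSucc)

theorem e123_apply (e : Basis (Fin 4) ℝ 𝔤) (v : Fin 3 → 𝔤) :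
    e123 e v = (Matrix.of fun i j : Fin 3 => e.repr (v i) j.castSucc).det := rfl

end LieAlg

section Reductive

variable {𝔫 : Type*} [LieRing 𝔫] [LieAlgebra ℝ 𝔫] (M : GenMetric (𝔫 × ℝ))

/-- The restriction of `g` to the ideal `𝔫 ≅ 𝔫 × 0` of `𝔫 × ℝ`. -/
def GenMetric.gn : LinearMap.BilinForm ℝ 𝔫 :=
  M.g.compl₁₂ (LinearMap.inl ℝ 𝔫 ℝ) (LinearMap.inl ℝ 𝔫 ℝ)

/-- `e = (e₁, e₂, e₃, e₄)` is an orthonormal basis of `𝔫 × ℝ` such that `(e₁, e₂, e₃)` is a basis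
of `𝔫`, and `H = a e^{123}` with `a ≠ 0`. The indices in `Fin 4` start at `0`. -/
structure IsAdapted (a : ℝ) (e : Basis (Fin 4) ℝ (𝔫 × ℝ)) : Prop where
  ne_zero : a ≠ 0
  norm : ∀ i, M.g (e i) (e i) = 1 ∨ M.g (e i) (e i) = -1
  orthogonal : ∀ i j, i ≠ j → M.g (e i) (e j) = 0
  span : Submodule.span ℝ {e 0, e 1, e 2} = LinearMap.range (LinearMap.inl ℝ 𝔫 ℝ)
  H_eq : M.H = a • e123 e

/-- The family with `𝔫 ≅ so(3)` Riemannian. -/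
def FamilyRiemannian : Prop :=
  Nonempty (𝔫 ≃ₗ⁅ℝ⁆ SO3) ∧ IsRiemannian M.gn ∧
  ∃ (a b ε : ℝ) (e : Basis (Fin 4) ℝ (𝔫 × ℝ)), (ε = 1 ∨ ε = -1) ∧ IsAdapted M a e ∧
    ⁅e 0, e 1⁆ = (ε * a) • e 2 ∧ ⁅e 1, e 2⁆ = (ε * a) • e 0 ∧ ⁅e 2, e 0⁆ = (ε * a) • e 1 ∧
    ⁅e 2, e 3⁆ = b • e 1 ∧ ⁅e 3, e 1⁆ = b • e 2 ∧ ⁅e 3, e 0⁆ = 0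

/-- The data common to the families with `𝔫 ≅ so(2,1)` Lorentzian: the basis is adapted, `e₁` is
timelike, and the brackets of `e₁, e₂, e₃` are the stated ones. -/
structure IsLorentzianFrame (a ε : ℝ) (e : Basis (Fin 4) ℝ (𝔫 × ℝ)) : Prop where
  sign : ε = 1 ∨ ε = -1
  adapted : IsAdapted M a e
  timelike : M.g (e 0) (e 0) = -1
  lie01 : ⁅e 0, e 1⁆ = (ε * a) • e 2
  lie12 : ⁅e 1, e 2⁆ = -((ε * a) • e 0)
  lie20 : ⁅e 2, e 0⁆ = (ε * a) • e 1

/-- The family (α) with `𝔫 ≅ so(2,1)` Lorentzian. -/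
def FamilyAlpha : Prop :=
  Nonempty (𝔫 ≃ₗ⁅ℝ⁆ SO21) ∧ IsLorentzian M.gn ∧
  ∃ (a ε b : ℝ) (e : Basis (Fin 4) ℝ (𝔫 × ℝ)), IsLorentzianFrame M a ε e ∧
    ⁅e 3, e 0⁆ = 0 ∧ ⁅e 3, e 1⁆ = b • e 2 ∧ ⁅e 3, e 2⁆ = -(b • e 1)

/-- The family (β) with `𝔫 ≅ so(2,1)` Lorentzian. -/
def FamilyBeta : Prop :=
  Nonempty (𝔫 ≃ₗ⁅ℝ⁆ SO21) ∧ IsLorentzian M.gn ∧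
  ∃ (a ε b : ℝ) (e : Basis (Fin 4) ℝ (𝔫 × ℝ)), IsLorentzianFrame M a ε e ∧ b ≠ 0 ∧
    ⁅e 3, e 0⁆ = b • e 1 ∧ ⁅e 3, e 1⁆ = b • e 0 ∧ ⁅e 3, e 2⁆ = 0

/-- The family (γ) with `𝔫 ≅ so(2,1)` Lorentzian. -/
def FamilyGamma : Prop :=
  Nonempty (𝔫 ≃ₗ⁅ℝ⁆ SO21) ∧ IsLorentzian M.gn ∧
  ∃ (a ε : ℝ) (e : Basis (Fin 4) ℝ (𝔫 × ℝ)), IsLorentzianFrame M a ε e ∧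
    ⁅e 3, e 0⁆ = e 1 ∧ ⁅e 3, e 1⁆ = e 0 + e 2 ∧ ⁅e 3, e 2⁆ = -e 1

end Reductive

end GenGeom

end

/-! Reduction to algebra. Torsion-freeness and metricity force the mixed parts of `D` (the action of
one eigenspace of `𝒢_g` on the other) to be those of the Dorfman bracket. In the Ricci trace the
pure parts cancel or assemble into a divergence, which is zero here. What remains is quadratic in
the bracket and `H` (`IsOrthonormal.trace_curvature`). A connection with zero divergence exists
(`leviCivita`) and RC⁻ is the transpose of RC⁺, so in an orthonormal frame the Einstein condition is
the vanishing of one 4 × 4 matrix (`IsOrthonormal.isGeneralisedEinstein_zero_iff`).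

Solving the equations. Choose a frame of `𝔫` and a unit normal. Since `𝔫` is unimodular, its bracket
is the cross product followed by a `g`-symmetric endomorphism L; since `𝔫` is perfect, L is
invertible. Let C be the cross product with the projection of the normal to `𝔫`. The
normal-tangential equations say that L kills the normal part of `H`, and that [L,[L,C]] = 0. The
tangential ones say adj(tr L/2 − L) − (CL²C − LC²L)/4 = h²/4. Traces against endomorphisms commuting
with L and [L,C] show that tr L/2 − L has a triple eigenvalue m, so L = m(2 + n) with n³ = 0, and
the equations become [n,[n,C]] = 0 and [C,[n,C]] = 2n + n². In Riemannian or Lorentzian signature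
this forces n = 0 (`nilpotent_symmetric_eq_zero`). Thus L is a scalar with square h²
(`symmetric_eq_scalar`). Conversely every such scalar solves the equations, whatever the projection
of the normal (`einsteinTensor_eq_zero_of_scalar`).

Normal forms. For scalar L the form `g` on `𝔫` is ad-invariant and `H` is a multiple of g([x,y],z),
so the frame of `𝔫` may be rotated freely (`IsScalarFrame.rotate`). The only remaining datum is the
projection of the normal to `𝔫`. Its causal type distinguishes (α), (β), (γ), and the signature on
`𝔫` decides between `so(3)` and `so(2,1)`. -/

namespace GenGeom

/-! ### Nilpotent symmetric endomorphisms in Lorentzian signature -/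

/-- A symmetric endomorphism `n` with `n³ = 0` which satisfies `[n, [n, c]] = 0` and
`[c, [n, c]] = 2 n + n²` for a skew endomorphism `c` vanishes, if the orthogonal complement of every
null vector is positive semi-definite with a one-dimensional radical. -/
theorem nilpotent_symmetric_eq_zero {V : Type*} [AddCommGroup V] [Module ℝ V]
    (B : LinearMap.BilinForm ℝ V) (hB : ∀ x y, B x y = B y x) (hnd : ∀ x, (∀ y, B x y = 0) → x = 0)
    (hnull : ∀ l w, l ≠ 0 → B l l = 0 → B w l = 0 → B w w = 0 → ∃ r : ℝ, w = r • l)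
    (hgram : ∀ l x z, l ≠ 0 → B l l = 0 → B x l = 0 → B z l = 0 → B x z ^ 2 = B x x * B z z)
    (n c : Module.End ℝ V) (hn : ∀ x y, B (n x) y = B x (n y))
    (hc : ∀ x y, B (c x) y = -B x (c y)) (h3 : n * n * n = 0)
    (h1 : n * (n * c - c * n) = (n * c - c * n) * n)
    (h2 : c * (n * c - c * n) - (n * c - c * n) * c = (2 : ℝ) • n + n * n) : n = 0 := by
  have n3 : ∀ x, n (n (n x)) = 0 := fun x => by simpa using LinearMap.congr_fun h3 x
  have e1 : ∀ x, n (n (c x)) + c (n (n x)) = (2 : ℝ) • n (c (n x)) := fun x => by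
    have := LinearMap.congr_fun h1 x
    simp only [Module.End.mul_apply, LinearMap.sub_apply, map_sub] at this
    rw [two_smul]
    linear_combination (norm := module) this
  have e2 : ∀ x, (2 : ℝ) • c (n (c x)) - c (c (n x)) - n (c (c x)) = (2 : ℝ) • n x + n (n x) :=
      fun x => by
    have := LinearMap.congr_fun h2 x
    simp only [Module.End.mul_apply, LinearMap.sub_apply, map_sub, LinearMap.add_apply,
      LinearMap.smul_apply] at this
    rw [two_smul] at this ⊢
    rw [two_smul]
    linear_combination (norm := module) this
  -- Polarisation: a symmetric endomorphism is determined by its quadratic form.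
  have polar : ∀ m : Module.End ℝ V, (∀ x y, B (m x) y = B x (m y)) → (∀ v, B v (m v) = 0) →
      m = 0 := by
    intro m hm h0
    ext x
    refine hnd _ fun y => ?_
    have h := h0 (x + y)
    simp only [map_add, LinearMap.add_apply, h0] at h
    have := hm x y
    have := hB y (m x)
    linarith
  -- If n² ≠ 0, some l = n²v pairs non-trivially with v. It is a null eigenvector of c, say cl = rl,
  -- and the last relation at nv, paired with v, gives r² + 2 = 0.
  have hnn : n * n = 0 := by
    by_contra hne
    obtain ⟨v, hv⟩ : ∃ v, B v (n (n v)) ≠ 0 := by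
      by_contra hcon
      push Not at hcon
      exact hne (polar (n * n) (fun x y => by simp [hn]) (fun v => by simpa using hcon v))
    set l := n (n v) with hl
    have hl0 : l ≠ 0 := fun h => hv (by rw [h, map_zero])
    have hll : B l l = 0 := by rw [hl, hn, n3, map_zero]
    have nl : n l = 0 := n3 v
    have ncl : n (c l) = 0 := by
      have h := congrArg n (e1 (n v))
      have h' := congrArg n (e1 v)
      have h'' := e1 (n v)
      simp only [map_add, map_smul, n3, ← hl, nl, map_zero, zero_add, add_zero] at h h' h''
      -- The first relation at v (after applying n) and at nv expresses each of ncl and n²cnv as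
      -- twice the other.
      have k : n (n (c (n v))) = 0 := by
        have h4 : n (c l) = (2 : ℝ) • n (n (c (n v))) := h'
        have h5 : n (n (c (n v))) = (2 : ℝ) • n (c l) := h''
        have : (3 : ℝ) • n (n (c (n v))) = 0 := by
          rw [h4, smul_smul] at h5
          linear_combination (norm := module) (-1 : ℝ) • h5
        exact (smul_eq_zero.1 this).resolve_left (by norm_num)
      rw [k, smul_zero] at h'
      exact h'
    have hcl : B (c l) l = 0 := by
      have := hc l l
      have := hB (c l) l
      linarith
    have hclcl : B (c l) (c l) = 0 := by
      have h : n (n (c (c l))) = 0 := by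
        have := e1 (c l)
        simpa [ncl] using this
      rw [hc, hl, hn, hn, ← hl, h, map_zero, neg_zero]
    obtain ⟨r, hr⟩ := hnull l (c l) hl0 hll hcl hclcl
    obtain ⟨k, hk⟩ := hnull l (n (n (c v))) hl0 hll (by rw [hn, nl, map_zero])
      (by rw [hn, n3, map_zero])
    have hkr : k = -r := by
      have h : B v (n (n (c v))) = -(r * B v l) := by
        rw [← hn, ← hn, ← hl, ← neg_eq_iff_eq_neg.2 (hc l v), hr, map_smul, LinearMap.smul_apply,
          hB l v, smul_eq_mul]
      rw [hk, map_smul, smul_eq_mul, ← neg_mul] at h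
      exact mul_right_cancel₀ hv h
    have hncn : n (c (n v)) = 0 := by
      have h := e1 v
      rw [← hl, hk, hr, hkr, neg_smul, neg_add_cancel] at h
      exact (smul_eq_zero.1 h.symm).resolve_left (by norm_num)
    -- Both cnv and nv lie in l^⊥ and are orthogonal by skewness of c. Since nv is not null, the
    -- degenerate Gram determinant makes cnv null.
    have hx : B (c (n v)) (c (n v)) = 0 := by
      have h := hgram l (c (n v)) (n v) hl0 hll
        (by rw [hc, hr, map_smul, hn, nl]; simp) (by rw [hn, nl, map_zero])
      have h0 : B (c (n v)) (n v) = 0 := by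
        have := hc (n v) (n v)
        have := hB (c (n v)) (n v)
        linarith
      have hz : B (n v) (n v) ≠ 0 := by rw [hn]; exact hv
      rw [h0] at h
      have : B (c (n v)) (c (n v)) * B (n v) (n v) = 0 := by rw [← h]; ring
      exact (mul_eq_zero.1 this).resolve_right hz
    have h := congrArg (B v) (e2 (n v))
    rw [hncn, ← hl, nl, hr] at h
    simp only [map_zero, smul_zero, zero_sub, add_zero, map_sub, map_neg, map_smul, hr,
      smul_eq_mul] at h
    rw [← hn v (c (c (n v))), ← neg_eq_iff_eq_neg.2 (hc (n v) (c (n v))), hx] at h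
    have : B v l * (r ^ 2 + 2) = 0 := by linarith
    rcases mul_eq_zero.1 this with h | h
    · exact hv h
    · nlinarith [sq_nonneg r]
  have n2 : ∀ x, n (n x) = 0 := fun x => by simpa using LinearMap.congr_fun hnn x
  -- The same scheme one degree lower, with l = nv; it ends in 2r² + 1 = 0.
  by_contra hne
  obtain ⟨v, hv⟩ : ∃ v, B v (n v) ≠ 0 := by
    by_contra hcon
    push Not at hcon
    exact hne (polar n hn hcon)
  have ncn : ∀ x, n (c (n x)) = 0 := fun x => by
    have := e1 x
    rw [n2, n2, map_zero, add_zero] at this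
    exact (smul_eq_zero.1 this.symm).resolve_left (by norm_num)
  have nccn : n (c (c (n v))) = 0 := by
    have := congrArg n (e2 v)
    simpa [n2, ncn] using this
  set l := n v with hl
  have hl0 : l ≠ 0 := fun h => hv (by rw [h, map_zero])
  have hll : B l l = 0 := by rw [hl, hn, n2, map_zero]
  have hcl : B (c l) l = 0 := by
    have := hc l l
    have := hB (c l) l
    linarith
  have hclcl : B (c l) (c l) = 0 := by
    rw [hc, hl, hn, ← hl, nccn, map_zero, neg_zero]
  obtain ⟨r, hr⟩ := hnull l (c l) hl0 hll hcl hclcl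
  obtain ⟨k, hk⟩ := hnull l (n (c v)) hl0 hll (by rw [hn, hl, n2, map_zero])
    (by rw [hn, n2, map_zero])
  have hkr : k = -r := by
    have h : B v (n (c v)) = -(r * B v l) := by
      rw [← hn, ← hl, ← neg_eq_iff_eq_neg.2 (hc l v), hr, map_smul, LinearMap.smul_apply,
        hB l v, smul_eq_mul]
    rw [hk, map_smul, smul_eq_mul, ← neg_mul] at h
    exact mul_right_cancel₀ hv h
  have hlast : B v (n (c (c v))) = r ^ 2 * B v l := by
    rw [← hn, ← hl, ← neg_eq_iff_eq_neg.2 (hc l (c v)), hr, map_smul, LinearMap.smul_apply,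
      ← neg_eq_iff_eq_neg.2 (hc l v), hr, map_smul, LinearMap.smul_apply, hB l v]
    simp only [smul_eq_mul]
    ring
  have h := congrArg (B v) (e2 v)
  rw [n2, hk, hkr, ← hl] at h
  simp only [add_zero, map_sub, map_smul, hr, smul_eq_mul, hlast] at h
  have : B v l * (2 * r ^ 2 + 1) = 0 := by linarith
  rcases mul_eq_zero.1 this with h | h
  · exact hv h
  · nlinarith [sq_nonneg r]

end GenGeom

/-! ### The matrix equation for the bracket -/

namespace GenGeom

open Matrix

/-- Cayley–Hamilton, with tr adj M playing the role of the second elementary symmetric function of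
the eigenvalues. -/
theorem charpoly_identity_fin_three (M : Matrix (Fin 3) (Fin 3) ℝ) :
    M * M * M - M.trace • (M * M) + M.adjugate.trace • M - M.det • 1 = 0 := by
  rw [M.eta_fin_three, adjugate_fin_three_of]
  ext i j
  fin_cases i <;> fin_cases j <;>
  · simp [det_fin_three, trace_fin_three]
    ring

theorem adjugate_eq_fin_three (M : Matrix (Fin 3) (Fin 3) ℝ) :
    M.adjugate = M * M - M.trace • M + M.adjugate.trace • 1 := by
  rw [M.eta_fin_three, adjugate_fin_three_of]
  ext i j
  fin_cases i <;> fin_cases j <;>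
  · simp [trace_fin_three]
    ring

theorem trace_adjugate_mul_adjugate_fin_three (M : Matrix (Fin 3) (Fin 3) ℝ) :
    (M.adjugate * M.adjugate).trace = M.adjugate.trace ^ 2 - 2 * M.trace * M.det := by
  rw [M.eta_fin_three, adjugate_fin_three_of]
  simp [det_fin_three, trace_fin_three]
  ring

theorem det_trace_sub_fin_three (M : Matrix (Fin 3) (Fin 3) ℝ) :
    (M.trace • 1 - M).det = M.trace * M.adjugate.trace - M.det := by
  rw [M.eta_fin_three, adjugate_fin_three_of]
  simp [det_fin_three, trace_fin_three]
  ring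

/-- The form `diag(σ, 1, 1)`. -/
abbrev lorentz (σ : ℝ) : Matrix (Fin 3) (Fin 3) ℝ := diagonal ![σ, 1, 1]

theorem lorentz_form_apply (σ : ℝ) (x y : Fin 3 → ℝ) :
    toBilin' (lorentz σ) x y = σ * x 0 * y 0 + x 1 * y 1 + x 2 * y 2 := by
  simp [toBilin'_apply', dotProduct, Fin.sum_univ_three, mulVec_diagonal]
  ring

theorem lorentz_null_ne_zero {σ : ℝ} (hσ : σ = 1 ∨ σ = -1) {l : Fin 3 → ℝ} (hl : l ≠ 0)
    (hll : toBilin' (lorentz σ) l l = 0) : σ = -1 ∧ l 0 ≠ 0 := by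
  rw [lorentz_form_apply] at hll
  have key : (l 0 = 0 → l 1 = 0 → l 2 = 0 → False) := fun h0 h1 h2 => hl (by
    ext i; fin_cases i <;> assumption)
  have h0 : l 0 ≠ 0 := by
    intro h0
    rw [h0] at hll
    exact key h0 (by nlinarith [sq_nonneg (l 1), sq_nonneg (l 2)])
      (by nlinarith [sq_nonneg (l 1), sq_nonneg (l 2)])
  refine ⟨hσ.resolve_left ?_, h0⟩
  rintro rfl
  exact h0 (by nlinarith [sq_nonneg (l 0), sq_nonneg (l 1), sq_nonneg (l 2)])

/-- For null l the quotient l^⊥/ℝl is a positive line, with coordinate (x₁l₂ − x₂l₁)/l₀. Both the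
Gram identity and the uniqueness of the null direction in l^⊥ follow from this. -/
theorem lorentz_orthogonal_null {l x z : Fin 3 → ℝ}
    (hll : toBilin' (lorentz (-1)) l l = 0) (hx : toBilin' (lorentz (-1)) x l = 0)
    (hz : toBilin' (lorentz (-1)) z l = 0) :
    l 0 ^ 2 * toBilin' (lorentz (-1)) x z
      = (x 1 * l 2 - x 2 * l 1) * (z 1 * l 2 - z 2 * l 1) := by
  simp only [lorentz_form_apply] at *
  linear_combination (-(x 1 * z 1 + x 2 * z 2)) * hll + (l 0 * z 0) * hx
    + (x 1 * l 1 + x 2 * l 2) * hz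

/-- The quadratic term equals [C,N]L with N = [L,C], so it is invisible to traces against anything
commuting with L and N. Three such traces determine the characteristic polynomial of M = tr L/2 − L,
and the nilpotent rest is killed by `nilpotent_symmetric_eq_zero`. -/
theorem symmetric_eq_scalar {σ : ℝ} (hσ : σ = 1 ∨ σ = -1) {L C : Matrix (Fin 3) (Fin 3) ℝ}
    (hL : (lorentz σ * L)ᵀ = lorentz σ * L) (hC : (lorentz σ * C)ᵀ = -(lorentz σ * C))
    (hdet : L.det ≠ 0) (h1 : L * (L * C - C * L) = (L * C - C * L) * L) {a : ℝ}
    (h2 : ((L.trace / 2) • 1 - L).adjugate - (1 / 4 : ℝ) • (C * L * L * C - L * C * C * L)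
      = (a ^ 2 / 4) • 1) : ∃ r : ℝ, L = r • 1 ∧ r ^ 2 = a ^ 2 := by
  set M := (L.trace / 2) • 1 - L with hM
  set N := L * C - C * L with hN
  have hQ : C * L * L * C - L * C * C * L = (C * N - N * C) * L := by
    have : C * (L * N) = C * (N * L) := by rw [h1]
    rw [hN] at this ⊢
    have h : C * L * L * C - L * C * C * L - (C * (L * C - C * L) - (L * C - C * L) * C) * L
      = C * (L * (L * C - C * L)) - C * ((L * C - C * L) * L) := by noncomm_ring
    rw [this, sub_self, sub_eq_zero] at h
    exact h
  rw [hQ] at h2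
  -- tr([C,N]LX) = 0 by cyclicity, because N commutes with LX. The test elements below are X = 1, M
  -- and adj M.
  have htr : ∀ X, Commute N X → Commute L X → (M.adjugate * X).trace = a ^ 2 / 4 * X.trace := by
    intro X hX hLX
    have h := congrArg (fun Y => (Y * X).trace) h2
    have h0 : ((C * N - N * C) * L * X).trace = 0 := by
      have : (C * N - N * C) * L * X = C * (N * L * X) - N * (C * (L * X)) := by noncomm_ring
      rw [this, trace_sub, trace_mul_comm N, sub_eq_zero]
      congr 1
      rw [← h1, mul_assoc L, hX.eq]
      noncomm_ring
    rw [sub_mul, trace_sub, smul_mul_assoc, trace_smul, h0, smul_mul_assoc, trace_smul, one_mul,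
      smul_zero, sub_zero, smul_eq_mul] at h
    exact h
  have cLM : Commute L M := ((Commute.one_right L).smul_right _).sub_right (Commute.refl L)
  have cNM : Commute N M := ((Commute.one_right N).smul_right _).sub_right h1.symm
  have cadj : ∀ X, Commute X M → Commute X M.adjugate := fun X h => by
    rw [adjugate_eq_fin_three]
    exact ((h.mul_right h).sub_right (h.smul_right _)).add_right
      ((Commute.one_right X).smul_right _)
  have t1 := htr 1 (Commute.one_right N) (Commute.one_right L)
  have t2 := htr M cNM cLM
  have t3 := htr M.adjugate (cadj N cNM) (cadj L cLM)
  rw [trace_adjugate_mul_adjugate_fin_three] at t3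
  rw [adjugate_mul, trace_smul, trace_one, smul_eq_mul] at t2
  rw [mul_one, trace_one] at t1
  have htM : M.trace = L.trace / 2 := by
    rw [hM, trace_sub, trace_smul, trace_one]; simp; ring
  have hLM : L = M.trace • 1 - M := by rw [htM, hM]; abel
  have hdL : L.det = M.trace * M.adjugate.trace - M.det := by
    conv_lhs => rw [hLM]
    exact det_trace_sub_fin_three M
  have hCH := charpoly_identity_fin_three M
  have hadj := adjugate_eq_fin_three M
  simp only [Fintype.card_fin, Nat.cast_ofNat] at t1 t2
  rw [t1] at t3 hCH hdL hadj
  set m := M.trace / 3 with hm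
  have hmt : M.trace = 3 * m := by rw [hm]; ring
  rw [hmt] at t2 t3 hCH hdL hadj hLM
  have hd : M.det = a ^ 2 / 4 * m := by linarith
  rw [hd] at t3 hCH hdL
  -- Here det L = 8(a²/4)m, so invertibility of L makes both a and m non-zero.
  have hne : a ^ 2 / 4 * m ≠ 0 := fun h => hdet (by rw [hdL]; linear_combination 8 * h)
  have ha : a ^ 2 / 4 ≠ 0 := left_ne_zero_of_mul hne
  have hm0 : m ≠ 0 := right_ne_zero_of_mul hne
  -- With A = a²/4, the trace against adj M reads 3A² = 9A² − 6Am². Thus the characteristic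
  -- polynomial of M is (λ − m)³.
  have hma : a ^ 2 / 4 = m ^ 2 := by
    apply mul_left_cancel₀ ha
    linear_combination t3 / 6
  rw [hma] at h2 hCH hadj
  -- Chosen so that L = m(2 + n) and M = m(1 − n), whence n³ = 0.
  set n := m⁻¹ • L - (2 : ℝ) • 1 with hn
  have hLn : L = m • ((2 : ℝ) • 1 + n) := by
    rw [hn, add_sub_cancel, smul_smul, mul_inv_cancel₀ hm0, one_smul]
  have hMn : M = m • (1 - n) := by
    have : M = (3 * m) • 1 - L := by rw [hLM]; abel
    rw [this]
    nth_rewrite 1 [hLn]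
    module
  have hn3 : n * n * n = 0 := by
    rw [hMn] at hCH
    have h : (m ^ 3) • (n * n * n) = 0 := by
      rw [← neg_eq_zero, ← hCH]
      simp only [smul_mul_assoc, mul_smul_comm, sub_mul, mul_sub, one_mul, mul_one, smul_sub]
      module
    exact (smul_eq_zero.1 h).resolve_left (pow_ne_zero 3 hm0)
  have hn3' : n * (n * n) = 0 := by rw [← mul_assoc, hn3]
  have hNn : N = m • (n * C - C * n) := by
    rw [hN]
    nth_rewrite 1 2 [hLn]
    simp only [smul_mul_assoc, mul_smul_comm, add_mul, mul_add, one_mul, mul_one]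
    module
  have hn1 : n * (n * C - C * n) = (n * C - C * n) * n := by
    rw [hNn] at h1
    nth_rewrite 1 2 [hLn] at h1
    simp only [smul_mul_assoc, mul_smul_comm, smul_smul] at h1
    have := smul_right_injective _ (mul_ne_zero hm0 hm0) h1
    simp only [add_mul _ n, mul_add _ _ n, smul_mul_assoc, mul_smul_comm, one_mul, mul_one] at this
    exact add_left_cancel this
  have hn2 : C * (n * C - C * n) - (n * C - C * n) * C = (2 : ℝ) • n + n * n := by
    set Z := C * (n * C - C * n) - (n * C - C * n) * C with hZ
    have hZL : (C * N - N * C) * L = (m ^ 2) • (Z * ((2 : ℝ) • 1 + n)) := by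
      rw [hZ, hNn]
      nth_rewrite 1 [hLn]
      simp only [smul_mul_assoc, mul_smul_comm, ← smul_sub, smul_smul, sq]
    have h : (m ^ 2) • ((4 : ℝ) • (n + n * n)) = (m ^ 2) • (Z * ((2 : ℝ) • 1 + n)) := by
      rw [← hZL]
      have h := h2
      rw [hadj, hMn] at h
      simp only [smul_mul_assoc, mul_smul_comm, sub_mul, mul_sub, one_mul, mul_one] at h
      rw [← sub_mul] at h
      linear_combination (norm := module) (4 : ℝ) • h
    have h := smul_right_injective _ (pow_ne_zero 2 hm0) h
    -- Since n³ = 0, (2 + n)(4 − 2n + n²) = 8, which inverts the factor coming from L.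
    have h := congrArg (· * ((4 : ℝ) • 1 - (2 : ℝ) • n + n * n)) h
    simp only [mul_add, add_mul, mul_sub, smul_mul_assoc, mul_smul_comm, mul_one,
      mul_assoc, hn3', mul_zero] at h
    linear_combination (norm := module) (-1 / 8 : ℝ) • h
  have hn0 : n = 0 := by
    set φ := Matrix.toLinAlgEquiv' (R := ℝ) (n := Fin 3) with hφ
    have hJ : ∀ x y, toBilin' (lorentz σ) x y = toBilin' (lorentz σ) y x := fun x y => by
      simp only [lorentz_form_apply]; ring
    have adj : ∀ (A : Matrix (Fin 3) (Fin 3) ℝ) x y,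
        toBilin' (lorentz σ) (φ A x) y = x ⬝ᵥ (lorentz σ * A)ᵀ *ᵥ y := fun A x y => by
      rw [toBilin'_apply', transpose_mul, diagonal_transpose, ← mulVec_mulVec,
        dotProduct_mulVec x, vecMul_transpose, hφ, toLinAlgEquiv'_apply]
    have adj' : ∀ (A : Matrix (Fin 3) (Fin 3) ℝ) x y,
        toBilin' (lorentz σ) x (φ A y) = x ⬝ᵥ (lorentz σ * A) *ᵥ y := fun A x y => by
      rw [toBilin'_apply', ← mulVec_mulVec, hφ, toLinAlgEquiv'_apply]
    have hnsym : (lorentz σ * n)ᵀ = lorentz σ * n := by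
      rw [hn, mul_sub, transpose_sub, mul_smul_comm, transpose_smul, hL, mul_smul_comm,
        transpose_smul, mul_one, diagonal_transpose]
    refine φ.injective ((nilpotent_symmetric_eq_zero (toBilin' (lorentz σ)) hJ ?_ ?_ ?_ (φ n) (φ C)
      ?_ ?_ ?_ ?_ ?_).trans (map_zero φ).symm)
    · intro x hx
      have h0 := hx (Pi.single 0 1)
      have h1 := hx (Pi.single 1 1)
      have h2 := hx (Pi.single 2 1)
      rw [lorentz_form_apply] at h0 h1 h2
      simp at h0 h1 h2
      ext i
      fin_cases i
      · rcases h0 with h0 | h0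
        · rcases hσ with hσ | hσ <;> norm_num [hσ] at h0
        · exact h0
      · exact h1
      · exact h2
    · intro l w hl hll hwl hww
      obtain ⟨rfl, hl0⟩ := lorentz_null_ne_zero hσ hl hll
      have h := lorentz_orthogonal_null hll hwl hwl
      rw [hww, mul_zero, eq_comm, mul_self_eq_zero] at h
      rw [lorentz_form_apply] at hll hwl
      refine ⟨w 0 / l 0, ?_⟩
      have e1 : l 0 * w 1 = w 0 * l 1 := by
        apply mul_left_cancel₀ hl0
        linear_combination (-w 1) * hll + l 1 * hwl + l 2 * h
      have e2 : l 0 * w 2 = w 0 * l 2 := by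
        apply mul_left_cancel₀ hl0
        linear_combination (-w 2) * hll + l 2 * hwl - l 1 * h
      ext i
      fin_cases i
      · simp [hl0]
      · simp; field_simp; linarith
      · simp; field_simp; linarith
    · intro l x z hl hll hxl hzl
      obtain ⟨rfl, hl0⟩ := lorentz_null_ne_zero hσ hl hll
      have hxz := lorentz_orthogonal_null hll hxl hzl
      have hxx := lorentz_orthogonal_null hll hxl hxl
      have hzz := lorentz_orthogonal_null hll hzl hzl
      apply mul_left_cancel₀ (pow_ne_zero 4 hl0)
      calc _ = (l 0 ^ 2 * toBilin' (lorentz (-1)) x z) ^ 2 := by ring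
        _ = (l 0 ^ 2 * toBilin' (lorentz (-1)) x x) * (l 0 ^ 2 * toBilin' (lorentz (-1)) z z) := by
          rw [hxz, hxx, hzz]; ring
        _ = _ := by ring
    · intro x y
      rw [adj, adj', hnsym]
    · intro x y
      rw [adj, adj', hC, neg_mulVec, dotProduct_neg]
    · rw [← map_mul, ← map_mul, hn3, map_zero]
    · simp only [← map_mul, ← map_sub, hn1]
    · simp only [← map_mul, ← map_sub, hn2, map_add, map_smul]
  refine ⟨2 * m, ?_, by linear_combination (-4) * hma⟩
  conv_lhs => rw [hLn, hn0, add_zero, smul_smul, mul_comm]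

end GenGeom

/-! ### The Einstein equations in frame components -/

namespace GenGeom

open Matrix

/-- The symmetric matrix with the given upper triangular entries. -/
def symMatrix (p q r s t u : ℝ) : Matrix (Fin 3) (Fin 3) ℝ := !![p, q, r; q, s, t; r, t, u]

/-- The tensor `g([eₐ, e_b], e_c)` in an orthonormal frame of `𝔫 ⊕ ℝ` with `e₃` orthogonal to `𝔫`,
where the bracket of `𝔫` is the symmetric matrix `l` after the cross product, and the projection of
`e₃` to `𝔫` has the coordinates `y`. -/
def structureTensor (σ p q r s t u : ℝ) (y : Fin 3 → ℝ) : Fin 4 → Fin 4 → Fin 4 → ℝ :=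
  ![![![0, 0, 0, 0], ![r, t, u, 0], ![-q, -s, -t, 0],
      ![y 1 * r - y 2 * q, y 1 * t - y 2 * s, y 1 * u - y 2 * t, 0]],
    ![![-r, -t, -u, 0], ![0, 0, 0, 0], ![σ * p, σ * q, σ * r, 0],
      ![y 2 * (σ * p) - y 0 * r, y 2 * (σ * q) - y 0 * t, y 2 * (σ * r) - y 0 * u, 0]],
    ![![q, s, t, 0], ![-(σ * p), -(σ * q), -(σ * r), 0], ![0, 0, 0, 0],
      ![y 0 * q - y 1 * (σ * p), y 0 * s - y 1 * (σ * q), y 0 * t - y 1 * (σ * r), 0]],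
    ![![y 2 * q - y 1 * r, y 2 * s - y 1 * t, y 2 * t - y 1 * u, 0],
      ![y 0 * r - y 2 * (σ * p), y 0 * t - y 2 * (σ * q), y 0 * u - y 2 * (σ * r), 0],
      ![y 1 * (σ * p) - y 0 * q, y 1 * (σ * q) - y 0 * s, y 1 * (σ * r) - y 0 * t, 0],
      ![0, 0, 0, 0]]]

/-- The components of a three-form on a four-dimensional space. -/
def fluxTensor (h : ℝ) (x : Fin 3 → ℝ) : Fin 4 → Fin 4 → Fin 4 → ℝ :=
  ![![![0, 0, 0, 0], ![0, 0, h, x 2], ![0, -h, 0, -x 1], ![0, -x 2, x 1, 0]],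
    ![![0, 0, -h, -x 2], ![0, 0, 0, 0], ![h, 0, 0, x 0], ![x 2, 0, -x 0, 0]],
    ![![0, h, 0, x 1], ![-h, 0, 0, -x 0], ![0, 0, 0, 0], ![-x 1, x 0, 0, 0]],
    ![![0, x 2, -x 1, 0], ![-x 2, 0, x 0, 0], ![x 1, -x 0, 0, 0], ![0, 0, 0, 0]]]

/-- The generalised Ricci tensor (up to a factor) in an orthonormal frame with signs `ε`, in terms
of the components `κ` of the bracket and `H` of the three-form. -/
def einsteinTensor (ε : Fin 4 → ℝ) (κ H : Fin 4 → Fin 4 → Fin 4 → ℝ) (b d : Fin 4) : ℝ :=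
  ∑ a, ∑ c, ε a * ε c * (H a b c - κ a b c + κ b c a - κ c a b) *
    (H c d a + κ c d a - κ d a c + κ a c d)

/-- Every component collapses to a multiple of ρ² − h². The dependence on y and η cancels, so the
position of the normal stays free. -/
theorem einsteinTensor_eq_zero_of_scalar {σ η ρ h : ℝ} (hσ : σ = 1 ∨ σ = -1)
    (hρ : ρ ^ 2 = h ^ 2) (y : Fin 3 → ℝ) (b d : Fin 4) :
    einsteinTensor ![σ, 1, 1, η] (structureTensor σ (ρ * σ) 0 0 ρ 0 ρ y) (fluxTensor h 0) b d = 0 := by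
  have hσ2 : σ ^ 2 = 1 := by rcases hσ with rfl | rfl <;> norm_num
  fin_cases b <;> fin_cases d <;>
  simp only [Fin.zero_eta, Fin.mk_one, Fin.reduceFinMk, einsteinTensor, structureTensor, fluxTensor,
    Fin.sum_univ_four, cons_val, Pi.zero_apply]
  all_goals rcases hσ with rfl | rfl
  all_goals first
    | ring1
    | linear_combination 2 * hρ
    | linear_combination (-2) * hρ

section Necessary

variable {σ p q r s t u h : ℝ} {x y : Fin 3 → ℝ}

theorem lorentz_mul_symMatrix :
    lorentz σ * symMatrix p q r s t u = !![σ * p, σ * q, σ * r; q, s, t; r, t, u] := by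
  ext i j
  fin_cases i <;> fin_cases j <;> simp [symMatrix]

/-- The antisymmetric part of the normal-tangential entries isolates the product of the bracket
matrix with the normal components of the three-form. -/
theorem einsteinTensor_antisymm (hσ : σ = 1 ∨ σ = -1)
    (H : ∀ b d, einsteinTensor ![σ, 1, 1, -σ] (structureTensor σ p q r s t u y) (fluxTensor h x) b d
      = 0) : symMatrix p q r s t u *ᵥ x = 0 := by
  have e0 := (H 3 0).trans (H 0 3).symm
  have e1 := (H 3 1).trans (H 1 3).symm
  have e2 := (H 3 2).trans (H 2 3).symm
  rcases hσ with rfl | rfl <;>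
  · simp only [einsteinTensor, structureTensor, fluxTensor, Fin.sum_univ_four, cons_val] at e0 e1 e2
    ext i
    fin_cases i
    · simp [symMatrix, vecHead, vecTail]; linarith
    · simp [symMatrix, vecHead, vecTail]; linarith
    · simp [symMatrix, vecHead, vecTail]; linarith

-- C is the cross product with y, hence skew for the form, and L is symmetric. So [L,C] is symmetric
-- and [L,[L,C]] is skew, with three independent entries: these are the symmetrised
-- normal-tangential equations.
set_option maxHeartbeats 2000000 in
theorem einsteinTensor_commute (hσ : σ = 1 ∨ σ = -1)
    (H : ∀ b d, einsteinTensor ![σ, 1, 1, -σ] (structureTensor σ p q r s t u y) (fluxTensor h 0) b d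
      = 0) {L C : Matrix (Fin 3) (Fin 3) ℝ} (hL : L = lorentz σ * symMatrix p q r s t u)
    (hC : C = !![0, -σ * y 2, σ * y 1; y 2, 0, -y 0; -y 1, y 0, 0]) :
    L * (L * C - C * L) = (L * C - C * L) * L := by
  have e0 := congrArg₂ (· + ·) (H 3 0) (H 0 3)
  have e1 := congrArg₂ (· + ·) (H 3 1) (H 1 3)
  have e2 := congrArg₂ (· + ·) (H 3 2) (H 2 3)
  simp only [einsteinTensor, structureTensor, fluxTensor, Fin.sum_univ_four, cons_val,
    Pi.zero_apply] at e0 e1 e2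
  rw [lorentz_mul_symMatrix] at hL
  rw [← sub_eq_zero, hL, hC]
  rcases hσ with rfl | rfl <;>
  · ring_nf at e0 e1 e2
    ext i j
    fin_cases i <;> fin_cases j <;>
      simp only [Fin.zero_eta, Fin.mk_one, Fin.reduceFinMk, Matrix.sub_apply, mul_apply,
        Fin.sum_univ_three, of_apply, cons_val, Matrix.zero_apply]
    all_goals first
      | ring1
      | linear_combination (1 / 4) * e0
      | linear_combination (1 / 4) * e1
      | linear_combination (1 / 4) * e2
      | linear_combination (-1 / 4) * e0
      | linear_combination (-1 / 4) * e1
      | linear_combination (-1 / 4) * e2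

-- Both sides are symmetric for the form, so the six symmetrised tangential equations account for
-- all nine entries.
set_option maxHeartbeats 2000000 in
theorem einsteinTensor_adjugate (hσ : σ = 1 ∨ σ = -1)
    (H : ∀ b d, einsteinTensor ![σ, 1, 1, -σ] (structureTensor σ p q r s t u y) (fluxTensor h 0) b d
      = 0) {L C : Matrix (Fin 3) (Fin 3) ℝ} (hL : L = lorentz σ * symMatrix p q r s t u)
    (hC : C = !![0, -σ * y 2, σ * y 1; y 2, 0, -y 0; -y 1, y 0, 0]) :
    ((L.trace / 2) • 1 - L).adjugate - (1 / 4 : ℝ) • (C * L * L * C - L * C * C * L)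
      = (h ^ 2 / 4) • 1 := by
  have e00 := H 0 0
  have e11 := H 1 1
  have e22 := H 2 2
  have e01 := congrArg₂ (· + ·) (H 0 1) (H 1 0)
  have e02 := congrArg₂ (· + ·) (H 0 2) (H 2 0)
  have e12 := congrArg₂ (· + ·) (H 1 2) (H 2 1)
  simp only [einsteinTensor, structureTensor, fluxTensor, Fin.sum_univ_four, cons_val,
    Pi.zero_apply] at e00 e11 e22 e01 e02 e12
  rw [← sub_eq_zero]
  rw [lorentz_mul_symMatrix] at hL
  have hM : (L.trace / 2) • 1 - L = !![(s + u - σ * p) / 2, -(σ * q), -(σ * r);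
      -q, (σ * p + u - s) / 2, -t; -r, -t, (σ * p + s - u) / 2] := by
    rw [hL]
    ext i j
    fin_cases i <;> fin_cases j <;> simp [trace_fin_three]
    all_goals ring
  rw [hM, adjugate_fin_three_of, hL, hC]
  rcases hσ with rfl | rfl
  · ring_nf at e00 e11 e22 e01 e02 e12
    ext i j
    fin_cases i <;> fin_cases j <;>
      simp only [Fin.zero_eta, Fin.mk_one, Fin.reduceFinMk, Matrix.sub_apply, mul_apply, Matrix.smul_apply,
        Fin.sum_univ_three, of_apply, cons_val, Matrix.zero_apply, one_apply, smul_eq_mul,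
        Fin.reduceEq, if_true, if_false]
    · linear_combination (1 / 8) * e00
    · linear_combination (1 / 16) * e01
    · linear_combination (1 / 16) * e02
    · linear_combination (1 / 16) * e01
    · linear_combination (1 / 8) * e11
    · linear_combination (1 / 16) * e12
    · linear_combination (1 / 16) * e02
    · linear_combination (1 / 16) * e12
    · linear_combination (1 / 8) * e22
  · ring_nf at e00 e11 e22 e01 e02 e12
    ext i j
    fin_cases i <;> fin_cases j <;>
      simp only [Fin.zero_eta, Fin.mk_one, Fin.reduceFinMk, Matrix.sub_apply, mul_apply, Matrix.smul_apply,
        Fin.sum_univ_three, of_apply, cons_val, Matrix.zero_apply, one_apply, smul_eq_mul,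
        Fin.reduceEq, if_true, if_false]
    · linear_combination (1 / 8) * e00
    · linear_combination (1 / 16) * e01
    · linear_combination (1 / 16) * e02
    · linear_combination (1 / (-16)) * e01
    · linear_combination (1 / (-8)) * e11
    · linear_combination (1 / (-16)) * e12
    · linear_combination (1 / (-16)) * e02
    · linear_combination (1 / (-16)) * e12
    · linear_combination (1 / (-8)) * e22

theorem symMatrix_eq_scalar_of_einsteinTensor (hσ : σ = 1 ∨ σ = -1)
    (hl : ∀ v, symMatrix p q r s t u *ᵥ v = 0 → v = 0)
    (H : ∀ b d, einsteinTensor ![σ, 1, 1, -σ] (structureTensor σ p q r s t u y) (fluxTensor h x) b d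
      = 0) : x = 0 ∧ ∃ ρ, ρ ≠ 0 ∧ ρ ^ 2 = h ^ 2 ∧ symMatrix p q r s t u = ρ • lorentz σ := by
  obtain rfl : x = 0 := hl x (einsteinTensor_antisymm hσ H)
  have hJJ : lorentz σ * lorentz σ = 1 := by
    rw [diagonal_mul_diagonal, ← diagonal_one]
    congr 1
    ext i
    rcases hσ with rfl | rfl <;> fin_cases i <;> simp
  have hJL : lorentz σ * (lorentz σ * symMatrix p q r s t u) = symMatrix p q r s t u := by
    rw [← mul_assoc, hJJ, one_mul]
  have hdet : (symMatrix p q r s t u).det ≠ 0 := by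
    intro h0
    obtain ⟨v, hv, hv0⟩ := exists_mulVec_eq_zero_iff.2 h0
    exact hv (hl v hv0)
  obtain ⟨ρ, hρ, hρh⟩ := symmetric_eq_scalar hσ (L := lorentz σ * symMatrix p q r s t u)
    (C := !![0, -σ * y 2, σ * y 1; y 2, 0, -y 0; -y 1, y 0, 0]) (a := h)
    (by
      rw [hJL]
      ext i j
      fin_cases i <;> fin_cases j <;> rfl)
    (by
      ext i j
      rcases hσ with rfl | rfl <;> fin_cases i <;> fin_cases j <;> simp)
    (by
      rw [det_mul]
      refine mul_ne_zero ?_ hdet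
      rcases hσ with rfl | rfl <;> simp [Fin.prod_univ_three])
    (einsteinTensor_commute hσ H rfl rfl) (einsteinTensor_adjugate hσ H rfl rfl)
  have hl' : symMatrix p q r s t u = ρ • lorentz σ := by
    rw [← hJL, hρ, mul_smul_comm, mul_one]
  refine ⟨rfl, ρ, ?_, hρh, hl'⟩
  rintro rfl
  rw [hl', zero_smul, det_zero] at hdet
  exact hdet rfl

end Necessary

end GenGeom

/-! ### The Dorfman bracket, eigenspaces of `𝒢_g` and traces -/

namespace GenGeom

section Alternating

variable {𝔤 : Type*} [AddCommGroup 𝔤] [Module ℝ 𝔤] (H : 𝔤 [⋀^Fin 3]→ₗ[ℝ] ℝ)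

theorem alternating_swap_left (X Y Z : 𝔤) : H ![Y, X, Z] = -H ![X, Y, Z] := by
  rw [← H.map_swap ![X, Y, Z] (i := 0) (j := 1) (by decide)]
  congr 1
  ext i
  fin_cases i <;> rfl

theorem alternating_swap_right (X Y Z : 𝔤) : H ![X, Z, Y] = -H ![X, Y, Z] := by
  rw [← H.map_swap ![X, Y, Z] (i := 1) (j := 2) (by decide)]
  congr 1
  ext i
  fin_cases i <;> rfl

end Alternating

section Bracket

variable {𝔤 : Type*} [LieRing 𝔤] [LieAlgebra ℝ 𝔤]

theorem pairing_comm (u v : E 𝔤) : pairing u v = pairing v u := by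
  simp only [pairing]; ring

theorem pairing_add_left (u u' v : E 𝔤) : pairing (u + u') v = pairing u v + pairing u' v := by
  simp [pairing]; ring

theorem pairing_smul_left (r : ℝ) (u v : E 𝔤) : pairing (r • u) v = r * pairing u v := by
  simp [pairing]; ring

variable (𝔤) in
/-- The pairing as a bilinear form. -/
noncomputable def pairingForm : LinearMap.BilinForm ℝ (E 𝔤) :=
  LinearMap.mk₂ ℝ pairing pairing_add_left (fun r u v => by rw [pairing_smul_left, smul_eq_mul])
    (fun u v w => by rw [pairing_comm, pairing_add_left, pairing_comm v, pairing_comm w])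
    (fun r u v => by rw [pairing_comm, pairing_smul_left, pairing_comm v, smul_eq_mul])

theorem pairing_eq (u v : E 𝔤) : pairing u v = pairingForm 𝔤 u v := rfl

variable (H : 𝔤 [⋀^Fin 3]→ₗ[ℝ] ℝ)

/-- In this form the total skewness of ⟨[u,v]_H, w⟩ is visible; the later cancellations rest on it.
-/
theorem pairing_dorfman (u v w : E 𝔤) : pairing (dorfman H u v) w =
    (w.2 ⁅u.1, v.1⁆ - v.2 ⁅u.1, w.1⁆ + u.2 ⁅v.1, w.1⁆ + H ![u.1, v.1, w.1]) / 2 := by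
  simp [pairing, dorfman, coad, contract₂]
  ring

theorem pairing_dorfman_swap_left (u v w : E 𝔤) :
    pairing (dorfman H v u) w = -pairing (dorfman H u v) w := by
  rw [pairing_dorfman, pairing_dorfman, alternating_swap_left, ← lie_skew u.1 v.1, map_neg]
  ring

theorem pairing_dorfman_swap_right (u v w : E 𝔤) :
    pairing (dorfman H u w) v = -pairing (dorfman H u v) w := by
  rw [pairing_dorfman, pairing_dorfman, alternating_swap_right, ← lie_skew v.1 w.1, map_neg]
  ring

theorem dorfman_swap (u v : E 𝔤) : dorfman H v u = -dorfman H u v := by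
  ext Z
  · simp [dorfman]
  · have := alternating_swap_left H u.1 v.1 Z
    simp [dorfman, contract₂, this]
    ring

theorem dorfman_add_right (u v w : E 𝔤) :
    dorfman H u (v + w) = dorfman H u v + dorfman H u w := by
  ext Z
  · simp [dorfman]
  · have := (contract₂ H Z u.1).map_add v.1 w.1
    have r : ∀ X, H ![u.1, X, Z] = contract₂ H Z u.1 X := fun X => by
      change _ = H ![Z, u.1, X]
      rw [alternating_swap_left H u.1 Z X, alternating_swap_right H u.1 X Z, neg_neg]
    simp [dorfman, coad]
    change _ + H ![u.1, v.1 + w.1, Z] = _ + H ![u.1, v.1, Z] + (_ + H ![u.1, w.1, Z])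
    rw [r, r, r, this]
    ring

theorem dorfman_smul_right (c : ℝ) (u v : E 𝔤) : dorfman H u (c • v) = c • dorfman H u v := by
  ext Z
  · simp [dorfman]
  · have := (contract₂ H Z u.1).map_smul c v.1
    have r : ∀ X, H ![u.1, X, Z] = contract₂ H Z u.1 X := fun X => by
      change _ = H ![Z, u.1, X]
      rw [alternating_swap_left H u.1 Z X, alternating_swap_right H u.1 X Z, neg_neg]
    simp [dorfman, coad]
    change H ![u.1, c • v.1, Z] = c * H ![u.1, v.1, Z]
    rw [r, r, this, smul_eq_mul]

/-- The Dorfman bracket as a bilinear map. -/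
noncomputable def dorfmanBilin : E 𝔤 →ₗ[ℝ] E 𝔤 →ₗ[ℝ] E 𝔤 :=
  LinearMap.mk₂ ℝ (dorfman H)
    (fun u v w => by
      rw [dorfman_swap, dorfman_add_right, dorfman_swap H u, dorfman_swap H v]; abel)
    (fun c u v => by rw [dorfman_swap, dorfman_smul_right, dorfman_swap H u, smul_neg, neg_neg])
    (dorfman_add_right H) (fun c u v => dorfman_smul_right H c u v)

theorem dorfmanBilin_apply (u v : E 𝔤) : dorfmanBilin H u v = dorfman H u v := rfl

end Bracket

namespace GenMetric

variable {𝔤 : Type*} [LieRing 𝔤] [LieAlgebra ℝ 𝔤] [FiniteDimensional ℝ 𝔤] (M : GenMetric 𝔤)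

/-- The lift `X ↦ X + s g X`, which takes values in the `s`-eigenspace of `𝒢_g` if `s = ±1`. -/
noncomputable def lift (s : ℝ) (X : 𝔤) : E 𝔤 := (X, s • M.g X)

theorem lift_add (s : ℝ) (X Y : 𝔤) : M.lift s (X + Y) = M.lift s X + M.lift s Y := by
  simp [lift]

theorem lift_smul (s c : ℝ) (X : 𝔤) : M.lift s (c • X) = c • M.lift s X := by
  rw [lift, map_smul, smul_comm, ← Prod.smul_mk]
  rfl

theorem piPlus_coe (z : E 𝔤) : (M.piPlus z : E 𝔤) = (2⁻¹ : ℝ) • (z + M.G z) := rfl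

theorem piMinus_coe (z : E 𝔤) : (M.piMinus z : E 𝔤) = (2⁻¹ : ℝ) • (z - M.G z) := rfl

theorem G_apply (u : E 𝔤) :
    M.G u = ((M.g.toDual M.nondeg).symm u.2, M.g u.1) := rfl

theorem G_lift {s : ℝ} (hs : s * s = 1) (X : 𝔤) : M.G (M.lift s X) = s • M.lift s X := by
  have h : M.g X = M.g.toDual M.nondeg X := rfl
  rw [G_apply]
  simp only [lift]
  rw [map_smul, h, LinearEquiv.symm_apply_apply, ← h, Prod.smul_mk, smul_smul, hs, one_smul]

theorem eq_lift {s : ℝ} (hs : s * s = 1) {u : E 𝔤} (hu : M.G u = s • u) : u = M.lift s u.1 := by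
  have h := congrArg Prod.snd hu
  simp only [G_apply, Prod.smul_snd] at h
  refine Prod.ext rfl ?_
  rw [lift, h, smul_smul, hs, one_smul]

/-- The identification of `𝔤` with an eigenspace of `𝒢_g`. -/
noncomputable def liftEquiv {s : ℝ} (hs : s * s = 1) : 𝔤 ≃ₗ[ℝ] End.eigenspace M.G s where
  toFun X := ⟨M.lift s X, End.mem_eigenspace_iff.2 (M.G_lift hs X)⟩
  invFun u := (u : E 𝔤).1
  left_inv _ := rfl
  right_inv u := Subtype.ext (M.eq_lift hs (End.mem_eigenspace_iff.1 u.2)).symm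
  map_add' X Y := Subtype.ext (M.lift_add s X Y)
  map_smul' c X := Subtype.ext (M.lift_smul s c X)

theorem symm_toDual_apply (ξ : Dual ℝ 𝔤) (X : 𝔤) : M.g ((M.g.toDual M.nondeg).symm ξ) X = ξ X :=
  LinearMap.BilinForm.apply_toDual_symm_apply (hB := M.nondeg) ξ X

theorem pairing_G_left (u v : E 𝔤) : pairing (M.G u) v = pairing u (M.G v) := by
  have h1 := M.symm_toDual_apply v.2 u.1
  have h2 := M.symm_toDual_apply u.2 v.1
  have h3 := M.symm_toDual_apply v.2 ((M.g.toDual M.nondeg).symm u.2)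
  have h4 := M.symm_toDual_apply u.2 ((M.g.toDual M.nondeg).symm v.2)
  have s1 := M.symm.eq u.1 v.1
  have s2 := M.symm.eq ((M.g.toDual M.nondeg).symm u.2) ((M.g.toDual M.nondeg).symm v.2)
  simp only [pairing, G_apply]
  rw [← h3, ← h4, s1, s2]
  ring

theorem pairing_eq_zero {s : ℝ} (hs : s * s = 1) {u v : E 𝔤} (hu : M.G u = s • u)
    (hv : M.G v = (-s) • v) : pairing u v = 0 := by
  have h := M.pairing_G_left u v
  rw [hu, hv, pairing_smul_left, pairing_comm u (-s • v), pairing_smul_left, pairing_comm v] at h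
  have hs0 : s ≠ 0 := by rintro rfl; simp at hs
  have : s * pairing u v = 0 := by linarith
  exact (mul_eq_zero.1 this).resolve_left hs0

theorem pairing_lift (s : ℝ) (z : E 𝔤) (X : 𝔤) :
    pairing z (M.lift s X) = (s * M.g X z.1 + z.2 X) / 2 := by
  simp [pairing, lift]

theorem pairing_dorfman_lift (s s' s'' : ℝ) (X Y Z : 𝔤) :
    pairing (dorfman M.H (M.lift s X) (M.lift s' Y)) (M.lift s'' Z) =
      (M.H ![X, Y, Z] + s'' * M.g ⁅X, Y⁆ Z + s * M.g ⁅Y, Z⁆ X + s' * M.g ⁅Z, X⁆ Y) / 2 := by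
  rw [pairing_dorfman]
  have h1 := M.symm.eq Z ⁅X, Y⁆
  have h2 := M.symm.eq Y ⁅X, Z⁆
  have h3 := M.symm.eq X ⁅Y, Z⁆
  simp only [lift, LinearMap.smul_apply, smul_eq_mul, h1, h2, h3]
  rw [← lie_skew Z X, map_neg, LinearMap.neg_apply]
  ring

/-- An orthonormal basis for a pseudo-Riemannian metric. -/
structure IsOrthonormal {ι : Type*} (e : Basis ι ℝ 𝔤) (ε : ι → ℝ) : Prop where
  sq : ∀ i, ε i * ε i = 1
  norm : ∀ i, M.g (e i) (e i) = ε i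
  orthogonal : ∀ i j, i ≠ j → M.g (e i) (e j) = 0

section Frame

variable {M} {ι : Type*} [Fintype ι] {e : Basis ι ℝ 𝔤} {ε : ι → ℝ}

theorem IsOrthonormal.repr_eq (h : M.IsOrthonormal e ε) (X : 𝔤) (i : ι) :
    e.repr X i = ε i * M.g (e i) X := by
  classical
  conv_rhs => rw [← e.sum_repr X]
  rw [map_sum, Finset.sum_eq_single i]
  · rw [map_smul, h.norm, smul_eq_mul]
    linear_combination (-e.repr X i) * h.sq i
  · intro j _ hj
    rw [map_smul, h.orthogonal i j hj.symm, smul_zero]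
  · simp

/-- The lifts of the frame are an orthogonal basis of the eigenspace with square lengths sεᵢ, and
the projection does not change pairings with vectors of that eigenspace. -/
theorem IsOrthonormal.trace_eq (h : M.IsOrthonormal e ε) {s : ℝ} (hs : s * s = 1)
    (P : E 𝔤 →ₗ[ℝ] End.eigenspace M.G s)
    (hP : ∀ z, (P z : E 𝔤) = (2⁻¹ : ℝ) • (z + s • M.G z)) (T : E 𝔤 →ₗ[ℝ] E 𝔤) :
    LinearMap.trace ℝ _ (P ∘ₗ T ∘ₗ (End.eigenspace M.G s).subtype) =
      s * ∑ i, ε i * pairing (T (M.lift s (e i))) (M.lift s (e i)) := by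
  classical
  set φ := M.liftEquiv hs
  rw [LinearMap.trace_eq_matrix_trace ℝ (e.map φ), Matrix.trace, Finset.mul_sum]
  refine Finset.sum_congr rfl fun i _ => ?_
  rw [Matrix.diag_apply, LinearMap.toMatrix_apply]
  have hz : ∀ z : E 𝔤, (e.map φ).repr (P z) i = s * (ε i * pairing z (M.lift s (e i))) := by
    intro z
    have h1 : (e.map φ).repr (P z) i = e.repr (P z : E 𝔤).1 i := rfl
    rw [h1, h.repr_eq, hP, pairing_lift]
    have h2 := M.symm_toDual_apply z.2 (e i)
    have h3 := M.symm.eq (e i) ((M.g.toDual M.nondeg).symm z.2)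
    simp only [G_apply, Prod.smul_fst, Prod.fst_add, map_smul, map_add, smul_eq_mul, h3, h2]
    linear_combination (-(ε i / 2 * M.g (e i) z.1)) * hs
  exact hz _

/-- Split T = Tπ₊ + Tπ₋ and use cyclicity to move each trace to an eigenspace. -/
theorem IsOrthonormal.trace_prod_eq (h : M.IsOrthonormal e ε) (T : E 𝔤 →ₗ[ℝ] E 𝔤) :
    LinearMap.trace ℝ _ T =
      ∑ i, ε i * pairing (T (M.lift 1 (e i))) (M.lift 1 (e i)) -
      ∑ i, ε i * pairing (T (M.lift (-1) (e i))) (M.lift (-1) (e i)) := by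
  have h1 := h.trace_eq (s := 1) (by norm_num) M.piPlus (fun z => by rw [one_smul]; rfl) T
  have h2 := h.trace_eq (s := -1) (by norm_num) M.piMinus
    (fun z => by
      change (M.piMinus z : E 𝔤) = _
      rw [piMinus_coe]
      module) T
  have h3 : T = (T ∘ₗ M.Eplus.subtype) ∘ₗ M.piPlus + (T ∘ₗ M.Eminus.subtype) ∘ₗ M.piMinus := by
    ext1 <;> ext1 z <;>
    · simp only [LinearMap.add_comp, LinearMap.add_apply, LinearMap.comp_apply,
        Submodule.subtype_apply, ← map_add]
      congr 1
      simp only [piPlus_coe, piMinus_coe]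
      module
  rw [one_mul] at h1
  rw [neg_one_mul] at h2
  have : Module.Finite ℝ M.Eplus := Module.Finite.equiv (M.liftEquiv (s := 1) (by norm_num))
  have : Module.Finite ℝ M.Eminus := Module.Finite.equiv (M.liftEquiv (s := -1) (by norm_num))
  have : Module.Free ℝ M.Eplus := Module.Free.of_equiv (M.liftEquiv (s := 1) (by norm_num))
  have : Module.Free ℝ M.Eminus := Module.Free.of_equiv (M.liftEquiv (s := -1) (by norm_num))
  have h4 := LinearMap.trace_comp_comm' (R := ℝ) (M := E 𝔤) (N := M.Eplus) M.piPlus (T ∘ₗ M.Eplus.subtype)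
  have h5 := LinearMap.trace_comp_comm' (R := ℝ) (M := E 𝔤) (N := M.Eminus)
    M.piMinus (T ∘ₗ M.Eminus.subtype)
  conv_lhs => rw [h3]
  rw [map_add, h4, h5, sub_eq_add_neg, ← h1, ← h2]
  rfl

theorem IsOrthonormal.sum_lift (h : M.IsOrthonormal e ε) {s : ℝ} (hs : s * s = 1) {u : E 𝔤}
    (hu : M.G u = s • u) :
    u = ∑ i, (s * ε i * pairing u (M.lift s (e i))) • M.lift s (e i) := by
  have h1 : ∀ i, s * ε i * pairing u (M.lift s (e i)) = e.repr u.1 i := fun i => by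
    rw [h.repr_eq, pairing_lift]
    have := congrArg (fun v : E 𝔤 => v.2) (M.eq_lift hs hu)
    rw [this]
    simp only [lift, LinearMap.smul_apply, smul_eq_mul]
    have h3 := M.symm.eq (e i) u.1
    rw [← h3]
    linear_combination (ε i * M.g (e i) u.1) * hs
  simp only [h1]
  have h2 : ∑ i, e.repr u.1 i • M.lift s (e i) = M.lift s (∑ i, e.repr u.1 i • e i) := by
    let φ : 𝔤 →ₗ[ℝ] E 𝔤 :=
      { toFun := M.lift s, map_add' := M.lift_add s, map_smul' := fun c X => M.lift_smul s c X }
    change ∑ i, e.repr u.1 i • φ (e i) = φ (∑ i, e.repr u.1 i • e i)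
    simp only [map_sum, map_smul]
  rw [h2, e.sum_repr]
  exact M.eq_lift hs hu

end Frame

end GenMetric

end GenGeom

/-! ### Levi-Civita connections and their Ricci curvature -/

namespace GenGeom

namespace GenMetric

variable {𝔤 : Type*} [LieRing 𝔤] [LieAlgebra ℝ 𝔤] [FiniteDimensional ℝ 𝔤] {M : GenMetric 𝔤}
  {D : E 𝔤 →ₗ[ℝ] E 𝔤 →ₗ[ℝ] E 𝔤}

theorem IsLeviCivita.eigen (hD : M.IsLeviCivita D) {s : ℝ} {w : E 𝔤} (hw : M.G w = s • w)
    (u : E 𝔤) : M.G (D u w) = s • D u w := by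
  rw [← hD.metric, hw, map_smul]

/-- The connection preserves the eigenspaces, which are orthogonal to each other; so in the torsion
identity only these two terms survive. The mixed parts of `D` are therefore forced. -/
theorem IsLeviCivita.pairing_mixed (hD : M.IsLeviCivita D) {s : ℝ} (hs : s * s = 1) {u w x : E 𝔤}
    (hu : M.G u = (-s) • u) (hw : M.G w = s • w) (hx : M.G x = s • x) :
    pairing (D u w) x = pairing (dorfman M.H u w) x := by
  have h := hD.torsion u w x
  have h1 : pairing (D w u) x = 0 := by
    rw [pairing_comm]
    exact M.pairing_eq_zero hs hx (hD.eigen hu w)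
  have h2 : pairing w (D x u) = 0 := M.pairing_eq_zero hs hw (hD.eigen hu x)
  rw [h2, pairing_eq, map_sub, map_sub, LinearMap.sub_apply, LinearMap.sub_apply] at h
  simp only [← pairing_eq] at h
  linarith

section Frame

variable {ι : Type*} [Fintype ι] {e : Basis ι ℝ 𝔤} {ε : ι → ℝ}

theorem IsOrthonormal.divergence_eq (h : M.IsOrthonormal e ε) (hD : M.IsLeviCivita D) {s : ℝ}
    (hs : s = 1 ∨ s = -1) {x : E 𝔤} (hx : M.G x = s • x) :
    divergence D x = s * ∑ i, ε i * pairing (D (M.lift s (e i)) x) (M.lift s (e i)) := by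
  have h0 : ∀ t : ℝ, t * t = 1 → t = -s → ∀ i, pairing (D (M.lift t (e i)) x) (M.lift t (e i)) = 0 :=
    fun t ht hts i => by
      subst hts
      exact M.pairing_eq_zero (by linarith) (hD.eigen hx _) (M.G_lift ht _)
  rw [divergence, h.trace_prod_eq]
  simp only [LinearMap.flip_apply]
  rcases hs with rfl | rfl
  · simp [h0 (-1) (by norm_num) rfl]
  · simp [h0 1 (by norm_num) (by norm_num)]

theorem IsOrthonormal.pairing_eq_sum (h : M.IsOrthonormal e ε) {s : ℝ} (hs : s * s = 1) {u : E 𝔤}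
    (hu : M.G u = s • u) (v : E 𝔤) :
    pairing u v = ∑ i, s * ε i * pairing u (M.lift s (e i)) * pairing (M.lift s (e i)) v := by
  conv_lhs => rw [h.sum_lift hs hu]
  rw [pairing_eq, map_sum, LinearMap.sum_apply]
  refine Finset.sum_congr rfl fun i _ => ?_
  rw [map_smul, LinearMap.smul_apply, smul_eq_mul, ← pairing_eq]

theorem sum_lift_add (h : M.IsOrthonormal e ε) {s : ℝ} (hs : s * s = 1) (z : E 𝔤) :
    z = ∑ i, (s * ε i * pairing z (M.lift s (e i))) • M.lift s (e i) -
      ∑ i, (s * ε i * pairing z (M.lift (-s) (e i))) • M.lift (-s) (e i) := by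
  have hs' : -s * -s = 1 := by linarith
  have ho : ∀ t, t * t = 1 → ∀ i, pairing ((2⁻¹ : ℝ) • (z + t • M.G z)) (M.lift t (e i)) =
      pairing z (M.lift t (e i)) := fun t ht i => by
    rw [pairing_smul_left, pairing_add_left, pairing_smul_left, M.pairing_G_left, M.G_lift ht,
      pairing_comm z (t • _), pairing_smul_left, pairing_comm _ z]
    linear_combination (pairing z (M.lift t (e i)) / 2) * ht
  have hG : ∀ t : ℝ, t * t = 1 → M.G ((2⁻¹ : ℝ) • (z + t • M.G z)) =
      t • ((2⁻¹ : ℝ) • (z + t • M.G z)) := fun t ht => by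
    rw [map_smul, map_add, map_smul, G_G, smul_comm t, smul_add t, smul_smul t t, ht, one_smul,
      add_comm]
  have h1 := h.sum_lift hs (hG s hs)
  have h2 := h.sum_lift hs' (hG (-s) hs')
  simp only [ho s hs] at h1
  simp only [ho (-s) hs'] at h2
  rw [← h1, sub_eq_add_neg, ← Finset.sum_neg_distrib]
  have h3 : ∀ i, -((s * ε i * pairing z (M.lift (-s) (e i))) • M.lift (-s) (e i)) =
      (-s * ε i * pairing z (M.lift (-s) (e i))) • M.lift (-s) (e i) := fun i => by
    module
  simp only [h3]
  rw [← h2]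
  module

/-- The first curvature term is a divergence. The pure part of the third cancels the second, which
leaves a product of mixed bracket components, independent of `D`. -/
theorem IsOrthonormal.trace_curvature (h : M.IsOrthonormal e ε) (hD : M.IsLeviCivita D)
    (hdiv : ∀ x, divergence D x = 0) {s : ℝ} (hs : s = 1 ∨ s = -1)
    (P : E 𝔤 →ₗ[ℝ] End.eigenspace M.G s)
    (hP : ∀ z, (P z : E 𝔤) = (2⁻¹ : ℝ) • (z + s • M.G z)) {v w : E 𝔤} (hv : M.G v = (-s) • v)
    (hw : M.G w = s • w) :
    LinearMap.trace ℝ _ (P ∘ₗ M.curvature D v w ∘ₗ (End.eigenspace M.G s).subtype) =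
      ∑ a, ∑ c, ε a * ε c * pairing (dorfman M.H (M.lift s (e a)) v) (M.lift (-s) (e c)) *
        pairing (dorfman M.H (M.lift (-s) (e c)) w) (M.lift s (e a)) := by
  have hss : s * s = 1 := by rcases hs with rfl | rfl <;> norm_num
  have hss' : -s * -s = 1 := by linarith
  rw [h.trace_eq hss P hP]
  have e1 : ∀ a, pairing (M.curvature D v w (M.lift s (e a))) (M.lift s (e a)) =
      pairing (D (M.lift s (e a)) (D v w)) (M.lift s (e a))
      - pairing (D v (D (M.lift s (e a)) w)) (M.lift s (e a))
      - pairing (D (dorfman M.H (M.lift s (e a)) v) w) (M.lift s (e a)) := fun a => by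
    have h1 : M.curvature D v w (M.lift s (e a)) = D (M.lift s (e a)) (D v w)
      - D v (D (M.lift s (e a)) w) - D (dorfman M.H (M.lift s (e a)) v) w := rfl
    rw [h1, pairing_eq, map_sub, map_sub, LinearMap.sub_apply, LinearMap.sub_apply]
    rfl
  -- Skewness moves D_v to the other factor, where it acts on the opposite eigenspace and is
  -- therefore the bracket.
  have e2 : ∀ a, pairing (D v (D (M.lift s (e a)) w)) (M.lift s (e a)) =
      ∑ c, s * ε c * pairing (D (M.lift s (e a)) w) (M.lift s (e c)) *
        pairing (dorfman M.H (M.lift s (e a)) v) (M.lift s (e c)) := fun a => by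
    have h1 := hD.skew v (D (M.lift s (e a)) w) (M.lift s (e a))
    have h2 : pairing (D (M.lift s (e a)) w) (D v (M.lift s (e a))) =
        pairing (D (M.lift s (e a)) w) (dorfman M.H v (M.lift s (e a))) := by
      rw [pairing_comm, hD.pairing_mixed hss hv (M.G_lift hss _) (hD.eigen hw _), pairing_comm]
    rw [h2, h.pairing_eq_sum hss (hD.eigen hw _)] at h1
    rw [eq_neg_of_add_eq_zero_left h1, ← Finset.sum_neg_distrib]
    refine Finset.sum_congr rfl fun c _ => ?_
    rw [pairing_comm (M.lift s (e c)), pairing_dorfman_swap_left]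
    ring
  -- Split [e_a, v] into its two eigencomponents; along the one in the opposite eigenspace, D is
  -- again the bracket.
  have e3 : ∀ a, pairing (D (dorfman M.H (M.lift s (e a)) v) w) (M.lift s (e a)) =
      ∑ c, s * ε c * pairing (dorfman M.H (M.lift s (e a)) v) (M.lift s (e c)) *
        pairing (D (M.lift s (e c)) w) (M.lift s (e a)) -
      ∑ c, s * ε c * pairing (dorfman M.H (M.lift s (e a)) v) (M.lift (-s) (e c)) *
        pairing (dorfman M.H (M.lift (-s) (e c)) w) (M.lift s (e a)) := fun a => by
    have h1 := sum_lift_add h hss (dorfman M.H (M.lift s (e a)) v)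
    have h2 := congrArg (fun z => pairing (D z w) (M.lift s (e a))) h1
    simp only [map_sub, map_sum, map_smul, LinearMap.sub_apply, LinearMap.sum_apply,
      LinearMap.smul_apply, pairing_eq, smul_eq_mul] at h2
    simp only [← pairing_eq] at h2
    rw [h2]
    congr 1
    refine Finset.sum_congr rfl fun c _ => ?_
    rw [hD.pairing_mixed hss (M.G_lift hss' _) hw (M.G_lift hss _)]
  -- This trace is the divergence of D_v w, which vanishes.
  have e4 : s * ∑ a, ε a * pairing (D (M.lift s (e a)) (D v w)) (M.lift s (e a)) = 0 := by
    rw [← h.divergence_eq hD hs (hD.eigen hw v), hdiv]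
  -- Exchange a and c and use skewness of the bracket in these two slots.
  have e5 : ∑ a, ε a * ∑ c, s * ε c * pairing (dorfman M.H (M.lift s (e a)) v) (M.lift s (e c)) *
        pairing (D (M.lift s (e c)) w) (M.lift s (e a)) =
      -∑ a, ε a * ∑ c, s * ε c * pairing (D (M.lift s (e a)) w) (M.lift s (e c)) *
        pairing (dorfman M.H (M.lift s (e a)) v) (M.lift s (e c)) := by
    simp only [Finset.mul_sum]
    rw [Finset.sum_comm, ← Finset.sum_neg_distrib]
    refine Finset.sum_congr rfl fun a _ => ?_
    rw [← Finset.sum_neg_distrib]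
    refine Finset.sum_congr rfl fun c _ => ?_
    have : pairing (dorfman M.H (M.lift s (e c)) v) (M.lift s (e a)) =
        -pairing (dorfman M.H (M.lift s (e a)) v) (M.lift s (e c)) := by
      rw [pairing_dorfman_swap_left, pairing_dorfman_swap_right M.H v (M.lift s (e a)),
        pairing_dorfman_swap_left M.H (M.lift s (e a))]
      ring
    rw [this]
    ring
  have e6 : s * ∑ a, ε a * ∑ c, s * ε c * pairing (dorfman M.H (M.lift s (e a)) v)
        (M.lift (-s) (e c)) * pairing (dorfman M.H (M.lift (-s) (e c)) w) (M.lift s (e a)) =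
      ∑ a, ∑ c, ε a * ε c * pairing (dorfman M.H (M.lift s (e a)) v) (M.lift (-s) (e c)) *
        pairing (dorfman M.H (M.lift (-s) (e c)) w) (M.lift s (e a)) := by
    simp only [Finset.mul_sum]
    refine Finset.sum_congr rfl fun a _ => Finset.sum_congr rfl fun c _ => ?_
    linear_combination (ε a * ε c * pairing (dorfman M.H (M.lift s (e a)) v) (M.lift (-s) (e c)) *
        pairing (dorfman M.H (M.lift (-s) (e c)) w) (M.lift s (e a))) * hss
  have e7 : ∀ X Y Z W : ι → ℝ, s * ∑ a, ε a * (X a - Y a - (Z a - W a)) = s * ∑ a, ε a * X a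
      - s * ∑ a, ε a * Y a - s * ∑ a, ε a * Z a + s * ∑ a, ε a * W a := fun X Y Z W => by
    simp only [mul_sub, Finset.sum_sub_distrib]
    ring
  simp only [e1, e2, e3]
  rw [e7, e4, e5, e6]
  ring

/-- The bilinear form on `E` which restricts to the generalised Ricci curvature. -/
noncomputable def mixedForm (M : GenMetric 𝔤) (e : Basis ι ℝ 𝔤) (ε : ι → ℝ) (s : ℝ) :
    LinearMap.BilinForm ℝ (E 𝔤) :=
  ∑ a, ∑ c, (ε a * ε c) • LinearMap.BilinForm.linMulLin
    ((pairingForm 𝔤).flip (M.lift (-s) (e c)) ∘ₗ dorfmanBilin M.H (M.lift s (e a)))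
    ((pairingForm 𝔤).flip (M.lift s (e a)) ∘ₗ dorfmanBilin M.H (M.lift (-s) (e c)))

theorem mixedForm_apply (s : ℝ) (v w : E 𝔤) : mixedForm M e ε s v w =
    ∑ a, ∑ c, ε a * ε c * pairing (dorfman M.H (M.lift s (e a)) v) (M.lift (-s) (e c)) *
        pairing (dorfman M.H (M.lift (-s) (e c)) w) (M.lift s (e a)) := by
  simp only [mixedForm, LinearMap.sum_apply, LinearMap.smul_apply, smul_eq_mul, mul_assoc]
  rfl

theorem IsOrthonormal.mixedForm_eq_zero (h : M.IsOrthonormal e ε) {s : ℝ} (hs : s * s = 1)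
    (h0 : ∀ b d, mixedForm M e ε s (M.lift (-s) (e b)) (M.lift s (e d)) = 0) {v w : E 𝔤}
    (hv : M.G v = (-s) • v) (hw : M.G w = s • w) : mixedForm M e ε s v w = 0 := by
  rw [h.sum_lift (by linarith) hv, h.sum_lift hs hw]
  simp only [map_sum, LinearMap.sum_apply, map_smul, LinearMap.smul_apply, h0, smul_zero,
    Finset.sum_const_zero]

theorem IsOrthonormal.ricciPlus_eq (h : M.IsOrthonormal e ε) (hD : M.IsLeviCivita D)
    (hdiv : ∀ x, divergence D x = 0) (v : M.Eminus) (w : M.Eplus) :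
    M.ricciPlus D v w = mixedForm M e ε 1 v w := by
  rw [mixedForm_apply]
  exact h.trace_curvature hD hdiv (Or.inl rfl) M.piPlus (fun z => by rw [one_smul]; rfl)
    (End.mem_eigenspace_iff.1 v.2) (End.mem_eigenspace_iff.1 w.2)

theorem IsOrthonormal.ricciMinus_eq (h : M.IsOrthonormal e ε) (hD : M.IsLeviCivita D)
    (hdiv : ∀ x, divergence D x = 0) (v : M.Eplus) (w : M.Eminus) :
    M.ricciMinus D v w = mixedForm M e ε (-1) v w := by
  rw [mixedForm_apply]
  refine h.trace_curvature hD hdiv (s := -1) (Or.inr rfl) M.piMinus (fun z => ?_) ?_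
    (End.mem_eigenspace_iff.1 w.2)
  · change (M.piMinus z : E 𝔤) = _
    rw [piMinus_coe]
    module
  · rw [neg_neg]
    exact End.mem_eigenspace_iff.1 v.2

end Frame

/-! ### A Levi-Civita connection with zero divergence -/

section Existence

variable (M)

/-- The projection to the `s`-eigenspace of `𝒢_g` as an endomorphism of `E`. -/
noncomputable def proj (s : ℝ) : E 𝔤 →ₗ[ℝ] E 𝔤 := (2⁻¹ : ℝ) • (LinearMap.id + s • M.G)

theorem proj_apply (s : ℝ) (u : E 𝔤) : M.proj s u = (2⁻¹ : ℝ) • (u + s • M.G u) := rfl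

theorem pairing_proj (s : ℝ) (u v : E 𝔤) : pairing (M.proj s u) v = pairing u (M.proj s v) := by
  rw [proj_apply, proj_apply, pairing_smul_left, pairing_add_left, pairing_smul_left,
    pairing_comm u (_ • _), pairing_smul_left, pairing_add_left, pairing_smul_left,
    pairing_G_left M v u, pairing_comm u v, pairing_comm v (M.G u)]

theorem proj_add_proj (u : E 𝔤) : M.proj 1 u + M.proj (-1) u = u := by
  rw [proj_apply, proj_apply]
  module

theorem G_proj {s : ℝ} (hs : s * s = 1) (u : E 𝔤) : M.G (M.proj s u) = s • M.proj s u := by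
  rw [proj_apply, map_smul, map_add, map_smul, G_G, smul_comm s, smul_add s, smul_smul s s, hs,
    one_smul, add_comm]

theorem proj_G {s : ℝ} (hs : s * s = 1) (u : E 𝔤) : M.proj s (M.G u) = s • M.proj s u := by
  rw [proj_apply, G_G, proj_apply, smul_comm s, smul_add s, smul_smul s s, hs, one_smul, add_comm]

/-- The component `(u, v) ↦ π_t [π_s u, π_t v]_H` of the Dorfman bracket. -/
noncomputable def component (s t : ℝ) : E 𝔤 →ₗ[ℝ] E 𝔤 →ₗ[ℝ] E 𝔤 :=
  ((dorfmanBilin M.H).compl₁₂ (M.proj s) (M.proj t)).compr₂ (M.proj t)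

/-- A generalised Levi-Civita connection with vanishing divergence operator. -/
noncomputable def leviCivita : E 𝔤 →ₗ[ℝ] E 𝔤 →ₗ[ℝ] E 𝔤 :=
  M.component (-1) 1 + M.component 1 (-1)
    + (3⁻¹ : ℝ) • (M.component 1 1 + M.component (-1) (-1))

theorem pairing_leviCivita (u v w : E 𝔤) : pairing (M.leviCivita u v) w =
    pairing (dorfman M.H (M.proj (-1) u) (M.proj 1 v)) (M.proj 1 w)
    + pairing (dorfman M.H (M.proj 1 u) (M.proj (-1) v)) (M.proj (-1) w)
    + 3⁻¹ * (pairing (dorfman M.H (M.proj 1 u) (M.proj 1 v)) (M.proj 1 w)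
      + pairing (dorfman M.H (M.proj (-1) u) (M.proj (-1) v)) (M.proj (-1) w)) := by
  simp only [← pairing_proj]
  simp only [← pairing_add_left, ← pairing_smul_left]
  rfl

theorem pairing_dorfman_proj (u v w : E 𝔤) : pairing (dorfman M.H u v) w =
    pairing (dorfman M.H (M.proj 1 u) (M.proj 1 v)) (M.proj 1 w)
    + pairing (dorfman M.H (M.proj 1 u) (M.proj 1 v)) (M.proj (-1) w)
    + pairing (dorfman M.H (M.proj 1 u) (M.proj (-1) v)) (M.proj 1 w)
    + pairing (dorfman M.H (M.proj 1 u) (M.proj (-1) v)) (M.proj (-1) w)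
    + pairing (dorfman M.H (M.proj (-1) u) (M.proj 1 v)) (M.proj 1 w)
    + pairing (dorfman M.H (M.proj (-1) u) (M.proj 1 v)) (M.proj (-1) w)
    + pairing (dorfman M.H (M.proj (-1) u) (M.proj (-1) v)) (M.proj 1 w)
    + pairing (dorfman M.H (M.proj (-1) u) (M.proj (-1) v)) (M.proj (-1) w) := by
  conv_lhs => rw [← M.proj_add_proj u, ← M.proj_add_proj v, ← M.proj_add_proj w]
  simp only [pairing_eq, ← dorfmanBilin_apply, map_add, LinearMap.add_apply]
  ring

/-- On pure arguments each of the three connection terms of the torsion contributes one copy of the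
totally skew form ⟨[u,v]_H, w⟩, whence the factor 1/3. When the eigenspaces are mixed, exactly one
contributes, with factor 1. -/
theorem isLeviCivita_leviCivita : M.IsLeviCivita M.leviCivita where
  skew u v w := by
    rw [pairing_comm v, pairing_leviCivita, pairing_leviCivita,
      pairing_dorfman_swap_right M.H (M.proj (-1) u) (M.proj 1 v),
      pairing_dorfman_swap_right M.H (M.proj 1 u) (M.proj (-1) v),
      pairing_dorfman_swap_right M.H (M.proj 1 u) (M.proj 1 v),
      pairing_dorfman_swap_right M.H (M.proj (-1) u) (M.proj (-1) v)]
    ring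
  torsion u v w := by
    have h := M.pairing_dorfman_proj u v w
    have e : pairing (M.leviCivita u v - M.leviCivita v u - dorfman M.H u v) w =
        pairing (M.leviCivita u v) w - pairing (M.leviCivita v u) w
          - pairing (dorfman M.H u v) w := by
      simp only [pairing_eq, map_sub, LinearMap.sub_apply]
    rw [e, h, pairing_comm v]
    simp only [pairing_leviCivita]
    have cyc : ∀ x y z, pairing (dorfman M.H z x) y = pairing (dorfman M.H x y) z := fun x y z => by
      rw [pairing_dorfman_swap_left, pairing_dorfman_swap_right, neg_neg]
    have sw : ∀ s t, pairing (dorfman M.H (M.proj s v) (M.proj t u)) (M.proj t w)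
        = -pairing (dorfman M.H (M.proj t u) (M.proj s v)) (M.proj t w) := fun s t =>
      pairing_dorfman_swap_left _ _ _ _
    have cy : ∀ s t, pairing (dorfman M.H (M.proj s w) (M.proj t u)) (M.proj t v)
        = pairing (dorfman M.H (M.proj t u) (M.proj t v)) (M.proj s w) := fun s t => cyc _ _ _
    simp only [sw, cy]
    ring
  metric u v := by
    have h : ∀ s t, t * t = 1 → M.component s t u (M.G v) = M.G (M.component s t u v) := by
      intro s t ht
      change M.proj t (dorfmanBilin M.H (M.proj s u) (M.proj t (M.G v)))
        = M.G (M.proj t (dorfmanBilin M.H (M.proj s u) (M.proj t v)))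
      rw [M.G_proj ht, M.proj_G ht, map_smul, map_smul]
    simp only [leviCivita, LinearMap.add_apply, LinearMap.smul_apply, map_add, map_smul]
    rw [h _ _ (by norm_num), h _ _ (by norm_num), h _ _ (by norm_num), h _ _ (by norm_num)]

variable {M}

/-- Within one eigenspace, every summand is a multiple of ⟨[u,y]_H, u⟩ and vanishes by skewness. -/
theorem IsOrthonormal.divergence_leviCivita {ι : Type*} [Fintype ι] {e : Basis ι ℝ 𝔤} {ε : ι → ℝ}
    (h : M.IsOrthonormal e ε) (x : E 𝔤) : divergence M.leviCivita x = 0 := by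
  have h0 : ∀ (t : ℝ) (u y : E 𝔤), t * t = 1 → M.G u = t • u → M.G y = t • y →
      pairing (M.leviCivita u y) u = 0 := by
    intro t u y ht hu hy
    have alt : ∀ a b, pairing (dorfman M.H a b) a = 0 := fun a b => by
      have h1 := pairing_dorfman_swap_left M.H a b a
      have h2 := pairing_dorfman_swap_right M.H b a a
      linarith
    rw [pairing_leviCivita]
    have p1 : ∀ z, M.G z = t • z → (t = 1 → M.proj (-1) z = 0) ∧ (t = -1 → M.proj 1 z = 0) := by
      intro z hz
      constructor <;> rintro rfl <;> rw [proj_apply, hz] <;> module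
    have z2 : ∀ a, dorfman M.H a 0 = 0 := fun a => map_zero (dorfmanBilin M.H a)
    have z3 : ∀ a : E 𝔤, pairing 0 a = 0 := fun a => by simp [pairing]
    have z4 : ∀ a, dorfman M.H 0 a = 0 := fun a => LinearMap.map_zero₂ (dorfmanBilin M.H) a
    rcases mul_self_eq_one_iff.1 ht with rfl | rfl
    · simp [(p1 u hu).1 rfl, (p1 y hy).1 rfl, z2, z3, z4, alt]
    · simp [(p1 u hu).2 rfl, (p1 y hy).2 rfl, z2, z3, z4, alt]
  have hadd : divergence M.leviCivita x =
      divergence M.leviCivita (M.proj 1 x) + divergence M.leviCivita (M.proj (-1) x) := by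
    simp only [divergence]
    rw [← map_add, ← map_add, M.proj_add_proj]
  have h1 : (1 : ℝ) * 1 = 1 := by norm_num
  have h2 : (-1 : ℝ) * -1 = 1 := by norm_num
  rw [hadd, h.divergence_eq M.isLeviCivita_leviCivita (Or.inl rfl) (M.G_proj h1 x),
    h.divergence_eq M.isLeviCivita_leviCivita (Or.inr rfl) (M.G_proj h2 x)]
  simp [h0 1 _ _ h1 (M.G_lift h1 _) (M.G_proj h1 x), h0 (-1) _ _ h2 (M.G_lift h2 _) (M.G_proj h2 x)]

/-- `leviCivita` supplies existence, and the trace formula makes the curvature the same for all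
admissible connections. -/
theorem IsOrthonormal.isGeneralisedEinstein_zero_iff {e : Basis (Fin 4) ℝ 𝔤} {ε : Fin 4 → ℝ}
    (h : M.IsOrthonormal e ε) : M.IsGeneralisedEinstein 0 ↔
      ∀ b d, einsteinTensor ε (fun a b c => M.g ⁅e a, e b⁆ (e c))
        (fun a b c => M.H ![e a, e b, e c]) b d = 0 := by
  have hp : ∀ b d, mixedForm M e ε 1 (M.lift (-1) (e b)) (M.lift 1 (e d)) =
      einsteinTensor ε (fun a b c => M.g ⁅e a, e b⁆ (e c))
        (fun a b c => M.H ![e a, e b, e c]) b d / 4 := by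
    intro b d
    rw [mixedForm_apply, einsteinTensor, Finset.sum_div]
    refine Finset.sum_congr rfl fun a _ => ?_
    rw [Finset.sum_div]
    refine Finset.sum_congr rfl fun c _ => ?_
    rw [pairing_dorfman_lift, pairing_dorfman_lift]
    ring
  -- Interchanging the two summations shows that RC⁻ is the transpose of RC⁺, so it imposes no
  -- further equations.
  have hm : ∀ b d, mixedForm M e ε (-1) (M.lift (- -1) (e b)) (M.lift (-1) (e d)) =
      einsteinTensor ε (fun a b c => M.g ⁅e a, e b⁆ (e c))
        (fun a b c => M.H ![e a, e b, e c]) d b / 4 := by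
    intro b d
    rw [mixedForm_apply, einsteinTensor, Finset.sum_comm, Finset.sum_div]
    refine Finset.sum_congr rfl fun a _ => ?_
    rw [Finset.sum_div]
    refine Finset.sum_congr rfl fun c _ => ?_
    rw [pairing_dorfman_lift, pairing_dorfman_lift]
    ring
  constructor
  · rintro ⟨⟨D, hD, hdiv⟩, hall⟩ b d
    have h1 := (hall D hD hdiv).1
      ⟨M.lift (-1) (e b), End.mem_eigenspace_iff.2 (M.G_lift (by norm_num) _)⟩
      ⟨M.lift 1 (e d), End.mem_eigenspace_iff.2 (M.G_lift (by norm_num) _)⟩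
    rw [h.ricciPlus_eq hD hdiv, hp] at h1
    linarith
  · intro h0
    refine ⟨⟨M.leviCivita, M.isLeviCivita_leviCivita, h.divergence_leviCivita⟩,
      fun D hD hdiv => ⟨fun v w => ?_, fun v w => ?_⟩⟩
    · rw [h.ricciPlus_eq hD hdiv]
      exact h.mixedForm_eq_zero (by norm_num) (fun b d => by rw [hp, h0, zero_div])
        (End.mem_eigenspace_iff.1 v.2) (End.mem_eigenspace_iff.1 w.2)
    · rw [h.ricciMinus_eq hD hdiv]
      exact h.mixedForm_eq_zero (by norm_num) (fun b d => by rw [hm, h0, zero_div])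
        (by rw [neg_neg]; exact End.mem_eigenspace_iff.1 v.2) (End.mem_eigenspace_iff.1 w.2)

end Existence

end GenMetric

end GenGeom

/-! ### Bases of `so(3)` and `so(2,1)` -/

namespace GenGeom

/-- A basis of a three-dimensional Lie algebra with `[f₀, f₁] = f₂`, `[f₁, f₂] = σ f₀` and
`[f₂, f₀] = f₁`. -/
structure IsCrossBasis {𝔫 : Type*} [LieRing 𝔫] [LieAlgebra ℝ 𝔫] (σ : ℝ) (f : Basis (Fin 3) ℝ 𝔫) :
    Prop where
  lie01 : ⁅f 0, f 1⁆ = f 2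
  lie12 : ⁅f 1, f 2⁆ = σ • f 0
  lie20 : ⁅f 2, f 0⁆ = f 1

theorem IsCrossBasis.map {𝔫 𝔪 : Type*} [LieRing 𝔫] [LieAlgebra ℝ 𝔫] [LieRing 𝔪] [LieAlgebra ℝ 𝔪]
    {σ : ℝ} {f : Basis (Fin 3) ℝ 𝔫} (h : IsCrossBasis σ f) (φ : 𝔫 ≃ₗ⁅ℝ⁆ 𝔪) :
    IsCrossBasis σ (f.map φ.toLinearEquiv) where
  lie01 := by simpa [h.lie01] using (φ.map_lie (f 0) (f 1)).symm
  lie12 := by simpa [h.lie12] using (φ.map_lie (f 1) (f 2)).symm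
  lie20 := by simpa [h.lie20] using (φ.map_lie (f 2) (f 0)).symm

/-- The coordinates of a skew-symmetric `3 × 3` matrix. -/
noncomputable def so3Equiv : SO3 ≃ₗ[ℝ] (Fin 3 → ℝ) where
  toFun A := ![A.1 2 1, A.1 0 2, A.1 1 0]
  invFun v := ⟨!![0, -v 2, v 1; v 2, 0, -v 0; -v 1, v 0, 0], by
    rw [LieAlgebra.Orthogonal.mem_so]
    ext i j
    fin_cases i <;> fin_cases j <;> simp⟩
  left_inv A := by
    have h := (LieAlgebra.Orthogonal.mem_so _ _ A.1).1 A.2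
    have h' : ∀ i j, A.1 j i = -A.1 i j := fun i j => congrFun (congrFun h i) j
    have h0 : ∀ i, A.1 i i = 0 := fun i => by linarith [h' i i]
    refine Subtype.ext ?_
    ext i j
    fin_cases i <;> fin_cases j <;> simp [h0]
    · exact (h' 1 0).symm
    · exact (h' 2 1).symm
    · exact (h' 0 2).symm
  right_inv v := by
    ext i
    fin_cases i <;> simp
  map_add' A B := by
    ext i
    fin_cases i <;> simp
  map_smul' c A := by
    ext i
    fin_cases i <;> simp

theorem exists_isCrossBasis_so3 : ∃ f : Basis (Fin 3) ℝ SO3, IsCrossBasis 1 f := by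
  refine ⟨Basis.ofEquivFun so3Equiv, ?_, ?_, ?_⟩ <;>
  · simp only [Basis.coe_ofEquivFun]
    refine Subtype.ext ?_
    simp only [LieSubalgebra.coe_bracket, so3Equiv, Ring.lie_def]
    ext i j
    fin_cases i <;> fin_cases j <;> simp

theorem mem_so21 (A : Matrix (Fin 2 ⊕ Fin 1) (Fin 2 ⊕ Fin 1) ℝ) :
    A ∈ LieAlgebra.Orthogonal.so' (Fin 2) (Fin 1) ℝ ↔
      A.transpose * LieAlgebra.Orthogonal.indefiniteDiagonal (Fin 2) (Fin 1) ℝ =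
        LieAlgebra.Orthogonal.indefiniteDiagonal (Fin 2) (Fin 1) ℝ * -A := by
  rw [LieAlgebra.Orthogonal.so', mem_skewAdjointMatricesLieSubalgebra,
    mem_skewAdjointMatricesSubmodule]
  rfl

/-- The coordinates of an element of `so(2,1)`. -/
noncomputable def so21Equiv : SO21 ≃ₗ[ℝ] (Fin 3 → ℝ) where
  toFun A := ![A.1 (.inl 1) (.inl 0), A.1 (.inl 0) (.inr 0), A.1 (.inl 1) (.inr 0)]
  invFun v := ⟨Matrix.fromBlocks !![0, -v 0; v 0, 0] !![v 1; v 2] !![v 1, v 2] !![0], by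
    rw [mem_so21]
    ext i j
    rcases i with i | i <;> rcases j with j | j <;> fin_cases i <;> fin_cases j <;>
      simp [LieAlgebra.Orthogonal.indefiniteDiagonal]⟩
  left_inv A := by
    have h := (mem_so21 A.1).1 A.2
    have h' : ∀ i j, _ := fun i j => congrFun (congrFun h i) j
    simp only [LieAlgebra.Orthogonal.indefiniteDiagonal, Matrix.mul_diagonal,
      Matrix.diagonal_mul, Matrix.transpose_apply, Matrix.neg_apply] at h'
    have h00 := h' (.inl 0) (.inl 0)
    have h11 := h' (.inl 1) (.inl 1)
    have h22 := h' (.inr 0) (.inr 0)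
    have h01 := h' (.inl 0) (.inl 1)
    have h02 := h' (.inl 0) (.inr 0)
    have h12 := h' (.inl 1) (.inr 0)
    simp at h00 h11 h22 h01 h02 h12
    refine Subtype.ext ?_
    ext i j
    rcases i with i | i <;> rcases j with j | j <;> fin_cases i <;> fin_cases j <;>
      simp <;> linarith
  right_inv v := by
    ext i
    fin_cases i <;> simp
  map_add' A B := by
    ext i
    fin_cases i <;> simp
  map_smul' c A := by
    ext i
    fin_cases i <;> simp

theorem exists_isCrossBasis_so21 : ∃ f : Basis (Fin 3) ℝ SO21, IsCrossBasis (-1) f := by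
  refine ⟨Basis.ofEquivFun so21Equiv, ?_, ?_, ?_⟩ <;>
  · simp only [Basis.coe_ofEquivFun]
    refine Subtype.ext ?_
    simp only [LieSubalgebra.coe_bracket, so21Equiv, Ring.lie_def]
    ext i j
    rcases i with i | i <;> rcases j with j | j <;> fin_cases i <;> fin_cases j <;>
      simp [Matrix.mul_apply]

section

variable {𝔫 : Type*} [LieRing 𝔫] [LieAlgebra ℝ 𝔫]

theorem exists_isCrossBasis
    (h𝔫 : Nonempty (𝔫 ≃ₗ⁅ℝ⁆ SO3) ∨ Nonempty (𝔫 ≃ₗ⁅ℝ⁆ SO21)) :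
    ∃ (σ : ℝ) (f : Basis (Fin 3) ℝ 𝔫), σ ≠ 0 ∧ IsCrossBasis σ f := by
  rcases h𝔫 with ⟨⟨φ⟩⟩ | ⟨⟨φ⟩⟩
  · obtain ⟨f, hf⟩ := exists_isCrossBasis_so3
    exact ⟨1, _, one_ne_zero, hf.map φ.symm⟩
  · obtain ⟨f, hf⟩ := exists_isCrossBasis_so21
    exact ⟨-1, _, by norm_num, hf.map φ.symm⟩

/-- A linear map on the Lie algebra which vanishes on all brackets is zero. -/
theorem IsCrossBasis.eq_zero_of_lie {σ : ℝ} {f : Basis (Fin 3) ℝ 𝔫} (hf : IsCrossBasis σ f)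
    (hσ : σ ≠ 0) (φ : 𝔫 →ₗ[ℝ] ℝ) (hφ : ∀ x y : 𝔫, φ ⁅x, y⁆ = 0) : φ = 0 := by
  refine f.ext fun i => ?_
  rw [LinearMap.zero_apply]
  fin_cases i
  · have := hφ (f 1) (f 2)
    rw [hf.lie12, map_smul, smul_eq_mul] at this
    exact (mul_eq_zero.1 this).resolve_left hσ
  · exact hf.lie20 ▸ hφ (f 2) (f 0)
  · exact hf.lie01 ▸ hφ (f 0) (f 1)

/-- The functional tr ∘ ad vanishes on brackets, and the algebra is perfect. -/
theorem trace_ad_eq_zero {σ : ℝ} {f : Basis (Fin 3) ℝ 𝔫} (hf : IsCrossBasis σ f) (hσ : σ ≠ 0)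
    (x : 𝔫) : LinearMap.trace ℝ 𝔫 (LieAlgebra.ad ℝ 𝔫 x) = 0 := by
  have h := hf.eq_zero_of_lie hσ (LinearMap.trace ℝ 𝔫 ∘ₗ (LieAlgebra.ad ℝ 𝔫 : 𝔫 →ₗ[ℝ] End ℝ 𝔫))
    (fun x y => by
      simp only [LinearMap.comp_apply, LieHom.coe_toLinearMap, LieHom.map_lie]
      rw [Ring.lie_def, map_sub, LinearMap.trace_mul_comm, sub_self])
  exact LinearMap.congr_fun h x

/-- The bracket is the Euclidean cross product, so [x,z] is orthogonal to z and c|z|² = 0. With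
`so21_exists_eigenvector` this tells the two algebras apart. -/
theorem so3_eigenvalue (h : Nonempty (𝔫 ≃ₗ⁅ℝ⁆ SO3)) {x z : 𝔫} (hz : z ≠ 0) {c : ℝ}
    (hxz : ⁅x, z⁆ = c • z) : c = 0 := by
  obtain ⟨φ⟩ := h
  obtain ⟨f, hf⟩ := exists_isCrossBasis_so3
  replace hf := hf.map φ.symm
  set f := f.map φ.symm.toLinearEquiv
  have e10 : ⁅f 1, f 0⁆ = -f 2 := by rw [← lie_skew, hf.lie01]
  have e21 : ⁅f 2, f 1⁆ = -f 0 := by rw [← lie_skew, hf.lie12, one_smul]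
  have e02 : ⁅f 0, f 2⁆ = -f 1 := by rw [← lie_skew, hf.lie20]
  by_contra hc
  have hx := f.sum_repr x
  have hzz := f.sum_repr z
  rw [Fin.sum_univ_three] at hx hzz
  set x0 := f.repr x 0
  set x1 := f.repr x 1
  set x2 := f.repr x 2
  set z0 := f.repr z 0 with hz0
  set z1 := f.repr z 1 with hz1
  set z2 := f.repr z 2 with hz2
  have h2 : ⁅x, z⁆ = (x1 * z2 - x2 * z1) • f 0 + (x2 * z0 - x0 * z2) • f 1
      + (x0 * z1 - x1 * z0) • f 2 := by
    rw [← hx, ← hzz]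
    simp only [add_lie, lie_add, smul_lie, lie_smul, lie_self, hf.lie01, hf.lie12, hf.lie20, e10,
      e21, e02]
    module
  rw [hxz, ← hzz] at h2
  have hcoord := fun i => congrArg (fun w => f.repr w i) h2
  have c0 := hcoord 0
  have c1 := hcoord 1
  have c2 := hcoord 2
  simp at c0 c1 c2
  have hsq : c * (z0 ^ 2 + z1 ^ 2 + z2 ^ 2) = 0 := by
    linear_combination z0 * c0 + z1 * c1 + z2 * c2
  have hs := (mul_eq_zero.1 hsq).resolve_left hc
  have k0 : z0 = 0 := by nlinarith [sq_nonneg z0, sq_nonneg z1, sq_nonneg z2]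
  have k1 : z1 = 0 := by nlinarith [sq_nonneg z0, sq_nonneg z1, sq_nonneg z2]
  have k2 : z2 = 0 := by nlinarith [sq_nonneg z0, sq_nonneg z1, sq_nonneg z2]
  exact hz (by rw [← hzz, k0, k1, k2]; simp)

theorem so21_exists_eigenvector (h : Nonempty (𝔫 ≃ₗ⁅ℝ⁆ SO21)) :
    ∃ x z : 𝔫, z ≠ 0 ∧ ⁅x, z⁆ = z := by
  obtain ⟨φ⟩ := h
  obtain ⟨f, hf⟩ := exists_isCrossBasis_so21
  replace hf := hf.map φ.symm
  set f := f.map φ.symm.toLinearEquiv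
  refine ⟨f 1, f 0 - f 2, ?_, ?_⟩
  · rw [sub_ne_zero]
    exact f.injective.ne (by decide)
  · rw [lie_sub, hf.lie12, ← lie_skew, hf.lie01]
    module

end

end GenGeom

/-! ### Linear algebra of Lorentzian forms -/

namespace GenGeom

section Lorentzian

variable {V : Type*} [AddCommGroup V] [Module ℝ V] {B : LinearMap.BilinForm ℝ V}

theorem IsLorentzian.exists_neg (h : IsLorentzian B) : ∃ x, B x x < 0 := by
  obtain ⟨n, e, he⟩ := h
  exact ⟨e 0, by rw [he]; norm_num⟩

/-- A vector orthogonal to a timelike vector is spacelike. -/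
theorem IsLorentzian.pos_of_orthogonal (h : IsLorentzian B) {x y : V} (hx : B x x < 0)
    (hxy : B x y = 0) (hy : y ≠ 0) : 0 < B y y := by
  obtain ⟨n, e, he⟩ := h
  have hB : ∀ u v, B u v = -(e.repr u 0 * e.repr v 0)
      + ∑ i : Fin n, e.repr u i.succ * e.repr v i.succ := by
    intro u v
    conv_lhs => rw [← e.sum_repr u, ← e.sum_repr v]
    simp only [map_sum, map_smul, LinearMap.sum_apply, LinearMap.smul_apply, he, smul_eq_mul,
      mul_ite, mul_one, mul_zero]
    rw [Fin.sum_univ_succ]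
    simp [Fin.succ_ne_zero, mul_comm]
  -- Cauchy–Schwarz for the spacelike parts: orthogonality turns their product into x₀y₀, while x₀²
  -- exceeds the squared spacelike part of x.
  have hcs := Finset.sum_mul_sq_le_sq_mul_sq Finset.univ (fun i : Fin n => e.repr x i.succ)
    (fun i : Fin n => e.repr y i.succ)
  have hsq : ∀ u, ∑ i : Fin n, e.repr u i.succ * e.repr u i.succ =
      ∑ i : Fin n, e.repr u i.succ ^ 2 := fun u =>
    Finset.sum_congr rfl fun i _ => (pow_two _).symm
  rw [hB, hsq] at hx
  rw [hB] at hxy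
  rw [hB, hsq]
  have hS : ∑ i : Fin n, e.repr x i.succ * e.repr y i.succ = e.repr x 0 * e.repr y 0 := by
    linarith
  rw [hS] at hcs
  have hx0 : 0 ≤ ∑ i : Fin n, e.repr x i.succ ^ 2 := Finset.sum_nonneg fun i _ => sq_nonneg _
  have hy0 : 0 ≤ ∑ i : Fin n, e.repr y i.succ ^ 2 := Finset.sum_nonneg fun i _ => sq_nonneg _
  rcases hy0.eq_or_lt with h0 | h0
  · exfalso
    rw [← h0, mul_zero] at hcs
    have hxx : e.repr x 0 ≠ 0 := by
      intro h1
      rw [h1] at hx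
      linarith
    have hyy : e.repr y 0 = 0 := by
      have : e.repr x 0 * e.repr y 0 = 0 := by nlinarith
      exact (mul_eq_zero.1 this).resolve_left hxx
    refine hy (e.repr.map_eq_zero_iff.1 (Finsupp.ext fun i => ?_))
    refine Fin.cases hyy (fun j => ?_) i
    have := (Finset.sum_eq_zero_iff_of_nonneg fun i _ => sq_nonneg _).1 h0.symm j
      (Finset.mem_univ j)
    simpa using this
  · by_contra hlt
    have h1 : ∑ i : Fin n, e.repr y i.succ ^ 2 ≤ e.repr y 0 * e.repr y 0 := by linarith
    nlinarith

/-- An orthogonal basis can be normalised. -/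
theorem exists_orthonormal_basis [FiniteDimensional ℝ V] {n : ℕ} (hn : finrank ℝ V = n)
    (hs : B.IsSymm) (hB : B.Nondegenerate) :
    ∃ (e : Basis (Fin n) ℝ V), (∀ i, B (e i) (e i) = 1 ∨ B (e i) (e i) = -1) ∧
      ∀ i j, i ≠ j → B (e i) (e j) = 0 := by
  have : Invertible (2 : ℝ) := invertibleOfNonzero two_ne_zero
  subst hn
  obtain ⟨v, hv⟩ := LinearMap.BilinForm.exists_orthogonal_basis ⟨hs.eq⟩
  have hne := hv.not_isOrtho_basis_self_of_separatingLeft hB.1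
  have hr : ∀ i, Real.sqrt |B (v i) (v i)| ≠ 0 := fun i =>
    (Real.sqrt_pos.2 (abs_pos.2 (hne i))).ne'
  refine ⟨v.isUnitSMul (fun i => (inv_ne_zero (hr i)).isUnit), fun i => ?_, fun i j hij => ?_⟩
  · simp only [Basis.isUnitSMul_apply, map_smul, LinearMap.smul_apply, smul_eq_mul]
    have h2 := Real.mul_self_sqrt (abs_nonneg (B (v i) (v i)))
    rw [← mul_assoc, ← mul_inv, h2]
    rcases lt_or_gt_of_ne (hne i) with h | h
    · right
      rw [abs_of_neg h, inv_neg, neg_mul, inv_mul_cancel₀ (hne i)]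
    · left
      rw [abs_of_pos h, inv_mul_cancel₀ (hne i)]
  · have := hv hij
    simp only [Function.onFun] at this
    simp only [Basis.isUnitSMul_apply, map_smul, LinearMap.smul_apply, smul_eq_mul]
    rw [show B (v i) (v j) = 0 from this, mul_zero, mul_zero]

end Lorentzian

section

variable {𝔤 : Type*} [LieRing 𝔤] [LieAlgebra ℝ 𝔤] (M : GenMetric 𝔤)

theorem GenMetric.exists_isOrthonormal {n : ℕ} (hn : finrank ℝ 𝔤 = n + 1)
    {v : Fin (n + 1) → 𝔤} {ε : Fin (n + 1) → ℝ} (hε : ∀ i, ε i * ε i = 1)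
    (hv : ∀ i, M.g (v i) (v i) = ε i) (hv' : ∀ i j, i < j → M.g (v i) (v j) = 0) :
    ∃ e : Basis (Fin (n + 1)) ℝ 𝔤, ⇑e = v ∧ M.IsOrthonormal e ε := by
  have ho : ∀ i j, i ≠ j → M.g (v i) (v j) = 0 := by
    intro i j hij
    rcases lt_or_gt_of_ne hij with h | h
    · exact hv' i j h
    · rw [M.symm.eq (v i) (v j)]
      exact hv' j i h
  have hli : LinearIndependent ℝ v := by
    refine LinearMap.linearIndependent_of_isOrthoᵢ (B := M.g) ?_ ?_
    · intro i j hij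
      exact ho i j hij
    · intro i h
      have h1 := hε i
      rw [← hv i, show M.g (v i) (v i) = 0 from h] at h1
      norm_num at h1
  have hc := coe_basisOfLinearIndependentOfCardEqFinrank hli (by simp [hn])
  exact ⟨_, hc, hε, by simpa [hc] using hv, by simpa [hc] using ho⟩

theorem fluxTensor_eq (H : 𝔤 [⋀^Fin 3]→ₗ[ℝ] ℝ) (e : Fin 4 → 𝔤) :
    (fun a b c => H ![e a, e b, e c]) =
      fluxTensor (H ![e 0, e 1, e 2]) ![H ![e 1, e 2, e 3], H ![e 2, e 0, e 3], H ![e 0, e 1, e 3]] := by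
  have l := alternating_swap_left H
  have r := alternating_swap_right H
  have z1 : ∀ X Y, H ![X, X, Y] = 0 := fun X Y => by linarith [l X X Y]
  have z2 : ∀ X Y, H ![X, Y, Y] = 0 := fun X Y => by linarith [r X Y Y]
  have z3 : ∀ X Y, H ![X, Y, X] = 0 := fun X Y => by rw [r, z1, neg_zero]
  funext a b c
  fin_cases a <;> fin_cases b <;> fin_cases c <;>
    simp [fluxTensor, z1, z2, z3]
  all_goals first
    | exact l _ _ _
    | exact r _ _ _
    | (rw [r, l, neg_neg]; done)
    | (rw [l, r, neg_neg]; done)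
    | (rw [l, r, l]; done)
    | rw [r, l, r, neg_neg]

end

end GenGeom

/-! ### Frames adapted to the splitting -/

namespace GenGeom

theorem prod_lie {𝔫 : Type*} [LieRing 𝔫] (x y : 𝔫 × ℝ) : ⁅x, y⁆ = (⁅x.1, y.1⁆, 0) := by
  rw [← real_lie_eq_zero x.2 y.2]
  rfl

variable {𝔫 : Type*} [LieRing 𝔫] [LieAlgebra ℝ 𝔫] (M : GenMetric (𝔫 × ℝ))

theorem GenMetric.gn_apply (x y : 𝔫) : M.gn x y = M.g (x, 0) (y, 0) := rfl

theorem GenMetric.gn_comm (x y : 𝔫) : M.gn x y = M.gn y x := M.symm.eq (x, 0) (y, 0)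

/-- Three orthonormal vectors of `𝔫`, with the signs `σ, 1, 1`, and a unit normal of `𝔫`. -/
structure IsSplitFrame (σ η : ℝ) (f : Fin 3 → 𝔫) (n : 𝔫 × ℝ) : Prop where
  sign : σ = 1 ∨ σ = -1
  sign_normal : η = 1 ∨ η = -1
  norm0 : M.gn (f 0) (f 0) = σ
  norm1 : M.gn (f 1) (f 1) = 1
  norm2 : M.gn (f 2) (f 2) = 1
  orthogonal01 : M.gn (f 0) (f 1) = 0
  orthogonal02 : M.gn (f 0) (f 2) = 0
  orthogonal12 : M.gn (f 1) (f 2) = 0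
  norm_normal : M.g n n = η
  normal : ∀ x : 𝔫, M.g (x, 0) n = 0

variable {M} {σ η : ℝ} {f : Fin 3 → 𝔫} {n : 𝔫 × ℝ}

variable [FiniteDimensional ℝ 𝔫]

theorem IsSplitFrame.exists_basis (h : IsSplitFrame M σ η f n) (hd : finrank ℝ (𝔫 × ℝ) = 4) :
    ∃ e : Basis (Fin 4) ℝ (𝔫 × ℝ), e 0 = (f 0, 0) ∧ e 1 = (f 1, 0) ∧ e 2 = (f 2, 0) ∧ e 3 = n ∧
      M.IsOrthonormal e ![σ, 1, 1, η] := by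
  have hε : ∀ i, ![σ, 1, 1, η] i * ![σ, 1, 1, η] i = 1 := by
    intro i
    fin_cases i
    · rcases h.sign with rfl | rfl <;> simp
    · simp
    · simp
    · rcases h.sign_normal with rfl | rfl <;> simp
  obtain ⟨e, he, ho⟩ := M.exists_isOrthonormal (v := ![(f 0, 0), (f 1, 0), (f 2, 0), n]) hd hε
    (by
      intro i
      fin_cases i
      · exact h.norm0
      · exact h.norm1
      · exact h.norm2
      · exact h.norm_normal)
    (by
      intro i j hij
      fin_cases i <;> fin_cases j <;> first
        | exact absurd hij (by decide)
        | exact h.normal _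
        | exact h.orthogonal01
        | exact h.orthogonal02
        | exact h.orthogonal12)
  exact ⟨e, by simp [he], by simp [he], by simp [he], by simp [he], ho⟩

theorem IsSplitFrame.sum_eq (h : IsSplitFrame M σ η f n) (hd : finrank ℝ (𝔫 × ℝ) = 4) (x : 𝔫) :
    x = (σ * M.gn (f 0) x) • f 0 + M.gn (f 1) x • f 1 + M.gn (f 2) x • f 2 := by
  obtain ⟨e, h0, h1, h2, h3, ho⟩ := h.exists_basis hd
  have hx := e.sum_repr (x, 0)
  have hn : M.g n (x, 0) = 0 := by rw [M.symm.eq, h.normal]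
  simp only [Fin.sum_univ_four, ho.repr_eq, h0, h1, h2, h3, hn] at hx
  simpa [GenMetric.gn_apply] using (congrArg Prod.fst hx).symm

theorem IsSplitFrame.gn_eq (h : IsSplitFrame M σ η f n) (hd : finrank ℝ (𝔫 × ℝ) = 4) (x y : 𝔫) :
    M.gn x y = σ * M.gn (f 0) x * M.gn (f 0) y + M.gn (f 1) x * M.gn (f 1) y
      + M.gn (f 2) x * M.gn (f 2) y := by
  conv_lhs => rw [h.sum_eq hd x]
  simp

theorem IsSplitFrame.isRiemannian (h : IsSplitFrame M 1 η f n) (hd : finrank ℝ (𝔫 × ℝ) = 4) :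
    IsRiemannian M.gn := by
  intro x hx
  rw [h.gn_eq hd]
  have hne : M.gn (f 0) x ≠ 0 ∨ M.gn (f 1) x ≠ 0 ∨ M.gn (f 2) x ≠ 0 := by
    by_contra! hc
    refine hx ?_
    rw [h.sum_eq hd x, hc.1, hc.2.1, hc.2.2]
    simp
  rcases hne with hc | hc | hc <;>
  · have := mul_self_pos.2 hc
    nlinarith [mul_self_nonneg (M.gn (f 0) x), mul_self_nonneg (M.gn (f 1) x),
      mul_self_nonneg (M.gn (f 2) x)]

theorem IsSplitFrame.exists_basis_ideal (h : IsSplitFrame M σ η f n)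
    (hd : finrank ℝ (𝔫 × ℝ) = 4) : ∃ o : Basis (Fin 3) ℝ 𝔫, ⇑o = f := by
  have hsp : ⊤ ≤ Submodule.span ℝ (Set.range f) := by
    intro x _
    rw [h.sum_eq hd x]
    refine add_mem (add_mem ?_ ?_) ?_ <;>
    exact Submodule.smul_mem _ _ (Submodule.subset_span ⟨_, rfl⟩)
  have hli : LinearIndependent ℝ f := by
    rw [Fintype.linearIndependent_iff]
    intro c hc i
    rw [Fin.sum_univ_three] at hc
    have hσ : σ ≠ 0 := by rcases h.sign with rfl | rfl <;> norm_num
    have h10 := M.gn_comm (f 1) (f 0)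
    have h20 := M.gn_comm (f 2) (f 0)
    have h21 := M.gn_comm (f 2) (f 1)
    have k := fun i => congrArg (M.gn (f i)) hc
    have k0 := k 0
    have k1 := k 1
    have k2 := k 2
    simp [h.norm0, h.norm1, h.norm2, h.orthogonal01, h.orthogonal02, h.orthogonal12, h10, h20,
      h21, hσ] at k0 k1 k2
    fin_cases i <;> assumption
  exact ⟨Basis.mk hli hsp, Basis.coe_mk hli hsp⟩

theorem IsSplitFrame.trace_eq (h : IsSplitFrame M σ η f n) (hd : finrank ℝ (𝔫 × ℝ) = 4)
    (T : 𝔫 →ₗ[ℝ] 𝔫) : LinearMap.trace ℝ 𝔫 T =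
      σ * M.gn (f 0) (T (f 0)) + M.gn (f 1) (T (f 1)) + M.gn (f 2) (T (f 2)) := by
  obtain ⟨o, ho⟩ := h.exists_basis_ideal hd
  have hr : ∀ x, ⇑(o.repr x) = ![σ * M.gn (f 0) x, M.gn (f 1) x, M.gn (f 2) x] := by
    intro x
    have hx := h.sum_eq hd x
    simp only [← ho] at hx ⊢
    conv_lhs => rw [hx]
    ext i
    fin_cases i <;> simp
  rw [LinearMap.trace_eq_matrix_trace ℝ o, Matrix.trace, Fin.sum_univ_three]
  simp [LinearMap.toMatrix_apply, hr, ho]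

theorem IsSplitFrame.isLorentzian (h : IsSplitFrame M (-1) η f n)
    (hd : finrank ℝ (𝔫 × ℝ) = 4) : IsLorentzian M.gn := by
  obtain ⟨o, ho⟩ := h.exists_basis_ideal hd
  refine ⟨2, o, fun i j => ?_⟩
  have h10 := M.gn_comm (f 1) (f 0)
  have h20 := M.gn_comm (f 2) (f 0)
  have h21 := M.gn_comm (f 2) (f 1)
  fin_cases i <;> fin_cases j <;>
    simp [ho, h.norm0, h.norm1, h.norm2, h.orthogonal01, h.orthogonal02, h.orthogonal12, h10, h20,
      h21]

variable (M)

/-- Subtract from (0,1) its orthogonal projection to `𝔫`. The result is not null, since otherwise it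
would lie in the radical of `g`. -/
theorem GenMetric.exists_normal (hnd : M.gn.Nondegenerate) :
    ∃ n : 𝔫 × ℝ, (∀ x : 𝔫, M.g (x, 0) n = 0) ∧ (M.g n n = 1 ∨ M.g n n = -1) := by
  obtain ⟨Z, hZ, hZZ⟩ : ∃ Z : 𝔫 × ℝ, (∀ x : 𝔫, M.g (x, 0) Z = 0) ∧ M.g Z Z ≠ 0 := by
    set ψ : Dual ℝ 𝔫 := M.g (0, 1) ∘ₗ LinearMap.inl ℝ 𝔫 ℝ
    set w := (M.gn.toDual hnd).symm ψ
    have hw : ∀ x, M.gn w x = M.g (0, 1) (x, 0) := fun x =>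
      LinearMap.BilinForm.apply_toDual_symm_apply (hB := hnd) ψ x
    have hZ : ∀ x : 𝔫, M.g (x, 0) (-w, 1) = 0 := by
      intro x
      have h1 : ((-w, 1) : 𝔫 × ℝ) = (0, 1) - (w, 0) := by simp
      rw [M.symm.eq, h1, map_sub, LinearMap.sub_apply, ← hw, GenMetric.gn_apply, sub_self]
    refine ⟨(-w, 1), hZ, fun h0 => ?_⟩
    have h2 : ((-w, 1) : 𝔫 × ℝ) = 0 := by
      refine M.nondeg.1 _ fun y => ?_
      have h3 : y = (y.1 + y.2 • w, 0) + y.2 • (-w, 1) := by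
        ext <;> simp
      rw [h3, map_add, map_smul, h0, M.symm.eq, hZ]
      simp
    simpa using congrArg Prod.snd h2
  have hr : Real.sqrt |M.g Z Z| ≠ 0 := (Real.sqrt_pos.2 (abs_pos.2 hZZ)).ne'
  refine ⟨(Real.sqrt |M.g Z Z|)⁻¹ • Z, fun x => by rw [map_smul, hZ, smul_zero], ?_⟩
  have h2 := Real.mul_self_sqrt (abs_nonneg (M.g Z Z))
  simp only [map_smul, LinearMap.smul_apply, smul_eq_mul]
  rw [← mul_assoc, ← mul_inv, h2]
  rcases lt_or_gt_of_ne hZZ with h | h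
  · right
    rw [abs_of_neg h, inv_neg, neg_mul, inv_mul_cancel₀ hZZ]
  · left
    rw [abs_of_pos h, inv_mul_cancel₀ hZZ]

theorem exists_isSplitFrame (h3 : finrank ℝ 𝔫 = 3) (hM : IsLorentzian M.g)
    (hnd : M.gn.Nondegenerate) :
    ∃ (σ : ℝ) (f : Fin 3 → 𝔫) (n : 𝔫 × ℝ), IsSplitFrame M σ (-σ) f n := by
  have hd : finrank ℝ (𝔫 × ℝ) = 4 := by simp [h3]
  obtain ⟨n, hn, hnn⟩ := M.exists_normal hnd
  obtain ⟨o, ho, ho'⟩ := exists_orthonormal_basis (B := M.gn) h3 ⟨M.gn_comm⟩ hnd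
  have hne : ∀ i, ((o i, 0) : 𝔫 × ℝ) ≠ 0 := fun i h => o.ne_zero i (congrArg Prod.fst h)
  by_cases hneg : ∃ i, M.gn (o i) (o i) = -1
  · obtain ⟨i, hi⟩ := hneg
    have hlt : M.g (o i, 0) (o i, 0) < 0 := by
      rw [← GenMetric.gn_apply, hi]
      norm_num
    have hpos : ∀ j, i ≠ j → M.gn (o j) (o j) = 1 := by
      intro j hj
      have : 0 < M.gn (o j) (o j) := hM.pos_of_orthogonal hlt (ho' i j hj) (hne j)
      refine (ho j).resolve_right fun h => ?_
      rw [h] at this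
      norm_num at this
    -- The swap moves the timelike vector to position 0, as the frame convention requires.
    set τ := Equiv.swap 0 i
    have hτ0 : τ 0 = i := Equiv.swap_apply_left _ _
    have hτ : ∀ j, j ≠ 0 → i ≠ τ j := fun j hj h => hj (τ.injective (h ▸ hτ0.symm ▸ rfl))
    refine ⟨-1, o ∘ τ, n, Or.inr rfl, Or.inl (by norm_num), ?_, hpos _ (hτ 1 (by decide)),
      hpos _ (hτ 2 (by decide)), ho' _ _ (τ.injective.ne (by decide)),
      ho' _ _ (τ.injective.ne (by decide)), ho' _ _ (τ.injective.ne (by decide)), ?_, hn⟩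
    · simp only [Function.comp_apply, hτ0, hi]
    · have hn0 : n ≠ 0 := by
        rintro rfl
        simp at hnn
      have := hM.pos_of_orthogonal hlt (hn _) hn0
      rw [neg_neg]
      refine hnn.resolve_right fun h => ?_
      rw [h] at this
      norm_num at this
  · push Not at hneg
    have h1 := fun i => (ho i).resolve_right (hneg i)
    refine ⟨1, o, n, Or.inl rfl, Or.inr rfl, h1 0, h1 1, h1 2, ho' _ _ (by decide),
      ho' _ _ (by decide), ho' _ _ (by decide), hnn.resolve_left fun h => ?_, hn⟩
    -- If `𝔫` and the normal were both spacelike, `g` would be positive semi-definite, contradicting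
    -- the timelike vector x below.
    obtain ⟨e, e0, e1, e2, e3, he⟩ := IsSplitFrame.exists_basis (M := M) (σ := 1) (η := 1) (f := o)
      (n := n) ⟨Or.inl rfl, Or.inl rfl, h1 0, h1 1, h1 2, ho' _ _ (by decide),
      ho' _ _ (by decide), ho' _ _ (by decide), h, hn⟩ hd
    obtain ⟨x, hx⟩ := hM.exists_neg
    have hr : ∀ i, e.repr x i = M.g (e i) x := by
      intro i
      rw [he.repr_eq]
      fin_cases i <;> simp
    have hxx := congrArg (fun y => M.g y x) (e.sum_repr x)
    simp only [map_sum, LinearMap.sum_apply, map_smul, LinearMap.smul_apply, ← hr,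
      smul_eq_mul] at hxx
    have : 0 ≤ ∑ i, e.repr x i * e.repr x i := Finset.sum_nonneg fun i _ => mul_self_nonneg _
    linarith

end GenGeom

/-! ### The Einstein condition is a scalar frame -/

namespace GenGeom

variable {𝔫 : Type*} [LieRing 𝔫] [LieAlgebra ℝ 𝔫] {M : GenMetric (𝔫 × ℝ)} {σ η : ℝ}
  {f : Fin 3 → 𝔫} {n : 𝔫 × ℝ}

theorem IsSplitFrame.structureTensor_eq (h : IsSplitFrame M σ η f n) {p q r s t u : ℝ}
    {y : Fin 3 → ℝ} (hy : n.1 = y 0 • f 0 + y 1 • f 1 + y 2 • f 2)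
    (h01 : ∀ i, M.gn ⁅f 0, f 1⁆ (f i) = ![r, t, u] i)
    (h20 : ∀ i, M.gn ⁅f 2, f 0⁆ (f i) = ![q, s, t] i)
    (h12 : ∀ i, M.gn ⁅f 1, f 2⁆ (f i) = ![σ * p, σ * q, σ * r] i)
    {e : Fin 4 → 𝔫 × ℝ} (he : e = ![(f 0, 0), (f 1, 0), (f 2, 0), n]) :
    (fun a b c => M.g ⁅e a, e b⁆ (e c)) = structureTensor σ p q r s t u y := by
  have l10 : ⁅f 1, f 0⁆ = -⁅f 0, f 1⁆ := (lie_skew _ _).symm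
  have l02 : ⁅f 0, f 2⁆ = -⁅f 2, f 0⁆ := (lie_skew _ _).symm
  have l21 : ⁅f 2, f 1⁆ = -⁅f 1, f 2⁆ := (lie_skew _ _).symm
  have hg : ∀ x z : 𝔫, M.g (x, 0) (z, 0) = M.gn x z := fun _ _ => rfl
  subst he
  funext a b c
  rw [prod_lie]
  fin_cases a <;> fin_cases b <;> fin_cases c <;>
    simp only [Fin.zero_eta, Fin.mk_one, Fin.reduceFinMk, structureTensor, Matrix.cons_val,
      h.normal, hy, hg, add_lie, lie_add, smul_lie, lie_smul, lie_self, l10, l02, l21, h01, h20,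
      h12, map_add, map_smul, map_neg, map_zero, LinearMap.add_apply, LinearMap.smul_apply,
      LinearMap.neg_apply, LinearMap.zero_apply, smul_eq_mul]
  all_goals ring1

variable (M) in
/-- A split frame in which the bracket of `𝔫` is `ρ` times the cross product and `H = a e¹²³`. -/
structure IsScalarFrame (σ η ρ a : ℝ) (f : Fin 3 → 𝔫) (n : 𝔫 × ℝ) : Prop
    extends IsSplitFrame M σ η f n where
  ne_zero : ρ ≠ 0
  sq : ρ ^ 2 = a ^ 2
  lie01 : ⁅f 0, f 1⁆ = ρ • f 2
  lie12 : ⁅f 1, f 2⁆ = (σ * ρ) • f 0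
  lie20 : ⁅f 2, f 0⁆ = ρ • f 1
  flux : M.H ![(f 0, 0), (f 1, 0), (f 2, 0)] = a
  flux_normal : ∀ x y : 𝔫, M.H ![(x, 0), (y, 0), n] = 0

variable [FiniteDimensional ℝ 𝔫]

theorem IsScalarFrame.fluxTensor_eq {ρ a : ℝ} (h : IsScalarFrame M σ η ρ a f n)
    {e : Fin 4 → 𝔫 × ℝ} (he : e = ![(f 0, 0), (f 1, 0), (f 2, 0), n]) :
    (fun i j k => M.H ![e i, e j, e k]) = fluxTensor a 0 := by
  subst he
  rw [GenGeom.fluxTensor_eq]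
  simp only [Matrix.cons_val, h.flux, h.flux_normal]
  congr 1
  ext i
  fin_cases i <;> rfl

theorem IsScalarFrame.isGeneralisedEinstein {ρ a : ℝ} (h : IsScalarFrame M σ η ρ a f n)
    (hd : finrank ℝ (𝔫 × ℝ) = 4) : M.IsGeneralisedEinstein 0 := by
  obtain ⟨e, h0, h1, h2, h3, ho⟩ := h.exists_basis hd
  have he : ⇑e = ![(f 0, 0), (f 1, 0), (f 2, 0), n] := by
    ext1 i
    fin_cases i <;> assumption
  have h10 := M.gn_comm (f 1) (f 0)
  have h20 := M.gn_comm (f 2) (f 0)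
  have h21 := M.gn_comm (f 2) (f 1)
  have hσ : σ * σ = 1 := by rcases h.sign with rfl | rfl <;> norm_num
  have hn : n.1 = _ := h.sum_eq hd n.1
  rw [ho.isGeneralisedEinstein_zero_iff, h.fluxTensor_eq he,
    h.structureTensor_eq (p := ρ * σ) (q := 0) (r := 0) (s := ρ) (t := 0) (u := ρ)
      (y := ![σ * M.gn (f 0) n.1, M.gn (f 1) n.1, M.gn (f 2) n.1]) hn ?_ ?_ ?_ he]
  · exact einsteinTensor_eq_zero_of_scalar h.sign h.sq _
  all_goals
    intro i
    fin_cases i <;>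
      simp [h.lie01, h.lie12, h.lie20, h.norm0, h.norm1, h.norm2, h.orthogonal01, h.orthogonal02,
        h.orthogonal12, h10, h20, h21]
  ring

/-- Unimodularity makes the bracket matrix symmetric, perfectness makes it injective; then
`symMatrix_eq_scalar_of_einsteinTensor` applies. -/
theorem IsSplitFrame.exists_isScalarFrame (h : IsSplitFrame M σ (-σ) f n)
    (hd : finrank ℝ (𝔫 × ℝ) = 4) {τ : ℝ} {b : Basis (Fin 3) ℝ 𝔫} (hb : IsCrossBasis τ b)
    (hτ : τ ≠ 0) (hE : M.IsGeneralisedEinstein 0) :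
    ∃ ρ a, IsScalarFrame M σ (-σ) ρ a f n := by
  obtain ⟨e, h0, h1, h2, h3, ho⟩ := h.exists_basis hd
  have he : ⇑e = ![(f 0, 0), (f 1, 0), (f 2, 0), n] := by
    ext1 i
    fin_cases i <;> assumption
  have hσ : σ * σ = 1 := by rcases h.sign with rfl | rfl <;> norm_num
  have h10 := M.gn_comm (f 1) (f 0)
  have h20 := M.gn_comm (f 2) (f 0)
  have h21 := M.gn_comm (f 2) (f 1)
  have l10 : ⁅f 1, f 0⁆ = -⁅f 0, f 1⁆ := (lie_skew _ _).symm
  have l02 : ⁅f 0, f 2⁆ = -⁅f 2, f 0⁆ := (lie_skew _ _).symm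
  have l21 : ⁅f 2, f 1⁆ = -⁅f 1, f 2⁆ := (lie_skew _ _).symm
  have htr := fun x => (h.trace_eq hd _).symm.trans (trace_ad_eq_zero hb hτ x)
  have t0 := htr (f 0)
  have t1 := htr (f 1)
  have t2 := htr (f 2)
  simp only [LieAlgebra.ad_apply, lie_self, l10, l02, l21, map_zero, map_neg, mul_zero] at t0 t1 t2
  have c0 := M.gn_comm ⁅f 0, f 1⁆
  have c1 := M.gn_comm ⁅f 2, f 0⁆
  have c2 := M.gn_comm ⁅f 1, f 2⁆
  -- The vanishing traces of ad(fᵢ) are exactly the symmetry of the bracket matrix.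
  have T02 : M.gn (f 2) ⁅f 2, f 0⁆ = M.gn (f 1) ⁅f 0, f 1⁆ := by linarith
  have T12 : M.gn (f 2) ⁅f 1, f 2⁆ = σ * M.gn (f 0) ⁅f 0, f 1⁆ := by linarith
  have T11 : M.gn (f 1) ⁅f 1, f 2⁆ = σ * M.gn (f 0) ⁅f 2, f 0⁆ := by linarith
  have hs := h.structureTensor_eq (p := σ * M.gn (f 0) ⁅f 1, f 2⁆) (q := M.gn (f 0) ⁅f 2, f 0⁆)
    (r := M.gn (f 0) ⁅f 0, f 1⁆) (s := M.gn (f 1) ⁅f 2, f 0⁆) (t := M.gn (f 1) ⁅f 0, f 1⁆)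
    (u := M.gn (f 2) ⁅f 0, f 1⁆) (h.sum_eq hd n.1)
    (y := ![σ * M.gn (f 0) n.1, M.gn (f 1) n.1, M.gn (f 2) n.1])
    (by intro i; fin_cases i <;> simp [c0])
    (by intro i; fin_cases i <;> simp [c1, T02])
    (by intro i; fin_cases i <;> simp [c2, T12, T11, ← mul_assoc, hσ]) he
  rw [ho.isGeneralisedEinstein_zero_iff, hs, GenGeom.fluxTensor_eq] at hE
  have hl : ∀ v, (symMatrix (σ * M.gn (f 0) ⁅f 1, f 2⁆) (M.gn (f 0) ⁅f 2, f 0⁆)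
      (M.gn (f 0) ⁅f 0, f 1⁆) (M.gn (f 1) ⁅f 2, f 0⁆) (M.gn (f 1) ⁅f 0, f 1⁆)
      (M.gn (f 2) ⁅f 0, f 1⁆)).mulVec v = 0 → v = 0 := by
    intro v hv
    have hv' := fun i => congrFun hv i
    have v0 := hv' 0
    have v1 := hv' 1
    have v2 := hv' 2
    simp only [symMatrix, Matrix.mulVec, dotProduct, Fin.sum_univ_three, Matrix.of_apply,
      Matrix.cons_val, Pi.zero_apply] at v0 v1 v2
    -- A kernel vector of the bracket matrix gives a functional that vanishes on all brackets, hence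
    -- is zero.
    obtain ⟨φ, hφ⟩ : ∃ φ : 𝔫 →ₗ[ℝ] ℝ, ∀ x, φ x =
        v 0 * M.gn (f 0) x + v 1 * M.gn (f 1) x + v 2 * M.gn (f 2) x :=
      ⟨v 0 • M.gn (f 0) + v 1 • M.gn (f 1) + v 2 • M.gn (f 2), fun x => by simp⟩
    have hφ0 : φ = 0 := by
      refine hb.eq_zero_of_lie hτ φ fun x y => ?_
      have b01 : φ ⁅f 0, f 1⁆ = 0 := by
        rw [hφ]
        linear_combination v2
      have b20 : φ ⁅f 2, f 0⁆ = 0 := by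
        rw [hφ, T02]
        linear_combination v1
      have b12 : φ ⁅f 1, f 2⁆ = 0 := by
        rw [hφ, T12, T11]
        linear_combination σ * v0 - v 0 * M.gn (f 0) ⁅f 1, f 2⁆ * hσ
      rw [h.sum_eq hd x, h.sum_eq hd y]
      generalize σ * M.gn (f 0) x = x0, M.gn (f 1) x = x1, M.gn (f 2) x = x2,
        σ * M.gn (f 0) y = y0, M.gn (f 1) y = y1, M.gn (f 2) y = y2
      simp only [lie_add, add_lie, smul_lie, lie_smul, lie_self, l10, l02, l21, map_add, map_smul,
        map_neg, map_zero, b01, b20, b12, smul_zero, neg_zero, add_zero]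
    have k := fun i => (hφ (f i)).symm.trans (LinearMap.congr_fun hφ0 (f i))
    have k0 := k 0
    have k1 := k 1
    have k2 := k 2
    simp [h.norm0, h.norm1, h.norm2, h.orthogonal01, h.orthogonal02, h.orthogonal12, h10, h20,
      h21] at k0 k1 k2
    ext i
    fin_cases i
    · exact k0.resolve_right fun h0 => by simp [h0] at hσ
    · exact k1
    · exact k2
  obtain ⟨hx, ρ, hρ, hsq, hL⟩ := symMatrix_eq_scalar_of_einsteinTensor h.sign hl hE
  have L := fun i j => congrFun (congrFun hL i) j
  have L00 := L 0 0
  have L01 := L 0 1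
  have L02 := L 0 2
  have L11 := L 1 1
  have L12 := L 1 2
  have L22 := L 2 2
  simp [symMatrix, lorentz] at L00 L01 L02 L11 L12 L22
  have hx' := fun i => congrFun hx i
  have x0 := hx' 0
  have x1 := hx' 1
  have x2 := hx' 2
  simp only [Matrix.cons_val, Pi.zero_apply, h0, h1, h2, h3] at x0 x1 x2
  have hlin : ∀ Y, M.H ![(f 0, 0), Y, n] = 0 → M.H ![(f 1, 0), Y, n] = 0 →
      M.H ![(f 2, 0), Y, n] = 0 → ∀ x : 𝔫, M.H ![(x, 0), Y, n] = 0 := by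
    intro Y y0 y1 y2 x
    have hx0 := congrArg (LinearMap.inl ℝ 𝔫 ℝ) (h.sum_eq hd x)
    simp only [map_add, map_smul, LinearMap.inl_apply] at hx0
    rw [hx0, M.H.map_vecCons_add ![Y, n], M.H.map_vecCons_add ![Y, n],
      M.H.map_vecCons_smul ![Y, n], M.H.map_vecCons_smul ![Y, n], M.H.map_vecCons_smul ![Y, n],
      y0, y1, y2]
    simp
  have hself : ∀ X, M.H ![X, X, n] = 0 := fun X => by
    linarith [alternating_swap_left M.H X X n]
  have hsw := fun X Y => alternating_swap_left M.H X Y n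
  refine ⟨ρ, M.H ![e 0, e 1, e 2], h, hρ, hsq, ?_, ?_, ?_, by rw [h0, h1, h2], ?_⟩
  · rw [h.sum_eq hd ⁅f 0, f 1⁆, L02, L12, L22]
    simp
  · rw [h.sum_eq hd ⁅f 1, f 2⁆, L00, T11, T12, L01, L02]
    simp [mul_comm]
  · rw [h.sum_eq hd ⁅f 2, f 0⁆, L01, L11, T02, L12]
    simp
  · intro x y
    refine hlin _ ?_ ?_ ?_ x <;> rw [hsw, neg_eq_zero] <;>
    · refine hlin _ ?_ ?_ ?_ y <;> first
        | exact hself _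
        | assumption
        | (rw [hsw, neg_eq_zero]; assumption)

end GenGeom

/-! ### Invariance of scalar frames under rotation -/

namespace GenGeom

variable {𝔫 : Type*} [LieRing 𝔫] [LieAlgebra ℝ 𝔫] [FiniteDimensional ℝ 𝔫]
  {M : GenMetric (𝔫 × ℝ)} {σ η ρ a : ℝ} {f : Fin 3 → 𝔫} {n : 𝔫 × ℝ}

theorem eq_smul_e123 {𝔤 : Type*} [LieRing 𝔤] [LieAlgebra ℝ 𝔤] {H : 𝔤 [⋀^Fin 3]→ₗ[ℝ] ℝ}
    {e : Basis (Fin 4) ℝ 𝔤} (h : (fun i j k => H ![e i, e j, e k]) = fluxTensor a 0) :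
    H = a • e123 e := by
  have h1 : (fun i j k => e123 e ![e i, e j, e k]) = fluxTensor 1 0 := by
    rw [fluxTensor_eq]
    congr 1
    · rw [e123_apply, Matrix.det_fin_three]
      simp
    · ext i
      fin_cases i <;> simp [e123_apply, Matrix.det_fin_three]
  refine Basis.ext_alternating e fun v _ => ?_
  have hv : (fun i => e (v i)) = ![e (v 0), e (v 1), e (v 2)] := by
    ext1 i
    fin_cases i <;> rfl
  have h2 := congrFun (congrFun (congrFun h (v 0)) (v 1)) (v 2)
  have h3 := congrFun (congrFun (congrFun h1 (v 0)) (v 1)) (v 2)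
  rw [hv, AlternatingMap.smul_apply, smul_eq_mul, h2, h3]
  generalize v 0 = i, v 1 = j, v 2 = k
  fin_cases i <;> fin_cases j <;> fin_cases k <;> simp [fluxTensor]

namespace IsScalarFrame

theorem exists_basis' (h : IsScalarFrame M σ η ρ a f n) (hd : finrank ℝ (𝔫 × ℝ) = 4) :
    ∃ e : Basis (Fin 4) ℝ (𝔫 × ℝ), ⇑e = ![(f 0, 0), (f 1, 0), (f 2, 0), n] ∧
      M.IsOrthonormal e ![σ, 1, 1, η] ∧ M.H = a • e123 e := by
  obtain ⟨e, h0, h1, h2, h3, ho⟩ := h.exists_basis hd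
  have he : ⇑e = ![(f 0, 0), (f 1, 0), (f 2, 0), n] := by
    ext1 i
    fin_cases i <;> assumption
  exact ⟨e, he, ho, eq_smul_e123 (h.fluxTensor_eq he)⟩

theorem lie_eq (h : IsScalarFrame M σ η ρ a f n) (hd : finrank ℝ (𝔫 × ℝ) = 4) (x y : 𝔫) :
    ⁅x, y⁆ =
      (σ * ρ * (M.gn (f 1) x * M.gn (f 2) y - M.gn (f 2) x * M.gn (f 1) y)) • f 0
      + (σ * ρ * (M.gn (f 2) x * M.gn (f 0) y - M.gn (f 0) x * M.gn (f 2) y)) • f 1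
      + (σ * ρ * (M.gn (f 0) x * M.gn (f 1) y - M.gn (f 1) x * M.gn (f 0) y)) • f 2 := by
  have l10 : ⁅f 1, f 0⁆ = -⁅f 0, f 1⁆ := (lie_skew _ _).symm
  have l02 : ⁅f 0, f 2⁆ = -⁅f 2, f 0⁆ := (lie_skew _ _).symm
  have l21 : ⁅f 2, f 1⁆ = -⁅f 1, f 2⁆ := (lie_skew _ _).symm
  conv_lhs => rw [h.sum_eq hd x, h.sum_eq hd y]
  generalize M.gn (f 0) x = x0, M.gn (f 1) x = x1, M.gn (f 2) x = x2,
    M.gn (f 0) y = y0, M.gn (f 1) y = y1, M.gn (f 2) y = y2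
  simp only [lie_add, add_lie, smul_lie, lie_smul, lie_self, l10, l02, l21, h.lie01, h.lie12,
    h.lie20]
  module

theorem gn_lie (h : IsScalarFrame M σ η ρ a f n) (hd : finrank ℝ (𝔫 × ℝ) = 4) (x y z : 𝔫) :
    M.gn ⁅x, y⁆ z = σ * ρ *
      ((M.gn (f 1) x * M.gn (f 2) y - M.gn (f 2) x * M.gn (f 1) y) * M.gn (f 0) z
      + (M.gn (f 2) x * M.gn (f 0) y - M.gn (f 0) x * M.gn (f 2) y) * M.gn (f 1) z
      + (M.gn (f 0) x * M.gn (f 1) y - M.gn (f 1) x * M.gn (f 0) y) * M.gn (f 2) z) := by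
  rw [h.lie_eq hd x y]
  simp only [map_add, map_smul, LinearMap.add_apply, LinearMap.smul_apply, smul_eq_mul]
  ring

/-- Ad-invariance of the metric on `𝔫`: the form g([x,y],z) is a multiple of a determinant. -/
theorem gn_lie_left (h : IsScalarFrame M σ η ρ a f n) (hd : finrank ℝ (𝔫 × ℝ) = 4) (x y z : 𝔫) :
    M.gn ⁅x, y⁆ z = M.gn x ⁅y, z⁆ := by
  rw [M.gn_comm x, h.gn_lie hd, h.gn_lie hd]
  ring

/-- The identity for the triple cross product. It allows brackets to be computed from inner products
alone, without the frame. -/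
theorem lie_lie (h : IsScalarFrame M σ η ρ a f n) (hd : finrank ℝ (𝔫 × ℝ) = 4) (x y z : 𝔫) :
    ⁅x, ⁅y, z⁆⁆ = (σ * ρ ^ 2) • (M.gn x z • y - M.gn x y • z) := by
  have hσ : σ * σ = 1 := by rcases h.sign with rfl | rfl <;> norm_num
  have g0 : ∀ w, M.gn (f 0) ⁅y, w⁆ = _ := fun w => (M.gn_comm _ _).trans (h.gn_lie hd y w (f 0))
  have g1 : ∀ w, M.gn (f 1) ⁅y, w⁆ = _ := fun w => (M.gn_comm _ _).trans (h.gn_lie hd y w (f 1))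
  have g2 : ∀ w, M.gn (f 2) ⁅y, w⁆ = _ := fun w => (M.gn_comm _ _).trans (h.gn_lie hd y w (f 2))
  have h10 := M.gn_comm (f 1) (f 0)
  have h20 := M.gn_comm (f 2) (f 0)
  have h21 := M.gn_comm (f 2) (f 1)
  rw [h.lie_eq hd x, g0, g1, g2, h.gn_eq hd x y, h.gn_eq hd x z]
  conv_rhs => rw [h.sum_eq hd y, h.sum_eq hd z]
  simp only [h.norm0, h.norm1, h.norm2, h.orthogonal01, h.orthogonal02, h.orthogonal12, h10, h20,
    h21, map_add, map_smul, smul_eq_mul]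
  generalize M.gn (f 0) x = x0, M.gn (f 1) x = x1, M.gn (f 2) x = x2,
    M.gn (f 0) y = y0, M.gn (f 1) y = y1, M.gn (f 2) y = y2,
    M.gn (f 0) z = z0, M.gn (f 1) z = z1, M.gn (f 2) z = z2
  rcases h.sign with rfl | rfl <;> module

/-- On `𝔫`, H is a/ρ times the form g([x,y],z), so the constant a survives a change of frame. -/
theorem flux_eq (h : IsScalarFrame M σ η ρ a f n) (hd : finrank ℝ (𝔫 × ℝ) = 4) (x y z : 𝔫) :
    ρ * M.H ![(x, 0), (y, 0), (z, 0)] = a * M.gn ⁅x, y⁆ z := by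
  obtain ⟨e, he, ho, hH⟩ := h.exists_basis' hd
  have hg : ∀ x z : 𝔫, M.g (x, 0) (z, 0) = M.gn x z := fun _ _ => rfl
  rw [hH, h.gn_lie hd, AlternatingMap.smul_apply, e123_apply, Matrix.det_fin_three]
  simp [ho.repr_eq, he, hg]
  ring

/-- A scalar frame can be replaced by one that contains two given orthonormal vectors. -/
theorem rotate (h : IsScalarFrame M σ η ρ a f n) (hd : finrank ℝ (𝔫 × ℝ) = 4) {u v : 𝔫}
    (hu : M.gn u u = σ) (hv : M.gn v v = 1) (huv : M.gn u v = 0) :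
    IsScalarFrame M σ η ρ a ![u, ρ⁻¹ • ⁅v, u⁆, v] n := by
  -- The middle vector is dictated by [f₂,f₀] = ρf₁. The remaining brackets follow from `lie_lie`,
  -- and the flux from `flux_eq`.
  have hσ : σ * σ = 1 := by rcases h.sign with rfl | rfl <;> norm_num
  have hρ := h.ne_zero
  have hvu : M.gn v u = 0 := by rw [M.gn_comm, huv]
  have hlu : M.gn u ⁅v, u⁆ = 0 := by rw [M.gn_comm, h.gn_lie_left hd, lie_self, map_zero]
  have hlv : M.gn ⁅v, u⁆ v = 0 := by
    have h1 := h.gn_lie_left hd v u v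
    rw [← lie_skew u v, map_neg, M.gn_comm v ⁅v, u⁆] at h1
    linarith
  have l01 : ⁅u, ρ⁻¹ • ⁅v, u⁆⁆ = ρ • v := by
    rw [lie_smul, h.lie_lie hd, hu, huv]
    have : ρ⁻¹ * (σ * ρ ^ 2) * σ = ρ := by
      field_simp
      linear_combination hσ
    rw [zero_smul, sub_zero, smul_smul, smul_smul, this]
  refine ⟨⟨h.sign, h.sign_normal, hu, ?_, hv, ?_, huv, ?_, h.norm_normal, h.normal⟩, hρ, h.sq, l01,
    ?_, ?_, ?_, h.flux_normal⟩
  · simp only [Matrix.cons_val, map_smul, LinearMap.smul_apply, smul_eq_mul]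
    rw [h.gn_lie_left hd, h.lie_lie hd, hu, huv]
    simp only [map_smul, map_sub, smul_eq_mul, hv, hvu]
    field_simp
    linear_combination hσ
  · simp [hlu]
  · simp [hlv]
  · simp only [Matrix.cons_val]
    rw [smul_lie, ← lie_skew, h.lie_lie hd, hv, hvu, zero_smul, zero_sub, one_smul, smul_neg,
      smul_neg, smul_neg, neg_neg, smul_smul]
    congr 1
    field_simp
  · simp only [Matrix.cons_val]
    rw [smul_inv_smul₀ hρ]
  · have h1 := h.flux_eq hd u (ρ⁻¹ • ⁅v, u⁆) v
    rw [l01, map_smul, LinearMap.smul_apply, hv, smul_eq_mul, mul_one, mul_comm a] at h1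
    exact mul_left_cancel₀ hρ h1

theorem isAdapted (h : IsScalarFrame M σ η ρ a f n) {e : Basis (Fin 4) ℝ (𝔫 × ℝ)}
    (he : ⇑e = ![(f 0, 0), (f 1, 0), (f 2, 0), n]) (ho : M.IsOrthonormal e ![σ, 1, 1, η])
    (hH : M.H = a • e123 e) : IsAdapted M a e where
  ne_zero h0 := h.ne_zero (by simpa [h0] using h.sq)
  norm i := by
    rw [ho.norm]
    have := h.sign
    have := h.sign_normal
    fin_cases i <;> first | simp; done | simpa
  orthogonal := ho.orthogonal
  span := by
    refine le_antisymm (Submodule.span_le.2 ?_) ?_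
    · rintro x (rfl | rfl | rfl) <;> simp [he]
    · rintro _ ⟨x, rfl⟩
      have hn : M.g n (x, 0) = 0 := by rw [M.symm.eq, h.normal]
      rw [← e.sum_repr (LinearMap.inl ℝ 𝔫 ℝ x), Fin.sum_univ_four, ho.repr_eq _ 3]
      have h3 : e 3 = n := by simp [he]
      rw [h3, LinearMap.inl_apply, hn, mul_zero, zero_smul, add_zero]
      refine add_mem (add_mem ?_ ?_) ?_ <;>
      exact Submodule.smul_mem _ _ (Submodule.subset_span (by simp))
  H_eq := hH

theorem fst_eq_of_lie (h : IsScalarFrame M σ η ρ a f n) (hd : finrank ℝ (𝔫 × ℝ) = 4) {x : 𝔫}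
    (hx : ∀ i, ⁅x, f i⁆ = 0) : x = 0 := by
  have h10 := M.gn_comm (f 1) (f 0)
  have h20 := M.gn_comm (f 2) (f 0)
  have h21 := M.gn_comm (f 2) (f 1)
  have hσ : σ ≠ 0 := by rcases h.sign with rfl | rfl <;> norm_num
  have k := fun i j => congrArg (M.gn (f j)) (hx i)
  have k12 := k 1 2
  have k10 := k 1 0
  have k02 := k 0 2
  rw [M.gn_comm, h.gn_lie hd] at k12 k10 k02
  simp [h.norm0, h.norm1, h.norm2, h.orthogonal01, h.orthogonal02, h.orthogonal12, h10, h20,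
    h21, hσ, h.ne_zero] at k12 k10 k02
  rw [h.sum_eq hd x, k12, k10, k02]
  simp

end IsScalarFrame

end GenGeom

/-! ### The families in terms of the projected normal -/

namespace GenGeom

variable {𝔫 : Type*} [LieRing 𝔫] [LieAlgebra ℝ 𝔫] [FiniteDimensional ℝ 𝔫]
  {M : GenMetric (𝔫 × ℝ)} {σ η ρ a ε : ℝ}

theorem IsAdapted.exists_isScalarFrame {e : Basis (Fin 4) ℝ (𝔫 × ℝ)} (h : IsAdapted M a e)
    (hσ : σ = 1 ∨ σ = -1) (hε : ε = 1 ∨ ε = -1) (h0 : M.g (e 0) (e 0) = σ)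
    (h1 : M.g (e 1) (e 1) = 1) (h2 : M.g (e 2) (e 2) = 1) (l01 : ⁅e 0, e 1⁆ = (ε * a) • e 2)
    (l12 : ⁅e 1, e 2⁆ = (σ * (ε * a)) • e 0) (l20 : ⁅e 2, e 0⁆ = (ε * a) • e 1) :
    ∃ f : Fin 3 → 𝔫, e 0 = (f 0, 0) ∧ e 1 = (f 1, 0) ∧ e 2 = (f 2, 0) ∧
      IsScalarFrame M σ (M.g (e 3) (e 3)) (ε * a) a f (e 3) := by
  have hmem : ∀ x ∈ ({e 0, e 1, e 2} : Set (𝔫 × ℝ)), ∃ y : 𝔫, (y, 0) = x := by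
    intro x hx
    have : x ∈ LinearMap.range (LinearMap.inl ℝ 𝔫 ℝ) := h.span ▸ Submodule.subset_span hx
    exact this
  obtain ⟨f0, hf0⟩ := hmem (e 0) (by simp)
  obtain ⟨f1, hf1⟩ := hmem (e 1) (by simp)
  obtain ⟨f2, hf2⟩ := hmem (e 2) (by simp)
  refine ⟨![f0, f1, f2], hf0.symm, hf1.symm, hf2.symm, ⟨⟨hσ, ?_, ?_, ?_, ?_, ?_, ?_, ?_, rfl, ?_⟩,
    ?_, ?_, ?_, ?_, ?_, ?_, ?_⟩⟩
  · exact h.norm 3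
  · simpa [M.gn_apply, hf0] using h0
  · simpa [M.gn_apply, hf1] using h1
  · simpa [M.gn_apply, hf2] using h2
  · simpa [M.gn_apply, hf0, hf1] using h.orthogonal 0 1 (by decide)
  · simpa [M.gn_apply, hf0, hf2] using h.orthogonal 0 2 (by decide)
  · simpa [M.gn_apply, hf1, hf2] using h.orthogonal 1 2 (by decide)
  · have hle : Submodule.span ℝ {e 0, e 1, e 2} ≤ LinearMap.ker (M.g.flip (e 3)) := by
      refine Submodule.span_le.2 ?_
      rintro x (rfl | rfl | rfl)
      · exact h.orthogonal 0 3 (by decide)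
      · exact h.orthogonal 1 3 (by decide)
      · exact h.orthogonal 2 3 (by decide)
    rw [h.span] at hle
    exact fun x => hle ⟨x, rfl⟩
  · have := h.ne_zero
    rcases hε with rfl | rfl <;> simpa
  · rcases hε with rfl | rfl <;> ring
  · have := congrArg Prod.fst l01
    rwa [← hf0, ← hf1, ← hf2, prod_lie] at this
  · have := congrArg Prod.fst l12
    rwa [← hf0, ← hf1, ← hf2, prod_lie] at this
  · have := congrArg Prod.fst l20
    rwa [← hf0, ← hf1, ← hf2, prod_lie] at this
  · simp [hf0, hf1, hf2, h.H_eq, e123_apply, Matrix.det_fin_three]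
  · intro x y
    simp [h.H_eq, e123_apply, Matrix.det_fin_three]

/-- The normal acts through its projection to `𝔫`, and `𝔫` has trivial centre, so the brackets with
the normal determine the projection. -/
theorem IsScalarFrame.fst_eq {f : Fin 3 → 𝔫} {n : 𝔫 × ℝ} (h : IsScalarFrame M σ η ρ a f n)
    (hd : finrank ℝ (𝔫 × ℝ) = 4) {w : 𝔫} (h0 : ⁅n, (f 0, (0 : ℝ))⁆ = (⁅w, f 0⁆, 0))
    (h1 : ⁅n, (f 1, (0 : ℝ))⁆ = (⁅w, f 1⁆, 0)) (h2 : ⁅n, (f 2, (0 : ℝ))⁆ = (⁅w, f 2⁆, 0)) :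
    n.1 = w := by
  rw [prod_lie] at h0 h1 h2
  refine sub_eq_zero.1 (h.fst_eq_of_lie hd fun i => ?_)
  rw [sub_lie, sub_eq_zero]
  fin_cases i
  · exact congrArg Prod.fst h0
  · exact congrArg Prod.fst h1
  · exact congrArg Prod.fst h2

theorem IsScalarFrame.exists_sign {f : Fin 3 → 𝔫} {n : 𝔫 × ℝ} (h : IsScalarFrame M σ η ρ a f n) :
    ∃ ε : ℝ, (ε = 1 ∨ ε = -1) ∧ ε * a = ρ := by
  rcases sq_eq_sq_iff_eq_or_eq_neg.1 h.sq with h1 | h1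
  · exact ⟨1, Or.inl rfl, by rw [h1, one_mul]⟩
  · exact ⟨-1, Or.inr rfl, by rw [h1, neg_one_mul]⟩

/-- The bracket parameter and the length of the projection are related by b = yρ, where ρ = εa. The
other families are translated in the same way. -/
theorem familyRiemannian_iff (hd : finrank ℝ (𝔫 × ℝ) = 4) :
    FamilyRiemannian M ↔ Nonempty (𝔫 ≃ₗ⁅ℝ⁆ SO3) ∧ ∃ (η ρ a y : ℝ) (f : Fin 3 → 𝔫) (n : 𝔫 × ℝ),
      IsScalarFrame M 1 η ρ a f n ∧ n.1 = y • f 0 := by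
  constructor
  · rintro ⟨hso, hR, a, b, ε, e, hε, hA, l01, l12, l20, l23, l31, l30⟩
    have hp : ∀ i, (e i).2 = 0 → M.g (e i) (e i) = 1 := by
      intro i hi
      have h1 : e i = ((e i).1, 0) := Prod.ext rfl hi
      have h2 : (e i).1 ≠ 0 := fun h0 => e.ne_zero i (Prod.ext h0 hi)
      have h3 : 0 < M.g (e i) (e i) := by
        rw [h1]
        exact hR _ h2
      refine (hA.norm i).resolve_right fun h4 => ?_
      rw [h4] at h3
      norm_num at h3
    have hz : ∀ i j k (c : ℝ), c ≠ 0 → ⁅e i, e j⁆ = c • e k → (e k).2 = 0 := by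
      intro i j k c hc h
      have := congrArg Prod.snd h
      rw [prod_lie] at this
      exact (mul_eq_zero.1 this.symm).resolve_left hc
    have hρ : ε * a ≠ 0 := by
      have := hA.ne_zero
      rcases hε with rfl | rfl <;> simpa
    obtain ⟨f, hf0, hf1, hf2, hS⟩ := hA.exists_isScalarFrame (Or.inl rfl) hε
      (hp 0 (hz _ _ _ _ hρ l12)) (hp 1 (hz _ _ _ _ hρ l20)) (hp 2 (hz _ _ _ _ hρ l01)) l01
      (by rw [l12, one_mul]) l20
    refine ⟨hso, _, _, _, b / (ε * a), f, _, hS, hS.fst_eq hd ?_ ?_ ?_⟩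
    · rw [← hf0, l30, smul_lie, lie_self, smul_zero]
      rfl
    · rw [← hf1, l31, smul_lie, hS.lie01, smul_smul, div_mul_cancel₀ _ hρ, hf2]
      ext <;> simp
    · rw [← hf2, ← lie_skew, l23, smul_lie, ← lie_skew, hS.lie20, smul_neg, smul_smul,
        div_mul_cancel₀ _ hρ, hf1]
      ext <;> simp
  · rintro ⟨hso, η, ρ, a, y, f, n, h, hn⟩
    obtain ⟨e, he, ho, hH⟩ := h.exists_basis' hd
    obtain ⟨ε, hε, hεa⟩ := h.exists_sign
    have e0 : e 0 = (f 0, 0) := by simp [he]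
    have e1 : e 1 = (f 1, 0) := by simp [he]
    have e2 : e 2 = (f 2, 0) := by simp [he]
    have e3 : e 3 = n := by simp [he]
    refine ⟨hso, h.isRiemannian hd, a, y * ρ, ε, e, hε, h.isAdapted he ho hH, ?_⟩
    simp only [hεa, e0, e1, e2, e3, prod_lie, hn, smul_lie, lie_smul, lie_self, h.lie01, h.lie12,
      h.lie20]
    refine ⟨?_, ?_, ?_, ?_, ?_, ?_⟩ <;> ext <;> simp [smul_smul]

theorem IsLorentzianFrame.exists_isScalarFrame {e : Basis (Fin 4) ℝ (𝔫 × ℝ)}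
    (h : IsLorentzianFrame M a ε e) (hM : IsLorentzian M.g) :
    ∃ f : Fin 3 → 𝔫, e 0 = (f 0, 0) ∧ e 1 = (f 1, 0) ∧ e 2 = (f 2, 0) ∧
      IsScalarFrame M (-1) 1 (ε * a) a f (e 3) := by
  have hp : ∀ i, 0 ≠ i → M.g (e i) (e i) = 1 := by
    intro i hi
    have h3 := hM.pos_of_orthogonal (by rw [h.timelike]; norm_num) (h.adapted.orthogonal 0 i hi)
      (e.ne_zero i)
    refine (h.adapted.norm i).resolve_right fun h4 => ?_
    rw [h4] at h3
    norm_num at h3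
  have hS := h.adapted.exists_isScalarFrame (Or.inr rfl) h.sign h.timelike (hp 1 (by decide))
    (hp 2 (by decide)) h.lie01 (by rw [h.lie12, neg_one_mul, neg_smul]) h.lie20
  rwa [hp 3 (by decide)] at hS

theorem IsScalarFrame.exists_isLorentzianFrame {f : Fin 3 → 𝔫} {n : 𝔫 × ℝ}
    (h : IsScalarFrame M (-1) η ρ a f n) (hd : finrank ℝ (𝔫 × ℝ) = 4) :
    ∃ (ε : ℝ) (e : Basis (Fin 4) ℝ (𝔫 × ℝ)), IsLorentzianFrame M a ε e ∧
      e 0 = (f 0, 0) ∧ e 1 = (f 1, 0) ∧ e 2 = (f 2, 0) ∧ e 3 = n := by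
  obtain ⟨e, he, ho, hH⟩ := h.exists_basis' hd
  obtain ⟨ε, hε, hεa⟩ := h.exists_sign
  have e0 : e 0 = (f 0, 0) := by simp [he]
  have e1 : e 1 = (f 1, 0) := by simp [he]
  have e2 : e 2 = (f 2, 0) := by simp [he]
  refine ⟨ε, e, ⟨hε, h.isAdapted he ho hH, ho.norm 0, ?_, ?_, ?_⟩, e0, e1, e2, by simp [he]⟩ <;>
  · simp only [e0, e1, e2, prod_lie, hεa, h.lie01, h.lie12, h.lie20]
    ext <;> simp

theorem familyAlpha_iff (hd : finrank ℝ (𝔫 × ℝ) = 4) (hM : IsLorentzian M.g) :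
    FamilyAlpha M ↔ Nonempty (𝔫 ≃ₗ⁅ℝ⁆ SO21) ∧ ∃ (η ρ a y : ℝ) (f : Fin 3 → 𝔫) (n : 𝔫 × ℝ),
      IsScalarFrame M (-1) η ρ a f n ∧ n.1 = y • f 0 := by
  constructor
  · rintro ⟨hso, -, a, ε, b, e, hF, l30, l31, l32⟩
    obtain ⟨f, hf0, hf1, hf2, hS⟩ := hF.exists_isScalarFrame hM
    have hρ := hS.ne_zero
    have l02 : ⁅f 0, f 2⁆ = -⁅f 2, f 0⁆ := (lie_skew _ _).symm
    refine ⟨hso, _, _, _, b / (ε * a), f, _, hS, hS.fst_eq hd ?_ ?_ ?_⟩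
    · rw [← hf0, l30, smul_lie, lie_self, smul_zero]
      rfl
    · rw [← hf1, l31, smul_lie, hS.lie01, smul_smul, div_mul_cancel₀ _ hρ, hf2]
      ext <;> simp
    · rw [← hf2, l32, smul_lie, l02, hS.lie20, smul_neg, smul_smul, div_mul_cancel₀ _ hρ, hf1]
      ext <;> simp
  · rintro ⟨hso, η, ρ, a, y, f, n, h, hn⟩
    obtain ⟨ε, e, hF, e0, e1, e2, e3⟩ := h.exists_isLorentzianFrame hd
    have l02 : ⁅f 0, f 2⁆ = -⁅f 2, f 0⁆ := (lie_skew _ _).symm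
    refine ⟨hso, h.isLorentzian hd, a, ε, y * ρ, e, hF, ?_⟩
    simp only [e0, e1, e2, e3, prod_lie, hn, smul_lie, lie_self, h.lie01, h.lie20, l02]
    refine ⟨?_, ?_, ?_⟩ <;> ext <;> simp [smul_smul]

theorem familyBeta_iff (hd : finrank ℝ (𝔫 × ℝ) = 4) (hM : IsLorentzian M.g) :
    FamilyBeta M ↔ Nonempty (𝔫 ≃ₗ⁅ℝ⁆ SO21) ∧ ∃ (η ρ a y : ℝ) (f : Fin 3 → 𝔫) (n : 𝔫 × ℝ),
      IsScalarFrame M (-1) η ρ a f n ∧ y ≠ 0 ∧ n.1 = y • f 2 := by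
  constructor
  · rintro ⟨hso, -, a, ε, b, e, hF, hb, l30, l31, l32⟩
    obtain ⟨f, hf0, hf1, hf2, hS⟩ := hF.exists_isScalarFrame hM
    have hρ := hS.ne_zero
    have l21 : ⁅f 2, f 1⁆ = -⁅f 1, f 2⁆ := (lie_skew _ _).symm
    refine ⟨hso, _, _, _, b / (ε * a), f, _, hS, div_ne_zero hb hρ, hS.fst_eq hd ?_ ?_ ?_⟩
    · rw [← hf0, l30, smul_lie, hS.lie20, smul_smul, div_mul_cancel₀ _ hρ, hf1]
      ext <;> simp
    · rw [← hf1, l31, smul_lie, l21, hS.lie12, neg_one_mul, neg_smul, neg_neg, smul_smul,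
        div_mul_cancel₀ _ hρ, hf0]
      ext <;> simp
    · rw [← hf2, l32, smul_lie, lie_self, smul_zero]
      rfl
  · rintro ⟨hso, η, ρ, a, y, f, n, h, hy, hn⟩
    obtain ⟨ε, e, hF, e0, e1, e2, e3⟩ := h.exists_isLorentzianFrame hd
    have l21 : ⁅f 2, f 1⁆ = -⁅f 1, f 2⁆ := (lie_skew _ _).symm
    refine ⟨hso, h.isLorentzian hd, a, ε, y * ρ, e, hF, mul_ne_zero hy h.ne_zero, ?_⟩
    simp only [e0, e1, e2, e3, prod_lie, hn, smul_lie, lie_self, h.lie20, h.lie12, l21]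
    refine ⟨?_, ?_, ?_⟩ <;> ext <;> simp [smul_smul]

/-- No parameter occurs, as boosts of `𝔫` rescale a null vector; the factor ρ⁻¹ makes the bracket
coefficients equal to ±1. -/
theorem familyGamma_iff (hd : finrank ℝ (𝔫 × ℝ) = 4) (hM : IsLorentzian M.g) :
    FamilyGamma M ↔ Nonempty (𝔫 ≃ₗ⁅ℝ⁆ SO21) ∧ ∃ (η ρ a : ℝ) (f : Fin 3 → 𝔫) (n : 𝔫 × ℝ),
      IsScalarFrame M (-1) η ρ a f n ∧ n.1 = ρ⁻¹ • (f 0 + f 2) := by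
  constructor
  · rintro ⟨hso, -, a, ε, e, hF, l30, l31, l32⟩
    obtain ⟨f, hf0, hf1, hf2, hS⟩ := hF.exists_isScalarFrame hM
    have hρ := hS.ne_zero
    have l02 : ⁅f 0, f 2⁆ = -⁅f 2, f 0⁆ := (lie_skew _ _).symm
    have l21 : ⁅f 2, f 1⁆ = -⁅f 1, f 2⁆ := (lie_skew _ _).symm
    refine ⟨hso, _, _, _, f, _, hS, hS.fst_eq hd ?_ ?_ ?_⟩
    · rw [← hf0, l30, smul_lie, add_lie, lie_self, zero_add, hS.lie20, inv_smul_smul₀ hρ, hf1]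
    · rw [← hf1, l31, smul_lie, add_lie, l21, hS.lie12, hS.lie01, neg_one_mul, neg_smul, neg_neg,
        smul_add, inv_smul_smul₀ hρ, inv_smul_smul₀ hρ, hf0, hf2, add_comm]
      ext <;> simp
    · rw [← hf2, l32, smul_lie, add_lie, lie_self, add_zero, l02, hS.lie20, smul_neg,
        inv_smul_smul₀ hρ, hf1]
      ext <;> simp
  · rintro ⟨hso, η, ρ, a, f, n, h, hn⟩
    obtain ⟨ε, e, hF, e0, e1, e2, e3⟩ := h.exists_isLorentzianFrame hd
    have hρ := h.ne_zero
    have l02 : ⁅f 0, f 2⁆ = -⁅f 2, f 0⁆ := (lie_skew _ _).symm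
    have l21 : ⁅f 2, f 1⁆ = -⁅f 1, f 2⁆ := (lie_skew _ _).symm
    refine ⟨hso, h.isLorentzian hd, a, ε, e, hF, ?_⟩
    simp only [e0, e1, e2, e3, prod_lie, hn, smul_lie, add_lie, lie_self, h.lie01, h.lie20,
      h.lie12, l02, l21]
    refine ⟨?_, ?_, ?_⟩ <;> ext <;> simp [smul_smul, hρ, add_comm]

end GenGeom

/-! ### Normal forms and causal types -/

namespace GenGeom

variable {𝔫 : Type*} [LieRing 𝔫] [LieAlgebra ℝ 𝔫] [FiniteDimensional ℝ 𝔫]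
  {M : GenMetric (𝔫 × ℝ)} {σ η ρ a : ℝ} {f : Fin 3 → 𝔫} {n : 𝔫 × ℝ}

theorem exists_smul_eq_of_pos {V : Type*} [AddCommGroup V] [Module ℝ V]
    {B : LinearMap.BilinForm ℝ V} {s : ℝ} (hs : s * s = 1) {x : V} (hx : 0 < s * B x x) :
    ∃ r : ℝ, 0 < r ∧ B (r • x) (r • x) = s := by
  refine ⟨(Real.sqrt (s * B x x))⁻¹, inv_pos.2 (Real.sqrt_pos.2 hx), ?_⟩
  simp only [map_smul, LinearMap.smul_apply, smul_eq_mul]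
  rw [← mul_assoc, ← mul_inv, Real.mul_self_sqrt hx.le]
  field_simp
  have h0 : B x x ≠ 0 := by
    rintro h
    simp [h] at hx
  have h1 : s ≠ 0 := by
    rintro rfl
    simp at hs
  field_simp
  linarith

theorem IsLorentzian.gn_pos (hM : IsLorentzian M.g) {x y : 𝔫} (hx : M.gn x x < 0)
    (hxy : M.gn x y = 0) (hy : y ≠ 0) : 0 < M.gn y y :=
  hM.pos_of_orthogonal hx hxy fun h => hy (congrArg Prod.fst h)

namespace IsScalarFrame

/-- A scalar frame can be chosen to contain `u`, if the orthogonal space of `u` is positive. -/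
theorem exists_of_norm (h : IsScalarFrame M σ η ρ a f n) (hd : finrank ℝ (𝔫 × ℝ) = 4) {u : 𝔫}
    (hu : M.gn u u = σ) (hpos : ∀ w, w ≠ 0 → M.gn u w = 0 → 0 < M.gn w w) :
    ∃ f' : Fin 3 → 𝔫, f' 0 = u ∧ IsScalarFrame M σ η ρ a f' n := by
  have hu0 : u ≠ 0 := by
    rintro rfl
    rw [map_zero] at hu
    rcases h.sign with hσ | hσ <;> norm_num [hσ] at hu
  obtain ⟨i, hi⟩ : ∃ i, ⁅u, f i⁆ ≠ 0 := by
    by_contra! hc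
    exact hu0 (h.fst_eq_of_lie hd hc)
  have ho : M.gn u ⁅u, f i⁆ = 0 := by
    rw [← h.gn_lie_left hd, lie_self, map_zero, LinearMap.zero_apply]
  obtain ⟨r, -, hr⟩ := exists_smul_eq_of_pos (B := M.gn) (s := 1) (by norm_num)
    (by rw [one_mul]; exact hpos _ hi ho)
  exact ⟨_, rfl, h.rotate hd hu hr (by rw [map_smul, ho, smul_zero])⟩

/-- For the definite ad-invariant form, [x,z] = z would give g(z,z) = g(x,[z,z]) = 0. -/
theorem not_so21 (h : IsScalarFrame M 1 η ρ a f n) (hd : finrank ℝ (𝔫 × ℝ) = 4) :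
    ¬ Nonempty (𝔫 ≃ₗ⁅ℝ⁆ SO21) := by
  intro hso
  obtain ⟨x, z, hz, hxz⟩ := so21_exists_eigenvector hso
  have h1 := h.gn_lie_left hd x z z
  rw [lie_self, map_zero, hxz] at h1
  exact (h.isRiemannian hd z hz).ne' h1

/-- The null vector f₀ + f₂ is an eigenvector of ad(f₁) with eigenvalue −ρ ≠ 0. -/
theorem not_so3 (h : IsScalarFrame M (-1) η ρ a f n) : ¬ Nonempty (𝔫 ≃ₗ⁅ℝ⁆ SO3) := by
  intro hso
  have hne : f 0 + f 2 ≠ 0 := by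
    intro h0
    have := congrArg (M.gn (f 0)) h0
    simp [h.norm0, h.orthogonal02] at this
  refine h.ne_zero (neg_eq_zero.1 (so3_eigenvalue hso (x := f 1) hne ?_))
  rw [lie_add, h.lie12, ← lie_skew, h.lie01]
  module

theorem familyRiemannian (h : IsScalarFrame M 1 η ρ a f n) (hd : finrank ℝ (𝔫 × ℝ) = 4)
    (hso : Nonempty (𝔫 ≃ₗ⁅ℝ⁆ SO3)) : FamilyRiemannian M := by
  have hR := h.isRiemannian hd
  rw [familyRiemannian_iff hd]
  refine ⟨hso, ?_⟩
  by_cases hY : n.1 = 0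
  · exact ⟨_, _, _, 0, _, _, h, by rw [hY, zero_smul]⟩
  · obtain ⟨r, hr, hrn⟩ := exists_smul_eq_of_pos (B := M.gn) (s := 1) (x := n.1) (by norm_num)
      (by rw [one_mul]; exact hR _ hY)
    obtain ⟨f', hf', h'⟩ := h.exists_of_norm hd hrn fun w hw _ => hR w hw
    exact ⟨_, _, _, r⁻¹, _, _, h', by rw [hf', inv_smul_smul₀ hr.ne']⟩

/-- After a rotation, a timelike projection is a multiple of f₀, a spacelike one of f₂, and a null
one equals ρ⁻¹(f₀ + f₂). -/
theorem familyLorentzian (h : IsScalarFrame M (-1) η ρ a f n) (hd : finrank ℝ (𝔫 × ℝ) = 4)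
    (hM : IsLorentzian M.g) (hso : Nonempty (𝔫 ≃ₗ⁅ℝ⁆ SO21)) :
    FamilyAlpha M ∨ FamilyBeta M ∨ FamilyGamma M := by
  rw [familyAlpha_iff hd hM, familyBeta_iff hd hM, familyGamma_iff hd hM]
  by_cases hY : n.1 = 0
  · exact Or.inl ⟨hso, _, _, _, 0, _, _, h, by rw [hY, zero_smul]⟩
  have hneg : ∀ {u : 𝔫}, M.gn u u = -1 → M.gn u u < 0 := fun hu => by
    rw [hu]
    norm_num
  rcases lt_trichotomy (M.gn n.1 n.1) 0 with hlt | heq | hgt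
  · left
    obtain ⟨r, hr, hrn⟩ := exists_smul_eq_of_pos (B := M.gn) (s := -1) (x := n.1) (by norm_num)
      (by linarith)
    obtain ⟨f', hf', h'⟩ := h.exists_of_norm hd hrn fun w hw hw' => hM.gn_pos (hneg hrn) hw' hw
    exact ⟨hso, _, _, _, r⁻¹, _, _, h', by rw [hf', inv_smul_smul₀ hr.ne']⟩
  · right; right
    have hw : M.gn (f 0) n.1 ≠ 0 := fun h0 =>
      (hM.gn_pos (hneg h.norm0) h0 hY).ne' heq
    have hw' := M.gn_comm n.1 (f 0)
    have hρ := h.ne_zero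
    set c := M.gn (f 0) n.1
    -- A second null vector: the reflection of Y = n.1 in f₀^⊥, scaled so that g(Y,W') = −2/ρ. Then
    -- (ρY ± W')/2 are orthonormal, timelike and spacelike, with sum ρY.
    set W' := (-(ρ * c ^ 2)⁻¹) • (n.1 + (2 * c) • f 0) with hW'
    have h0 : M.gn W' W' = 0 := by
      have hc : M.gn (f 0) n.1 = c := rfl
      simp only [hW', map_smul, map_add, LinearMap.smul_apply, LinearMap.add_apply, h.norm0, heq,
        hw', hc, smul_eq_mul]
      ring
    have h1 : M.gn n.1 W' = -2 / ρ := by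
      simp only [hW', map_smul, map_add, heq, hw', smul_eq_mul]
      field_simp
      ring
    have h2 := (M.gn_comm W' n.1).trans h1
    have hu : M.gn ((2⁻¹ : ℝ) • (ρ • n.1 + W')) ((2⁻¹ : ℝ) • (ρ • n.1 + W')) = -1 := by
      simp only [map_smul, map_add, LinearMap.smul_apply, LinearMap.add_apply, smul_eq_mul, heq,
        h0, h1, h2]
      field_simp
      ring
    have hv : M.gn ((2⁻¹ : ℝ) • (ρ • n.1 - W')) ((2⁻¹ : ℝ) • (ρ • n.1 - W')) = 1 := by
      simp only [map_smul, map_sub, LinearMap.smul_apply, LinearMap.sub_apply, smul_eq_mul, heq,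
        h0, h1, h2]
      field_simp
      ring
    have huv : M.gn ((2⁻¹ : ℝ) • (ρ • n.1 + W')) ((2⁻¹ : ℝ) • (ρ • n.1 - W')) = 0 := by
      simp only [map_smul, map_add, map_sub, LinearMap.smul_apply, LinearMap.add_apply,
        smul_eq_mul, heq, h0, h1, h2]
      ring
    refine ⟨hso, _, _, _, _, _, h.rotate hd hu hv huv, ?_⟩
    have hs : (2⁻¹ : ℝ) • (ρ • n.1 + W') + (2⁻¹ : ℝ) • (ρ • n.1 - W') = ρ • n.1 := by module
    simp only [Matrix.cons_val]
    rw [hs, inv_smul_smul₀ hρ]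
  · right; left
    obtain ⟨r, hr, hv⟩ := exists_smul_eq_of_pos (B := M.gn) (s := 1) (x := n.1) (by norm_num)
      (by linarith)
    set v := r • n.1 with hvdef
    -- Removing from f₀ its component along the spacelike unit vector v keeps it timelike.
    have hlt : M.gn (f 0 - M.gn (f 0) v • v) (f 0 - M.gn (f 0) v • v) =
        -1 - M.gn (f 0) v ^ 2 := by
      simp only [map_smul, map_sub, LinearMap.smul_apply, LinearMap.sub_apply, smul_eq_mul,
        h.norm0, hv, M.gn_comm v (f 0)]
      ring
    have ho : M.gn (f 0 - M.gn (f 0) v • v) v = 0 := by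
      simp [hv]
    obtain ⟨t, -, hu⟩ := exists_smul_eq_of_pos (B := M.gn) (s := -1) (by norm_num)
      (x := f 0 - M.gn (f 0) v • v) (by rw [hlt]; nlinarith [sq_nonneg (M.gn (f 0) v)])
    refine ⟨hso, _, _, _, r⁻¹, _, _, h.rotate hd hu hv ?_, inv_ne_zero hr.ne', ?_⟩
    · rw [map_smul M.gn t, LinearMap.smul_apply, ho, smul_zero]
    · simp only [Matrix.cons_val]
      rw [hvdef, inv_smul_smul₀ hr.ne']

end IsScalarFrame

theorem IsSplitFrame.exists_eq_smul (h : IsSplitFrame M σ η f n) (hd : finrank ℝ (𝔫 × ℝ) = 4)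
    {X : 𝔫 × ℝ} (hX : ∀ y : 𝔫, M.g X (y, 0) = 0) (hX0 : X ≠ 0) :
    ∃ c : ℝ, c ≠ 0 ∧ X = c • n := by
  obtain ⟨e, h0, h1, h2, h3, ho⟩ := h.exists_basis hd
  have hX' : ∀ y : 𝔫, M.g (y, 0) X = 0 := fun y => by rw [M.symm.eq, hX]
  have hs := e.sum_repr X
  simp only [Fin.sum_univ_four, ho.repr_eq, h0, h1, h2, h3, hX', mul_zero, zero_smul,
    zero_add] at hs
  refine ⟨_, ?_, hs.symm⟩
  intro hc
  rw [hc, zero_smul] at hs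
  exact hX0 hs.symm

/-- A normal X is a non-zero multiple of the frame normal, so the sign of g on its projection is
read off from the normal form and depends on neither frame nor X. This also makes the three
Lorentzian families exclusive. -/
theorem FamilyAlpha.causal (hd : finrank ℝ (𝔫 × ℝ) = 4) (hM : IsLorentzian M.g) {X : 𝔫 × ℝ}
    (hX : ∀ y : 𝔫, M.g X (y, 0) = 0) (hX0 : X ≠ 0) (h : FamilyAlpha M) :
    M.gn X.1 X.1 < 0 ∨ X.1 = 0 := by
  obtain ⟨-, η, ρ, a, y, f, n, hS, hn⟩ := (familyAlpha_iff hd hM).1 h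
  obtain ⟨c, hc, rfl⟩ := hS.exists_eq_smul hd hX hX0
  by_cases hy : y = 0
  · right
    simp [hn, hy]
  · left
    have := mul_pos (sq_pos_of_ne_zero hc) (sq_pos_of_ne_zero hy)
    simp only [Prod.smul_fst, hn, map_smul, LinearMap.smul_apply, hS.norm0, smul_eq_mul]
    linarith

theorem FamilyBeta.causal (hd : finrank ℝ (𝔫 × ℝ) = 4) (hM : IsLorentzian M.g) {X : 𝔫 × ℝ}
    (hX : ∀ y : 𝔫, M.g X (y, 0) = 0) (hX0 : X ≠ 0) (h : FamilyBeta M) :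
    0 < M.gn X.1 X.1 := by
  obtain ⟨-, η, ρ, a, y, f, n, hS, hy, hn⟩ := (familyBeta_iff hd hM).1 h
  obtain ⟨c, hc, rfl⟩ := hS.exists_eq_smul hd hX hX0
  have := mul_pos (sq_pos_of_ne_zero hc) (sq_pos_of_ne_zero hy)
  simp only [Prod.smul_fst, hn, map_smul, LinearMap.smul_apply, hS.norm2, smul_eq_mul]
  linarith

theorem FamilyGamma.causal (hd : finrank ℝ (𝔫 × ℝ) = 4) (hM : IsLorentzian M.g) {X : 𝔫 × ℝ}
    (hX : ∀ y : 𝔫, M.g X (y, 0) = 0) (hX0 : X ≠ 0) (h : FamilyGamma M) :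
    M.gn X.1 X.1 = 0 ∧ X.1 ≠ 0 := by
  obtain ⟨-, η, ρ, a, f, n, hS, hn⟩ := (familyGamma_iff hd hM).1 h
  obtain ⟨c, hc, rfl⟩ := hS.exists_eq_smul hd hX hX0
  have h20 := M.gn_comm (f 2) (f 0)
  constructor
  · simp [hn, hS.norm0, hS.norm2, hS.orthogonal02, h20]
  · intro h0
    have := congrArg (M.gn (f 0)) h0
    simp [hn, hS.norm0, hS.orthogonal02, hc, hS.ne_zero] at this

end GenGeom

/-! ### The classification -/

theorem mainTheorem11 {𝔫 : Type*} [LieRing 𝔫] [LieAlgebra ℝ 𝔫] [FiniteDimensional ℝ 𝔫]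
    (h𝔫 : Nonempty (𝔫 ≃ₗ⁅ℝ⁆ GenGeom.SO3) ∨ Nonempty (𝔫 ≃ₗ⁅ℝ⁆ GenGeom.SO21))
    (M : GenGeom.GenMetric (𝔫 × ℝ)) (hM : GenGeom.IsLorentzian M.g)
    (hnd : M.gn.Nondegenerate) :
    -- the classification
    (M.IsGeneralisedEinstein 0 ↔
      GenGeom.FamilyRiemannian M ∨
        GenGeom.FamilyAlpha M ∨ GenGeom.FamilyBeta M ∨ GenGeom.FamilyGamma M) ∧
    -- the families are mutually exclusive
    (¬ (GenGeom.FamilyRiemannian M ∧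
        (GenGeom.FamilyAlpha M ∨ GenGeom.FamilyBeta M ∨ GenGeom.FamilyGamma M)) ∧
      ¬ (GenGeom.FamilyAlpha M ∧ GenGeom.FamilyBeta M) ∧
      ¬ (GenGeom.FamilyAlpha M ∧ GenGeom.FamilyGamma M) ∧
      ¬ (GenGeom.FamilyBeta M ∧ GenGeom.FamilyGamma M)) ∧
    -- the causal type of the projection `X.1` to `𝔫` of a normal `X` of length `±1`
    (∀ X : 𝔫 × ℝ, (∀ y : 𝔫, M.g X (y, 0) = 0) → (M.g X X = 1 ∨ M.g X X = -1) →
      (GenGeom.FamilyAlpha M → M.gn X.1 X.1 < 0 ∨ X.1 = 0) ∧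
      (GenGeom.FamilyBeta M → 0 < M.gn X.1 X.1) ∧
      (GenGeom.FamilyGamma M → M.gn X.1 X.1 = 0 ∧ X.1 ≠ 0)) := by
  open GenGeom in
  obtain ⟨τ, b, hτ, hb⟩ := exists_isCrossBasis h𝔫
  have h3 : finrank ℝ 𝔫 = 3 := by simp [finrank_eq_card_basis b]
  have hd : finrank ℝ (𝔫 × ℝ) = 4 := by simp [h3]
  have hlor : FamilyAlpha M ∨ FamilyBeta M ∨ FamilyGamma M →
      ∃ (η ρ a : ℝ) (f : Fin 3 → 𝔫) (n : 𝔫 × ℝ), IsScalarFrame M (-1) η ρ a f n := by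
    rintro (h | h | h)
    · obtain ⟨-, η, ρ, a, -, f, n, hS, -⟩ := (familyAlpha_iff hd hM).1 h
      exact ⟨η, ρ, a, f, n, hS⟩
    · obtain ⟨-, η, ρ, a, -, f, n, hS, -⟩ := (familyBeta_iff hd hM).1 h
      exact ⟨η, ρ, a, f, n, hS⟩
    · obtain ⟨-, η, ρ, a, f, n, hS, -⟩ := (familyGamma_iff hd hM).1 h
      exact ⟨η, ρ, a, f, n, hS⟩
  have hne : ∀ X : 𝔫 × ℝ, (M.g X X = 1 ∨ M.g X X = -1) → X ≠ 0 := by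
    rintro X hX rfl
    simp at hX
  obtain ⟨n, hn, hnn⟩ := M.exists_normal hnd
  have hn' : ∀ y : 𝔫, M.g n (y, 0) = 0 := fun y => by rw [M.symm.eq, hn]
  refine ⟨⟨fun hE => ?_, ?_⟩, ⟨?_, ?_, ?_, ?_⟩, fun X hX hXX => ⟨?_, ?_, ?_⟩⟩
  · obtain ⟨σ, f, n, hF⟩ := exists_isSplitFrame M h3 hM hnd
    obtain ⟨ρ, a, hS⟩ := hF.exists_isScalarFrame hd hb hτ hE
    -- The signature of `g` on `𝔫` determines the algebra: an invariant definite form excludes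
    -- `so(2,1)`, a Lorentzian scalar frame excludes `so(3)`.
    rcases hF.sign with rfl | rfl
    · exact Or.inl (hS.familyRiemannian hd (h𝔫.resolve_right (hS.not_so21 hd)))
    · exact Or.inr (hS.familyLorentzian hd hM (h𝔫.resolve_left hS.not_so3))
  · rintro (h | h)
    · obtain ⟨-, η, ρ, a, -, f, n, hS, -⟩ := (familyRiemannian_iff hd).1 h
      exact hS.isGeneralisedEinstein hd
    · obtain ⟨η, ρ, a, f, n, hS⟩ := hlor h
      exact hS.isGeneralisedEinstein hd
  · rintro ⟨⟨-, hR, -⟩, h⟩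
    obtain ⟨η, ρ, a, f, n, hS⟩ := hlor h
    have hf : f 0 ≠ 0 := by
      intro h0
      have := hS.norm0
      simp [h0] at this
    have := hR _ hf
    rw [hS.norm0] at this
    norm_num at this
  · rintro ⟨hα, hβ⟩
    have := FamilyBeta.causal hd hM hn' (hne n hnn) hβ
    rcases FamilyAlpha.causal hd hM hn' (hne n hnn) hα with h | h
    · exact lt_asymm h this
    · simp [h] at this
  · rintro ⟨hα, hγ⟩
    obtain ⟨h1, h2⟩ := FamilyGamma.causal hd hM hn' (hne n hnn) hγ
    exact (FamilyAlpha.causal hd hM hn' (hne n hnn) hα).elim (fun h => h.ne h1) h2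
  · rintro ⟨hβ, hγ⟩
    exact (FamilyBeta.causal hd hM hn' (hne n hnn) hβ).ne' (FamilyGamma.causal hd hM hn' (hne n hnn) hγ).1
  · exact FamilyAlpha.causal hd hM hX (hne X hXX)
  · exact FamilyBeta.causal hd hM hX (hne X hXX)
  · exact FamilyGamma.causal hd hM hX (hne X hXX)
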